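/- Let $k_\theta,k_\omega,\alpha,\beta>0$, $\kappa=k_\theta/\alpha^2$, $\vec\tau(\theta)=(\cos\theta,\sin\theta)$, and let $I\subset\mathbb R$ be an open set of times. For a function $u(\theta,\omega)\ge 0$ that is $2\pi$-periodic in $\theta$ put (integrals over $(-\pi,\pi]\times\mathbb R$) $$\rho_u=\int u\,d\theta d\omega,\quad J_u=\int\vec\tau(\theta)u\,d\theta d\omega,\quad \vec\tau(\bar\theta_u)=\Omega_u=\frac{J_u}{|J_u|}\ \ (\bar\theta_u\in(-\pi,\pi]),\quad \bar\omega_u=\frac1{\rho_u}\int\omega u\,d\theta d\omega,$$ $$Q(u)=-k_\theta\,\partial_\theta\big(\sin(\bar\theta_u-\theta)\,u\big)-k_\omega\,\partial_\omega\big((\bar\omega_u-\omega)\,u\big)+\alpha^2\partial_\theta^2u+\beta^2\partial_\omega^2u .$$ For every $\varepsilon>0$ let $f^\varepsilon(t,x,\theta,\omega)\ge0$, $(t,x,\theta,\omega)\in I\times\mathbb R^2\times\mathbb R\times\mathbb R$, be smooth, $2\pi$-periodic in $\theta$, with $(1+|\omega|)f^\varepsilon(t,x,\cdot,\cdot)$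 integrable on $(-\pi,\pi]\times\mathbb R$ and $J_{f^\varepsilon}(t,x)\ne0$ for all $(t,x)$, and let $$\partial_tf^\varepsilon+\vec\tau(\theta)\cdot\nabla_xf^\varepsilon+\partial_\theta(\omega f^\varepsilon)=\frac1\varepsilon Q(f^\varepsilon)+r^\varepsilon,\qquad r^\varepsilon=\mathcal O(\varepsilon),$$ where $\mathcal O(\varepsilon)$ means: for every $(t,x)$ there is $h$ with $\int(1+|\omega|)h(\omega)\,d\omega<\infty$ and $|r^\varepsilon(t,x,\theta,\omega)|\le\varepsilon h(\omega)$ for all $\theta,\omega$ and all small $\varepsilon>0$. (In particular $r^\varepsilon=0$ and, with the analogous meaning, $r^\varepsilon=\mathcal O(\varepsilon^2)$ are allowed.) Suppose that $f^\varepsilon$ converges as $\varepsilon\to0$ to a $C^2$ function $f^0$ strongly enough to exchange limits with derivatives and integrals, in the following sense: $f^\varepsilon,\partial_tf^\varepsilon,\nabla_xf^\varepsilon,\partial_\theta f^\varepsilon,\partial_\omega f^\varepsilon,\partial_\theta^2f^\varepsilon,\partial_\omega^2f^\varepsilon$ converge pointwise to the corresponding derivatives of $f^0$, and each point $(t_0,x_0)\in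 I\times\mathbb R^2$ has a neighbourhood on which, for all small $\varepsilon$ and all $\theta,\omega$, they are all bounded in absolute value by a function $h(\omega)$ with $\int(1+\omega^2)h(\omega)\,d\omega<\infty$. Let $\rho=\rho_{f^0}$, $\bar\theta=\bar\theta_{f^0}$, $\Omega=\vec\tau(\bar\theta)$, $\bar\omega=\bar\omega_{f^0}$ (with arbitrary values of $\bar\theta,\bar\omega$ where $\rho=0$). Then $$f^0=\rho\,\mathcal N_{\bar\theta}(\theta)\,\mathcal M_{\bar\omega}(\omega),\qquad \mathcal N_{\bar\theta}(\theta)=\frac{e^{\kappa\cos(\theta-\bar\theta)}}{2\pi I_0(\kappa)},\qquad \mathcal M_{\bar\omega}(\omega)=\sqrt{\frac{k_\omega}{2\pi\beta^2}}\,e^{-\frac{k_\omega}{2\beta^2}(\omega-\bar\omega)^2},$$ where $I_j$ is the modified Bessel function of the first kind of order $j$. Moreover $\rho,\rho\Omega,\rho\bar\omega,\rho\bar\omega\Omega$ are $C^1$ on $I\times\mathbb R^2$, $\Omega$ and $\bar\omega$ are $C^1$ where $\rho>0$, and on $I\times\mathbb R^2$ $$\partial_t\rho+c_1\nabla_x\cdot(\rho\Omega)=0,\qquad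 \partial_t(\rho\bar\omega)+c_1\nabla_x\cdot(\rho\bar\omega\Omega)=0,$$ $$\rho\big(\partial_t\Omega+c_2(\Omega\cdot\nabla_x)\Omega-\bar\omega\,\Omega^\perp\big)+\frac1\kappa P_{\Omega^\perp}\nabla_x\rho=0,$$ where $\Omega^\perp=(-\sin\bar\theta,\cos\bar\theta)$, $P_{\Omega^\perp}=\mathrm{Id}-\Omega\otimes\Omega$, and the first term of the last equation is read as $0$ where $\rho=0$. Here $c_1=I_1(\kappa)/I_0(\kappa)$ and $c_2=K_2/K_1$ with $$K_1=\int_{-\pi}^{\pi}\sin\theta\,\mathcal N_0(\theta)g(\theta)\,d\theta\neq0,\qquad K_2=\int_{-\pi}^{\pi}\cos\theta\sin\theta\,\mathcal N_0(\theta)g(\theta)\,d\theta,$$ $$g(\Gamma)=\frac{\Gamma}{\kappa}-\frac{\pi}{\kappa}\,\frac{\int_0^\Gamma e^{-\kappa\cos\varphi}\,d\varphi}{\int_0^\pi e^{-\kappa\cos\varphi}\,d\varphi}.$$ -/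

import Mathlib

open Set Filter Topology MeasureTheory

noncomputable section

namespace VK

/-- The Euclidean plane. -/
abbrev Plane := EuclideanSpace ℝ (Fin 2)

/-- Functions of `(t, x, θ, ω)`: time, position, orientation angle, angular velocity.
The circle of angles is handled through `2π`-periodic functions of `θ : ℝ`. -/
abbrev PhaseFun := ℝ → Plane → ℝ → ℝ → ℝ

/-- The unit vector `(cos θ, sin θ)`. -/
def tau (θ : ℝ) : Plane := !₂[Real.cos θ, Real.sin θ]

/-- Rotation by `π / 2`: the vector `v^⊥ = (-v₂, v₁)`. -/
def perp (v : Plane) : Plane := !₂[-(v 1), v 0]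

/-- `P_{Ω^⊥} v = (Id - Ω ⊗ Ω) v`. -/
def projPerp (Ω v : Plane) : Plane := v - (inner ℝ Ω v) • Ω

/-- Divergence of a vector field on the plane. -/
def div (F : Plane → Plane) (x : Plane) : ℝ :=
  ∑ i : Fin 2, (fderiv ℝ F x (EuclideanSpace.single i 1)) i

/-! ### Moments in `(θ, ω) ∈ (-π, π] × ℝ` -/

/-- Mass `∫ u dθ dω`. -/
def mass (u : ℝ → ℝ → ℝ) : ℝ :=
  ∫ p in Ioc (-Real.pi) Real.pi ×ˢ (univ : Set ℝ), u p.1 p.2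

/-- Current `∫ τ(θ) u dθ dω`. -/
def current (u : ℝ → ℝ → ℝ) : Plane :=
  ∫ p in Ioc (-Real.pi) Real.pi ×ˢ (univ : Set ℝ), u p.1 p.2 • tau p.1

/-- Mean angular velocity `∫ ω u dθ dω / ∫ u dθ dω`. -/
def meanAngVel (u : ℝ → ℝ → ℝ) : ℝ :=
  (∫ p in Ioc (-Real.pi) Real.pi ×ˢ (univ : Set ℝ), p.2 * u p.1 p.2) / mass u

/-- Mean angle: the angle in `(-π, π]` of the current (see `tau_meanAngle`). -/
def meanAngle (u : ℝ → ℝ → ℝ) : ℝ :=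
  Complex.arg ⟨current u 0, current u 1⟩

theorem meanAngle_mem (u : ℝ → ℝ → ℝ) : meanAngle u ∈ Ioc (-Real.pi) Real.pi :=
  Complex.arg_mem_Ioc _

theorem tau_meanAngle (u : ℝ → ℝ → ℝ) (h : current u ≠ 0) :
    tau (meanAngle u) = ‖current u‖⁻¹ • current u := by
  set J := current u with hJ
  set z : ℂ := ⟨J 0, J 1⟩ with hz
  have hn : ‖z‖ = ‖J‖ := by
    rw [EuclideanSpace.norm_eq, Complex.norm_def, Complex.normSq_apply]
    simp [hz, Fin.sum_univ_two, sq]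
  have hz0 : z ≠ 0 := by
    intro h0
    rw [h0, norm_zero] at hn
    exact h (norm_eq_zero.mp hn.symm)
  have hm : meanAngle u = Complex.arg z := rfl
  ext i
  fin_cases i
  · change Real.cos (meanAngle u) = ‖J‖⁻¹ * J 0
    rw [hm, Complex.cos_arg hz0, hn, div_eq_inv_mul]
  · change Real.sin (meanAngle u) = ‖J‖⁻¹ * J 1
    rw [hm, Complex.sin_arg, hn, div_eq_inv_mul]

/-! ### The collision operator and the kinetic equation -/

/-- The Fokker–Planck alignment operator
`Q(u) = -k_θ ∂_θ(F_u u) - k_ω ∂_ω(G_u u) + α² ∂_θ² u + β² ∂_ω² u`, where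
`F_u = sin(θ̄_u - θ)` and `G_u = ω̄_u - ω`. -/
def collision (kθ kω α β : ℝ) (u : ℝ → ℝ → ℝ) (θ ω : ℝ) : ℝ :=
  -kθ * deriv (fun s => Real.sin (meanAngle u - s) * u s ω) θ
    - kω * deriv (fun s => (meanAngVel u - s) * u θ s) ω
    + α ^ 2 * iteratedDeriv 2 (fun s => u s ω) θ
    + β ^ 2 * iteratedDeriv 2 (fun s => u θ s) ω

/-- The residual `∂_t f + τ(θ)·∇_x f + ∂_θ(ω f) - ε⁻¹ Q(f)`. -/
def residual (kθ kω α β ε : ℝ) (f : PhaseFun) (t : ℝ) (x : Plane) (θ ω : ℝ) : ℝ :=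
  deriv (fun s => f s x θ ω) t
    + inner ℝ (tau θ) (gradient (fun y => f t y θ ω) x)
    + deriv (fun s => ω * f t x s ω) θ
    - (1 / ε) * collision kθ kω α β (f t x) θ ω

/-- A smooth kinetic density on the time set `I`, for which the mean quantities entering the
collision operator are defined. -/
structure IsKineticDensity (I : Set ℝ) (f : PhaseFun) : Prop where
  smooth : ContDiffOn ℝ ((⊤ : ℕ∞) : WithTop ℕ∞)
    (fun p : ℝ × Plane × ℝ × ℝ => f p.1 p.2.1 p.2.2.1 p.2.2.2) (I ×ˢ univ)
  periodic : ∀ t ∈ I, ∀ x θ ω, f t x (θ + 2 * Real.pi) ω = f t x θ ω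
  nonneg : ∀ t ∈ I, ∀ x θ ω, 0 ≤ f t x θ ω
  integrable : ∀ t ∈ I, ∀ x, IntegrableOn (fun p : ℝ × ℝ => (1 + |p.2|) * f t x p.1 p.2)
    (Ioc (-Real.pi) Real.pi ×ˢ (univ : Set ℝ))
  current_ne_zero : ∀ t ∈ I, ∀ x, current (f t x) ≠ 0

/-- The family `f ε`, `ε > 0`, consists of smooth solutions of
`∂_t f + τ(θ)·∇_x f + ∂_θ(ω f) = ε⁻¹ Q(f) + O(ε)`; at each `(t, x)` the remainder is `O(ε)`
as `ε → 0`, uniformly in `θ` and with an integrable weight in `ω`. -/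
structure IsScaledSolution (kθ kω α β : ℝ) (I : Set ℝ) (f : ℝ → PhaseFun) : Prop where
  density : ∀ ε, 0 < ε → IsKineticDensity I (f ε)
  remainder : ∀ t ∈ I, ∀ x, ∃ h : ℝ → ℝ, Integrable (fun ω => (1 + |ω|) * h ω) ∧
    ∀ᶠ ε in 𝓝[>] (0 : ℝ), ∀ θ ω, |residual kθ kω α β ε (f ε) t x θ ω| ≤ ε * h ω

/-- The function and those of its derivatives which appear in the kinetic equation are bounded by
`h ω` at `(t, x, θ, ω)`. -/
structure DerivBound (f : PhaseFun) (h : ℝ → ℝ) (t : ℝ) (x : Plane) (θ ω : ℝ) : Prop where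
  val : |f t x θ ω| ≤ h ω
  dt : |deriv (fun s => f s x θ ω) t| ≤ h ω
  dx : ‖gradient (fun y => f t y θ ω) x‖ ≤ h ω
  dθ : |deriv (fun s => f t x s ω) θ| ≤ h ω
  dω : |deriv (fun s => f t x θ s) ω| ≤ h ω
  dθθ : |iteratedDeriv 2 (fun s => f t x s ω) θ| ≤ h ω
  dωω : |iteratedDeriv 2 (fun s => f t x θ s) ω| ≤ h ω

/-- Convergence `f ε → f₀` as `ε ↓ 0` strong enough to exchange limits with derivatives and
integrals: pointwise convergence of the function and of the derivatives in the kinetic equation,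
which are dominated, locally uniformly in `(t, x)` and uniformly in small `ε`, by a function of `ω`
with finite second moment. -/
structure ConvergesStrongly (I : Set ℝ) (f : ℝ → PhaseFun) (f₀ : PhaseFun) : Prop where
  contDiff : ContDiffOn ℝ 2
    (fun p : ℝ × Plane × ℝ × ℝ => f₀ p.1 p.2.1 p.2.2.1 p.2.2.2) (I ×ˢ univ)
  val : ∀ t ∈ I, ∀ x θ ω, Tendsto (fun ε => f ε t x θ ω) (𝓝[>] 0) (𝓝 (f₀ t x θ ω))
  dt : ∀ t ∈ I, ∀ x θ ω, Tendsto (fun ε => deriv (fun s => f ε s x θ ω) t) (𝓝[>] 0)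
    (𝓝 (deriv (fun s => f₀ s x θ ω) t))
  dx : ∀ t ∈ I, ∀ x θ ω, Tendsto (fun ε => gradient (fun y => f ε t y θ ω) x) (𝓝[>] 0)
    (𝓝 (gradient (fun y => f₀ t y θ ω) x))
  dθ : ∀ t ∈ I, ∀ x θ ω, Tendsto (fun ε => deriv (fun s => f ε t x s ω) θ) (𝓝[>] 0)
    (𝓝 (deriv (fun s => f₀ t x s ω) θ))
  dω : ∀ t ∈ I, ∀ x θ ω, Tendsto (fun ε => deriv (fun s => f ε t x θ s) ω) (𝓝[>] 0)
    (𝓝 (deriv (fun s => f₀ t x θ s) ω))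
  dθθ : ∀ t ∈ I, ∀ x θ ω, Tendsto (fun ε => iteratedDeriv 2 (fun s => f ε t x s ω) θ) (𝓝[>] 0)
    (𝓝 (iteratedDeriv 2 (fun s => f₀ t x s ω) θ))
  dωω : ∀ t ∈ I, ∀ x θ ω, Tendsto (fun ε => iteratedDeriv 2 (fun s => f ε t x θ s) ω) (𝓝[>] 0)
    (𝓝 (iteratedDeriv 2 (fun s => f₀ t x θ s) ω))
  dominated : ∀ t₀ ∈ I, ∀ x₀, ∃ V ∈ 𝓝 (t₀, x₀), ∃ h : ℝ → ℝ,
    Integrable (fun ω => (1 + ω ^ 2) * h ω) ∧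
    ∀ᶠ ε in 𝓝[>] (0 : ℝ), ∀ t x, (t, x) ∈ V → t ∈ I → ∀ θ ω, DerivBound (f ε) h t x θ ω

/-! ### Equilibria and coefficients -/

/-- Modified Bessel function of the first kind of integer order `n`, by Bessel's integral. -/
def besselI (n : ℕ) (z : ℝ) : ℝ :=
  (1 / Real.pi) * ∫ φ in (0 : ℝ)..Real.pi, Real.exp (z * Real.cos φ) * Real.cos (n * φ)

/-- Von Mises density centred at `θbar` with concentration `κ`. -/
def vonMises (κ θbar θ : ℝ) : ℝ :=
  1 / (2 * Real.pi * besselI 0 κ) * Real.exp (κ * Real.cos (θ - θbar))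

/-- Gaussian density centred at `ωbar` with variance `β² / k_ω`. -/
def gauss (kω β ωbar ω : ℝ) : ℝ :=
  Real.sqrt (kω / (2 * Real.pi * β ^ 2)) * Real.exp (-(kω / (2 * β ^ 2)) * (ω - ωbar) ^ 2)

/-- The odd profile `g` of the generalized collisional invariant. -/
def gci (κ Γ : ℝ) : ℝ :=
  (1 / κ) * Γ - (1 / κ) * Real.pi *
    ((∫ φ in (0 : ℝ)..Γ, Real.exp (-κ * Real.cos φ)) /
      (∫ φ in (0 : ℝ)..Real.pi, Real.exp (-κ * Real.cos φ)))

def K1 (κ : ℝ) : ℝ :=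
  ∫ θ in (-Real.pi)..Real.pi, Real.sin θ * vonMises κ 0 θ * gci κ θ

def K2 (κ : ℝ) : ℝ :=
  ∫ θ in (-Real.pi)..Real.pi, Real.cos θ * Real.sin θ * vonMises κ 0 θ * gci κ θ

def c1 (κ : ℝ) : ℝ := besselI 1 κ / besselI 0 κ

def c2 (κ : ℝ) : ℝ := K2 κ / K1 κ

/-! ### The macroscopic system -/

/-- `(ρ, Ω, ωbar)` satisfies the macroscopic system on `I × ℝ²`. The conserved densities and their
fluxes are `C¹`, and `Ω`, `ωbar` are `C¹` off the vacuum `{ρ = 0}` (on which they carry no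
information), so that every derivative below, where not multiplied by `ρ = 0`, is a genuine one. -/
structure IsMacroSolution (κ : ℝ) (I : Set ℝ) (ρ : ℝ → Plane → ℝ) (Ω : ℝ → Plane → Plane)
    (ωbar : ℝ → Plane → ℝ) : Prop where
  contDiff_mass : ContDiffOn ℝ 1 (fun p : ℝ × Plane => ρ p.1 p.2) (I ×ˢ univ)
  contDiff_massFlux : ContDiffOn ℝ 1 (fun p : ℝ × Plane => ρ p.1 p.2 • Ω p.1 p.2) (I ×ˢ univ)
  contDiff_mom : ContDiffOn ℝ 1 (fun p : ℝ × Plane => ρ p.1 p.2 * ωbar p.1 p.2) (I ×ˢ univ)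
  contDiff_momFlux : ContDiffOn ℝ 1
    (fun p : ℝ × Plane => (ρ p.1 p.2 * ωbar p.1 p.2) • Ω p.1 p.2) (I ×ˢ univ)
  contDiff_Ω : ContDiffOn ℝ 1 (fun p : ℝ × Plane => Ω p.1 p.2)
    {p : ℝ × Plane | p.1 ∈ I ∧ 0 < ρ p.1 p.2}
  contDiff_ωbar : ContDiffOn ℝ 1 (fun p : ℝ × Plane => ωbar p.1 p.2)
    {p : ℝ × Plane | p.1 ∈ I ∧ 0 < ρ p.1 p.2}
  mass_eq : ∀ t ∈ I, ∀ x,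
    deriv (fun s => ρ s x) t + c1 κ * div (fun y => ρ t y • Ω t y) x = 0
  mom_eq : ∀ t ∈ I, ∀ x,
    deriv (fun s => ρ s x * ωbar s x) t
      + c1 κ * div (fun y => (ρ t y * ωbar t y) • Ω t y) x = 0
  orient_eq : ∀ t ∈ I, ∀ x,
    ρ t x • (deriv (fun s => Ω s x) t + c2 κ • fderiv ℝ (fun y => Ω t y) x (Ω t x)
        - ωbar t x • perp (Ω t x))
      + (1 / κ) • projPerp (Ω t x) (gradient (fun y => ρ t y) x) = 0

end VK

end

noncomputable section

namespace VK

/-! ### Integrals over a period -/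

/-! Multiplying the kinetic equation by ε and letting ε → 0 forces the collision term to vanish in
the limit. The mean angles of f^ε cannot simply be passed to the limit, because the argument jumps
and the current of f₀ may vanish; but they lie in a compact interval, so along some sequence they
converge to an angle θs. Where f₀ has mass, it therefore solves the stationary linear Fokker–Planck
equation with frozen parameters θs and ω̄ (`linCollision_limit_eq_zero`).

The only dominated periodic solutions of that equation are the multiples of E = von Mises × Gauss
(`stationary_eq`). Writing u = vE, the two fluxes are α²E ∂_θ v and β²E ∂_ω v, and testing with
arctan v gives a nonnegative dissipation of zero integral (`stationary_flux_eq_zero`). Testing with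
v itself would require decay that is not available; arctan v is bounded. The current of the
equilibrium is a positive multiple of τ(θs), so τ(θs) is the direction of f₀
(`tau_meanAngle_limit`), and `limit_eq` follows. In vacuum f₀ = 0 by positivity and continuity.

For the macroscopic equations, the kinetic equation is tested with 1, ω and g(θ − θ̄), where θ̄ is
the mean angle of f^ε. The collision term then drops out exactly at each small ε, so the factor 1/ε
does no harm. For g this holds because g'' − κ sin g' = −sin: the adjoint operator turns g(θ − θ̄)
into −α² sin(θ − θ̄), whose integral against f^ε is zero by the definition of θ̄
(`SliceRegular.integral_linCollision_mul_gci`). Hence the free transport of f₀ is orthogonal to 1, ω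
and g(θ − θs) (`integral_transport_mul_eq_zero`). Inserting the equilibrium, the first two relations
become the conservation laws (`macro_balance`). In the third, parity leaves only the integrals K1
and K2 (`direction_eq_of_integral`), and K1 > 0 allows division (`K1_pos`).

Regularity comes from differentiating moments of f₀ under the integral sign; Ω and ω̄ are quotients
of moments, hence C¹ only off the vacuum. -/

theorem integral_neg_pi_pi_of_even {F : ℝ → ℝ} (hF : Continuous F) (he : ∀ x, F (-x) = F x) :
    ∫ x in (-Real.pi)..Real.pi, F x = 2 * ∫ x in (0 : ℝ)..Real.pi, F x := by
  have h := intervalIntegral.integral_comp_neg (a := 0) (b := Real.pi) F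
  simp only [he, neg_zero] at h
  rw [← intervalIntegral.integral_add_adjacent_intervals (hF.intervalIntegrable _ 0)
    (hF.intervalIntegrable _ _), ← h]
  ring

theorem integral_neg_pi_pi_of_odd {F : ℝ → ℝ} (ho : ∀ x, F (-x) = -F x) :
    ∫ x in (-Real.pi)..Real.pi, F x = 0 := by
  have h := intervalIntegral.integral_comp_neg (a := -Real.pi) (b := Real.pi) F
  simp only [ho, neg_neg, intervalIntegral.integral_neg] at h
  linarith

theorem integral_period_eq {F : ℝ → ℝ} (hp : Function.Periodic F (2 * Real.pi)) (a : ℝ) :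
    ∫ x in a..(a + 2 * Real.pi), F x = ∫ x in (-Real.pi)..Real.pi, F x := by
  rw [hp.intervalIntegral_add_eq a (-Real.pi)]
  congr 1
  ring

theorem integral_comp_sub_of_periodic {F : ℝ → ℝ} (hp : Function.Periodic F (2 * Real.pi))
    (a : ℝ) :
    ∫ x in (-Real.pi)..Real.pi, F (x - a) = ∫ x in (-Real.pi)..Real.pi, F x := by
  rw [intervalIntegral.integral_comp_sub_right, ← integral_period_eq hp (-Real.pi - a)]
  congr 1
  ring

theorem integral_deriv_of_periodic {P P' : ℝ → ℝ} (hP : ∀ x, HasDerivAt P (P' x) x)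
    (hc : Continuous P') (hp : Function.Periodic P (2 * Real.pi)) (a : ℝ) :
    ∫ x in a..(a + 2 * Real.pi), P' x = 0 := by
  rw [intervalIntegral.integral_eq_sub_of_hasDerivAt (fun x _ => hP x)
    (hc.intervalIntegrable _ _), hp, sub_self]

theorem integral_deriv_neg_pi_pi {P P' : ℝ → ℝ} (hP : ∀ x, HasDerivAt P (P' x) x)
    (hc : Continuous P') (hp : Function.Periodic P (2 * Real.pi)) :
    ∫ x in (-Real.pi)..Real.pi, P' x = 0 := by
  have h := integral_deriv_of_periodic hP hc hp (-Real.pi)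
  rwa [show -Real.pi + 2 * Real.pi = Real.pi by ring] at h

/-! ### The von Mises density -/

/-- `∫_0^π exp (κ cos φ) dφ`. -/
def halfNorm (κ : ℝ) : ℝ := ∫ φ in (0 : ℝ)..Real.pi, Real.exp (κ * Real.cos φ)

theorem halfNorm_neg (κ : ℝ) :
    ∫ φ in (0 : ℝ)..Real.pi, Real.exp (-κ * Real.cos φ) = halfNorm κ := by
  have h := intervalIntegral.integral_comp_sub_left (a := 0) (b := Real.pi)
    (fun x => Real.exp (κ * Real.cos x)) Real.pi
  simp only [Real.cos_pi_sub, sub_self, sub_zero] at h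
  rw [halfNorm, ← h]
  simp

/-- Jensen's inequality in the form `x + 1 ≤ exp x`: the affine part integrates to π, and the
inequality is strict at φ = 0. This is what makes `K1` positive. -/
theorem pi_lt_halfNorm {κ : ℝ} (hκ : 0 < κ) : Real.pi < halfNorm κ := by
  have h : ∫ φ in (0 : ℝ)..Real.pi, (κ * Real.cos φ + 1) = Real.pi := by
    rw [intervalIntegral.integral_add (Continuous.intervalIntegrable (by fun_prop) _ _)
      (Continuous.intervalIntegrable (by fun_prop) _ _)]
    simp
  rw [halfNorm]
  conv_lhs => rw [← h]
  refine intervalIntegral.integral_lt_integral_of_continuousOn_of_le_of_exists_lt Real.pi_pos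
    (by fun_prop) (by fun_prop) (fun x _ => Real.add_one_le_exp _) ⟨0, ⟨le_rfl, Real.pi_pos.le⟩, ?_⟩
  exact Real.add_one_lt_exp (by simp [hκ.ne'])

theorem halfNorm_pos (κ : ℝ) : 0 < halfNorm κ := by
  apply intervalIntegral.intervalIntegral_pos_of_pos_on
    (Continuous.intervalIntegrable (by fun_prop) _ _) (fun x _ => Real.exp_pos _) Real.pi_pos

theorem besselI_zero (κ : ℝ) : besselI 0 κ = halfNorm κ / Real.pi := by
  simp [besselI, halfNorm]
  ring

theorem vonMises_eq (κ a θ : ℝ) :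
    vonMises κ a θ = (2 * halfNorm κ)⁻¹ * Real.exp (κ * Real.cos (θ - a)) := by
  have := Real.pi_pos.ne'
  have := (halfNorm_pos κ).ne'
  rw [vonMises, besselI_zero]
  field_simp

theorem vonMises_pos (κ a θ : ℝ) : 0 < vonMises κ a θ := by
  rw [vonMises_eq]
  have := halfNorm_pos κ
  positivity

theorem vonMises_sub (κ a θ : ℝ) : vonMises κ a θ = vonMises κ 0 (θ - a) := by
  simp [vonMises_eq]

theorem vonMises_neg (κ θ : ℝ) : vonMises κ 0 (-θ) = vonMises κ 0 θ := by
  simp [vonMises_eq]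

theorem continuous_vonMises (κ a : ℝ) : Continuous (vonMises κ a) := by
  unfold vonMises
  fun_prop

theorem periodic_vonMises (κ a : ℝ) : Function.Periodic (vonMises κ a) (2 * Real.pi) := by
  intro θ
  rw [vonMises_eq, vonMises_eq, show θ + 2 * Real.pi - a = θ - a + 2 * Real.pi by ring,
    Real.cos_add_two_pi]

theorem hasDerivAt_vonMises (κ a θ : ℝ) :
    HasDerivAt (vonMises κ a) (-κ * Real.sin (θ - a) * vonMises κ a θ) θ := by
  have h := ((((hasDerivAt_id θ).sub_const a).cos.const_mul κ).exp).const_mul (2 * halfNorm κ)⁻¹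
  have h' : vonMises κ a = fun θ => (2 * halfNorm κ)⁻¹ * Real.exp (κ * Real.cos (id θ - a)) := by
    funext s
    rw [vonMises_eq, id]
  rw [h']
  refine h.congr_deriv ?_
  simp only [id]
  ring

theorem integral_exp_cos (κ : ℝ) :
    ∫ θ in (-Real.pi)..Real.pi, Real.exp (κ * Real.cos θ) = 2 * halfNorm κ :=
  integral_neg_pi_pi_of_even (by fun_prop) (by simp)

theorem integral_vonMises_zero (κ : ℝ) : ∫ θ in (-Real.pi)..Real.pi, vonMises κ 0 θ = 1 := by
  have := (halfNorm_pos κ).ne'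
  simp only [vonMises_eq, sub_zero, intervalIntegral.integral_const_mul, integral_exp_cos]
  field_simp

theorem integral_vonMises (κ a : ℝ) : ∫ θ in (-Real.pi)..Real.pi, vonMises κ a θ = 1 := by
  simp only [vonMises_sub κ a]
  rw [integral_comp_sub_of_periodic (periodic_vonMises κ 0), integral_vonMises_zero]

theorem integral_vonMises_mul_cos (κ : ℝ) :
    ∫ θ in (-Real.pi)..Real.pi, vonMises κ 0 θ * Real.cos θ = c1 κ := by
  have hv := continuous_vonMises κ 0
  rw [integral_neg_pi_pi_of_even (by fun_prop) (by simp [vonMises_neg])]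
  simp only [vonMises_eq, sub_zero, mul_assoc, intervalIntegral.integral_const_mul]
  rw [c1, besselI_zero, besselI]
  have := (halfNorm_pos κ).ne'
  have := Real.pi_pos.ne'
  simp only [Nat.cast_one, one_mul]
  field_simp

theorem integral_vonMises_mul_sin (κ : ℝ) :
    ∫ θ in (-Real.pi)..Real.pi, vonMises κ 0 θ * Real.sin θ = 0 :=
  integral_neg_pi_pi_of_odd (by simp [vonMises_neg])

/-- Integrating (sin · N)' over a period, with N the von Mises density, gives c1 = κ ∫ sin² N. -/
theorem c1_pos {κ : ℝ} (hκ : 0 < κ) : 0 < c1 κ := by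
  have hd : ∀ x, HasDerivAt (fun x => Real.sin x * vonMises κ 0 x)
      (vonMises κ 0 x * Real.cos x - κ * (Real.sin x ^ 2 * vonMises κ 0 x)) x := fun x => by
    refine ((Real.hasDerivAt_sin x).mul (hasDerivAt_vonMises κ 0 x)).congr_deriv ?_
    rw [sub_zero]
    ring
  have hv := continuous_vonMises κ 0
  have h := integral_deriv_neg_pi_pi hd (by fun_prop) (fun x => by
    simp only [Real.sin_add_two_pi, periodic_vonMises κ 0 x])
  rw [intervalIntegral.integral_sub (Continuous.intervalIntegrable (by fun_prop) _ _)
    (Continuous.intervalIntegrable (by fun_prop) _ _), integral_vonMises_mul_cos,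
    intervalIntegral.integral_const_mul,
    integral_neg_pi_pi_of_even (by fun_prop) (by simp [vonMises_neg])] at h
  have hp : 0 < ∫ x in (0 : ℝ)..Real.pi, Real.sin x ^ 2 * vonMises κ 0 x := by
    refine intervalIntegral.intervalIntegral_pos_of_pos_on
      (Continuous.intervalIntegrable (by fun_prop) _ _) (fun x hx => ?_) Real.pi_pos
    have := Real.sin_pos_of_mem_Ioo hx
    have := vonMises_pos κ 0 x
    positivity
  rw [sub_eq_zero.mp h]
  positivity

theorem integral_vonMises_mul_cos_sub (κ a : ℝ) :
    ∫ θ in (-Real.pi)..Real.pi, vonMises κ a θ * Real.cos θ = c1 κ * Real.cos a := by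
  have hp : Function.Periodic (fun s => vonMises κ 0 s * Real.cos (s + a)) (2 * Real.pi) := by
    intro s
    simp only [periodic_vonMises κ 0 s, show s + 2 * Real.pi + a = s + a + 2 * Real.pi by ring,
      Real.cos_add_two_pi]
  have h := integral_comp_sub_of_periodic hp a
  simp only [← vonMises_sub, sub_add_cancel] at h
  have hv := continuous_vonMises κ 0
  rw [h]
  simp only [Real.cos_add, mul_sub, ← mul_assoc]
  rw [intervalIntegral.integral_sub (Continuous.intervalIntegrable (by fun_prop) _ _)
    (Continuous.intervalIntegrable (by fun_prop) _ _), intervalIntegral.integral_mul_const,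
    intervalIntegral.integral_mul_const, integral_vonMises_mul_cos, integral_vonMises_mul_sin]
  ring

theorem integral_vonMises_mul_sin_sub (κ a : ℝ) :
    ∫ θ in (-Real.pi)..Real.pi, vonMises κ a θ * Real.sin θ = c1 κ * Real.sin a := by
  have hp : Function.Periodic (fun s => vonMises κ 0 s * Real.sin (s + a)) (2 * Real.pi) := by
    intro s
    simp only [periodic_vonMises κ 0 s, show s + 2 * Real.pi + a = s + a + 2 * Real.pi by ring,
      Real.sin_add_two_pi]
  have h := integral_comp_sub_of_periodic hp a
  simp only [← vonMises_sub, sub_add_cancel] at h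
  have hv := continuous_vonMises κ 0
  rw [h]
  simp only [Real.sin_add, mul_add, ← mul_assoc]
  rw [intervalIntegral.integral_add (Continuous.intervalIntegrable (by fun_prop) _ _)
    (Continuous.intervalIntegrable (by fun_prop) _ _), intervalIntegral.integral_mul_const,
    intervalIntegral.integral_mul_const, integral_vonMises_mul_cos, integral_vonMises_mul_sin]
  ring

/-! ### The Gaussian density -/

/-- The variance is β² / kω; normalisation, positivity and mean are then those of the standard
Gaussian law. -/
theorem gauss_eq_gaussianPDFReal {kω β : ℝ} (hkω : 0 < kω) (hβ : 0 < β) (ωb : ℝ) :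
    gauss kω β ωb = ProbabilityTheory.gaussianPDFReal ωb (Real.toNNReal (β ^ 2 / kω)) := by
  have hv : ((Real.toNNReal (β ^ 2 / kω) : NNReal) : ℝ) = β ^ 2 / kω :=
    Real.coe_toNNReal _ (by positivity)
  funext ω
  rw [gauss, ProbabilityTheory.gaussianPDFReal, hv, ← Real.sqrt_inv]
  congr 2
  · field_simp
  · field_simp

theorem toNNReal_variance_ne_zero {kω β : ℝ} (hkω : 0 < kω) (hβ : 0 < β) :
    Real.toNNReal (β ^ 2 / kω) ≠ 0 :=
  (Real.toNNReal_pos.mpr (by positivity)).ne'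

theorem integrable_gauss {kω β : ℝ} (hkω : 0 < kω) (hβ : 0 < β) (ωb : ℝ) :
    Integrable (gauss kω β ωb) := by
  rw [gauss_eq_gaussianPDFReal hkω hβ]
  exact ProbabilityTheory.integrable_gaussianPDFReal _ _

theorem integral_gauss {kω β : ℝ} (hkω : 0 < kω) (hβ : 0 < β) (ωb : ℝ) :
    ∫ ω, gauss kω β ωb ω = 1 := by
  rw [gauss_eq_gaussianPDFReal hkω hβ]
  exact ProbabilityTheory.integral_gaussianPDFReal_eq_one _ (toNNReal_variance_ne_zero hkω hβ)

theorem gauss_pos {kω β : ℝ} (hkω : 0 < kω) (hβ : 0 < β) (ωb ω : ℝ) : 0 < gauss kω β ωb ω := by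
  rw [gauss_eq_gaussianPDFReal hkω hβ]
  exact ProbabilityTheory.gaussianPDFReal_pos _ _ _ (toNNReal_variance_ne_zero hkω hβ)

theorem integral_mul_gauss {kω β : ℝ} (hkω : 0 < kω) (hβ : 0 < β) (ωb : ℝ) :
    ∫ ω, ω * gauss kω β ωb ω = ωb := by
  have h := ProbabilityTheory.integral_gaussianReal_eq_integral_smul (μ := ωb)
    (f := fun x : ℝ => x) (toNNReal_variance_ne_zero hkω hβ)
  rw [ProbabilityTheory.integral_id_gaussianReal] at h
  rw [gauss_eq_gaussianPDFReal hkω hβ]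
  simp only [smul_eq_mul, mul_comm] at h ⊢
  exact h.symm

theorem integrable_mul_gauss {kω β : ℝ} (hkω : 0 < kω) (hβ : 0 < β) (ωb : ℝ) :
    Integrable (fun ω => ω * gauss kω β ωb ω) := by
  have hb : 0 < kω / (2 * β ^ 2) := by positivity
  have h1 := ((integrable_mul_exp_neg_mul_sq hb).comp_sub_right ωb).const_mul
    (Real.sqrt (kω / (2 * Real.pi * β ^ 2)))
  have h2 := (integrable_gauss hkω hβ ωb).const_mul ωb
  refine (h1.add h2).congr (ae_of_all _ fun ω => ?_)
  simp only [gauss, Pi.add_apply]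
  ring

theorem hasDerivAt_gauss (kω β ωb ω : ℝ) :
    HasDerivAt (fun m => gauss kω β m ω) (kω / β ^ 2 * (ω - ωb) * gauss kω β ωb ω) ωb := by
  have h := ((((hasDerivAt_id ωb).const_sub ω).pow 2).const_mul (-(kω / (2 * β ^ 2)))).exp.const_mul
    (Real.sqrt (kω / (2 * Real.pi * β ^ 2)))
  refine h.congr_deriv ?_
  simp only [gauss, id]
  -- Division by zero being zero, both sides vanish when β = 0.
  by_cases hβ : β = 0
  · simp [hβ]
  · field_simp
    simp
    ring

/-! ### The generalized collisional invariant -/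

/-- Derivative of `gci κ`. -/
def gciDeriv (κ Γ : ℝ) : ℝ :=
  1 / κ - Real.pi / (κ * halfNorm κ) * Real.exp (-κ * Real.cos Γ)

theorem gci_eq (κ Γ : ℝ) : gci κ Γ = (1 / κ) * Γ - Real.pi / (κ * halfNorm κ) *
    ∫ φ in (0 : ℝ)..Γ, Real.exp (-κ * Real.cos φ) := by
  rw [gci, halfNorm_neg]
  ring

theorem hasDerivAt_gci (κ Γ : ℝ) : HasDerivAt (gci κ) (gciDeriv κ Γ) Γ := by
  have hc : Continuous fun φ => Real.exp (-κ * Real.cos φ) := by fun_prop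
  have h := ((hasDerivAt_id Γ).const_mul (1 / κ)).sub
    ((hc.integral_hasStrictDerivAt 0 Γ).hasDerivAt.const_mul (Real.pi / (κ * halfNorm κ)))
  rw [mul_one] at h
  exact (funext (gci_eq κ) : gci κ = _) ▸ h

theorem continuous_gci (κ : ℝ) : Continuous (gci κ) :=
  continuous_iff_continuousAt.mpr fun Γ => (hasDerivAt_gci κ Γ).continuousAt

theorem continuous_gciDeriv (κ : ℝ) : Continuous (gciDeriv κ) := by
  unfold gciDeriv
  fun_prop

/-- Derivative of `gciDeriv κ`. -/
def gciDeriv2 (κ Γ : ℝ) : ℝ := κ * Real.sin Γ * gciDeriv κ Γ - Real.sin Γ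

/-- This is the equation g'' = κ sin Γ g' − sin Γ which characterises the invariant; the exponential
has been eliminated through g'. -/
theorem hasDerivAt_gciDeriv {κ : ℝ} (hκ : 0 < κ) (Γ : ℝ) :
    HasDerivAt (gciDeriv κ) (gciDeriv2 κ Γ) Γ := by
  have h := (((Real.hasDerivAt_cos Γ).const_mul (-κ)).exp.const_mul
    (Real.pi / (κ * halfNorm κ))).const_sub (1 / κ)
  refine h.congr_deriv ?_
  have := hκ.ne'
  have := (halfNorm_pos κ).ne'
  simp only [gciDeriv2, gciDeriv]
  field_simp
  ring

theorem continuous_gciDeriv2 (κ : ℝ) : Continuous (gciDeriv2 κ) := by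
  have := continuous_gciDeriv κ
  unfold gciDeriv2
  fun_prop

theorem gci_neg (κ Γ : ℝ) : gci κ (-Γ) = -gci κ Γ := by
  have h := intervalIntegral.integral_comp_neg (a := 0) (b := Γ)
    (fun φ => Real.exp (-κ * Real.cos φ))
  simp only [Real.cos_neg, neg_zero] at h
  rw [gci_eq, gci_eq, h, intervalIntegral.integral_symm]
  ring

/-- The normalisation of `gci` serves this purpose: exp(−κ cos) integrates to 2 `halfNorm κ` over a
period, and the resulting increment cancels the increment 2π/κ of the linear term. -/
theorem periodic_gci (κ : ℝ) : Function.Periodic (gci κ) (2 * Real.pi) := by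
  intro Γ
  have hc : Continuous fun φ => Real.exp (-κ * Real.cos φ) := by fun_prop
  have hp : Function.Periodic (fun φ => Real.exp (-κ * Real.cos φ)) (2 * Real.pi) := by
    intro φ
    simp
  have h := integral_period_eq hp Γ
  rw [integral_neg_pi_pi_of_even hc (by simp), halfNorm_neg] at h
  have h2 := intervalIntegral.integral_add_adjacent_intervals (hc.intervalIntegrable (μ := volume)
    0 Γ) (hc.intervalIntegrable Γ (Γ + 2 * Real.pi))
  rw [gci_eq, gci_eq, ← h2, h]
  have := (halfNorm_pos κ).ne'
  by_cases hκ : κ = 0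
  · simp [hκ]
  · field_simp
    ring

theorem periodic_gciDeriv (κ : ℝ) : Function.Periodic (gciDeriv κ) (2 * Real.pi) := by
  intro Γ
  simp [gciDeriv]

/-- Integrating (N g)' over a period gives κ K1 = ∫ N g'. The exponentials in N g' cancel, leaving
N/κ minus a constant; with Z = `halfNorm κ` the integral is (Z² − π²)/(κ Z²), positive because Z >
π. -/
theorem K1_pos {κ : ℝ} (hκ : 0 < κ) : 0 < K1 κ := by
  have hd : ∀ x, HasDerivAt (fun x => vonMises κ 0 x * gci κ x)
      (vonMises κ 0 x * gciDeriv κ x - κ * (Real.sin x * vonMises κ 0 x * gci κ x)) x := fun x => by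
    refine ((hasDerivAt_vonMises κ 0 x).mul (hasDerivAt_gci κ x)).congr_deriv ?_
    rw [sub_zero]
    ring
  have hv := continuous_vonMises κ 0
  have hg := continuous_gci κ
  have hg' := continuous_gciDeriv κ
  have h := integral_deriv_neg_pi_pi hd (by fun_prop) (fun x => by
    simp only [periodic_gci κ x, periodic_vonMises κ 0 x])
  rw [intervalIntegral.integral_sub (Continuous.intervalIntegrable (by fun_prop) _ _)
    (Continuous.intervalIntegrable (by fun_prop) _ _), intervalIntegral.integral_const_mul] at h
  have hc := halfNorm_pos κ
  have he : ∀ x, vonMises κ 0 x * gciDeriv κ x =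
      1 / κ * vonMises κ 0 x - Real.pi / (2 * κ * halfNorm κ ^ 2) := fun x => by
    rw [gciDeriv, vonMises_eq, sub_zero, neg_mul, Real.exp_neg]
    have := Real.exp_pos (κ * Real.cos x)
    field_simp
  simp only [he] at h
  rw [intervalIntegral.integral_sub (Continuous.intervalIntegrable (by fun_prop) _ _)
    (Continuous.intervalIntegrable (by fun_prop) _ _), intervalIntegral.integral_const_mul,
    integral_vonMises, intervalIntegral.integral_const, smul_eq_mul] at h
  have hK : κ * K1 κ = (halfNorm κ ^ 2 - Real.pi ^ 2) / (κ * halfNorm κ ^ 2) := by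
    rw [K1, ← sub_eq_zero.mp h]
    field_simp
    ring
  have hpos : 0 < κ * K1 κ := by
    rw [hK]
    have := pi_lt_halfNorm hκ
    have := Real.pi_pos
    have : 0 < halfNorm κ ^ 2 - Real.pi ^ 2 := by nlinarith
    positivity
  exact (pos_iff_pos_of_mul_pos hpos).mp hκ

/-! ### Partial derivatives of functions of `(θ, ω)` -/

section Partial

variable {u : ℝ → ℝ → ℝ}

theorem hasDerivAt_fst (hu : Differentiable ℝ fun p : ℝ × ℝ => u p.1 p.2) (θ ω : ℝ) :
    HasDerivAt (fun s => u s ω) (fderiv ℝ (fun p : ℝ × ℝ => u p.1 p.2) (θ, ω) (1, 0)) θ :=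
  HasFDerivAt.comp_hasDerivAt θ (f := fun s => (s, ω)) (hu (θ, ω)).hasFDerivAt
    ((hasDerivAt_id θ).prodMk (hasDerivAt_const θ ω))

theorem hasDerivAt_snd (hu : Differentiable ℝ fun p : ℝ × ℝ => u p.1 p.2) (θ ω : ℝ) :
    HasDerivAt (fun s => u θ s) (fderiv ℝ (fun p : ℝ × ℝ => u p.1 p.2) (θ, ω) (0, 1)) ω :=
  HasFDerivAt.comp_hasDerivAt ω (f := fun s => (θ, s)) (hu (θ, ω)).hasFDerivAt
    ((hasDerivAt_const ω θ).prodMk (hasDerivAt_id ω))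

theorem contDiff_partial_fst {n : WithTop ℕ∞}
    (hu : ContDiff ℝ (n + 1) fun p : ℝ × ℝ => u p.1 p.2) :
    ContDiff ℝ n fun p : ℝ × ℝ => deriv (fun s => u s p.2) p.1 := by
  have h : (fun p : ℝ × ℝ => deriv (fun s => u s p.2) p.1) =
      fun p => fderiv ℝ (fun p : ℝ × ℝ => u p.1 p.2) p (1, 0) :=
    funext fun p => (hasDerivAt_fst (hu.differentiable (by simp)) p.1 p.2).deriv
  rw [h]
  exact (hu.fderiv_right le_rfl).clm_apply contDiff_const

theorem contDiff_partial_snd {n : WithTop ℕ∞}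
    (hu : ContDiff ℝ (n + 1) fun p : ℝ × ℝ => u p.1 p.2) :
    ContDiff ℝ n fun p : ℝ × ℝ => deriv (fun s => u p.1 s) p.2 := by
  have h : (fun p : ℝ × ℝ => deriv (fun s => u p.1 s) p.2) =
      fun p => fderiv ℝ (fun p : ℝ × ℝ => u p.1 p.2) p (0, 1) :=
    funext fun p => (hasDerivAt_snd (hu.differentiable (by simp)) p.1 p.2).deriv
  rw [h]
  exact (hu.fderiv_right le_rfl).clm_apply contDiff_const

end Partial

theorem iteratedDeriv_two (f : ℝ → ℝ) (x : ℝ) :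
    iteratedDeriv 2 f x = deriv (fun y => deriv f y) x := by
  rw [iteratedDeriv_succ, iteratedDeriv_one]

/-- A `C²` function of `(θ, ω)`, periodic in `θ`, which is dominated together with its derivatives
by a function of `ω` with finite second moment. -/
structure SliceRegular (u : ℝ → ℝ → ℝ) (h : ℝ → ℝ) : Prop where
  contDiff : ContDiff ℝ 2 fun p : ℝ × ℝ => u p.1 p.2
  periodic : ∀ θ ω, u (θ + 2 * Real.pi) ω = u θ ω
  val_le : ∀ θ ω, |u θ ω| ≤ h ω
  dθ_le : ∀ θ ω, |deriv (fun s => u s ω) θ| ≤ h ω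
  dω_le : ∀ θ ω, |deriv (fun s => u θ s) ω| ≤ h ω
  dθθ_le : ∀ θ ω, |iteratedDeriv 2 (fun s => u s ω) θ| ≤ h ω
  dωω_le : ∀ θ ω, |iteratedDeriv 2 (fun s => u θ s) ω| ≤ h ω
  integrable : Integrable fun ω => (1 + ω ^ 2) * h ω

namespace SliceRegular

variable {u : ℝ → ℝ → ℝ} {h : ℝ → ℝ} (hu : SliceRegular u h)
include hu

theorem continuous : Continuous fun p : ℝ × ℝ => u p.1 p.2 := hu.contDiff.continuous

theorem contDiff_dθ : ContDiff ℝ 1 fun p : ℝ × ℝ => deriv (fun s => u s p.2) p.1 :=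
  contDiff_partial_fst (n := 1) (by simpa [one_add_one_eq_two] using hu.contDiff)

theorem contDiff_dω : ContDiff ℝ 1 fun p : ℝ × ℝ => deriv (fun s => u p.1 s) p.2 :=
  contDiff_partial_snd (n := 1) (by simpa [one_add_one_eq_two] using hu.contDiff)

theorem continuous_dθ : Continuous fun p : ℝ × ℝ => deriv (fun s => u s p.2) p.1 :=
  hu.contDiff_dθ.continuous

theorem continuous_dω : Continuous fun p : ℝ × ℝ => deriv (fun s => u p.1 s) p.2 :=
  hu.contDiff_dω.continuous

theorem continuous_dθθ : Continuous fun p : ℝ × ℝ => iteratedDeriv 2 (fun s => u s p.2) p.1 := by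
  simp only [iteratedDeriv_two]
  exact (contDiff_partial_fst (n := 0) (u := fun θ ω => deriv (fun s => u s ω) θ)
    (by simpa using hu.contDiff_dθ)).continuous

theorem continuous_dωω : Continuous fun p : ℝ × ℝ => iteratedDeriv 2 (fun s => u p.1 s) p.2 := by
  simp only [iteratedDeriv_two]
  exact (contDiff_partial_snd (n := 0) (u := fun θ ω => deriv (fun s => u θ s) ω)
    (by simpa using hu.contDiff_dω)).continuous

theorem hasDerivAt_θ (θ ω : ℝ) :
    HasDerivAt (fun s => u s ω) (deriv (fun s => u s ω) θ) θ :=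
  (hasDerivAt_fst (hu.contDiff.differentiable (by simp)) θ ω).differentiableAt.hasDerivAt

theorem hasDerivAt_ω (θ ω : ℝ) :
    HasDerivAt (fun s => u θ s) (deriv (fun s => u θ s) ω) ω :=
  (hasDerivAt_snd (hu.contDiff.differentiable (by simp)) θ ω).differentiableAt.hasDerivAt

theorem hasDerivAt_dθ (θ ω : ℝ) :
    HasDerivAt (fun s => deriv (fun r => u r ω) s) (iteratedDeriv 2 (fun s => u s ω) θ) θ := by
  rw [iteratedDeriv_two]
  exact (hasDerivAt_fst (u := fun θ ω => deriv (fun s => u s ω) θ)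
    (hu.contDiff_dθ.differentiable (by simp)) θ ω).differentiableAt.hasDerivAt

theorem hasDerivAt_dω (θ ω : ℝ) :
    HasDerivAt (fun s => deriv (fun r => u θ r) s) (iteratedDeriv 2 (fun s => u θ s) ω) ω := by
  rw [iteratedDeriv_two]
  exact (hasDerivAt_snd (u := fun θ ω => deriv (fun s => u θ s) ω)
    (hu.contDiff_dω.differentiable (by simp)) θ ω).differentiableAt.hasDerivAt

theorem bound_nonneg (ω : ℝ) : 0 ≤ h ω := (abs_nonneg _).trans (hu.val_le 0 ω)

theorem periodic_dθ (θ ω : ℝ) :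
    deriv (fun s => u s ω) (θ + 2 * Real.pi) = deriv (fun s => u s ω) θ := by
  rw [← deriv_comp_add_const]
  simp only [hu.periodic]

end SliceRegular

/-! ### Dominated integrals over the phase cylinder -/

/-- Lebesgue measure on `(-π, π] × ℝ`. -/
def cyl : Measure (ℝ × ℝ) := (volume.restrict (Ioc (-Real.pi) Real.pi)).prod volume

theorem restrict_eq_cyl :
    (volume : Measure (ℝ × ℝ)).restrict (Ioc (-Real.pi) Real.pi ×ˢ univ) = cyl := by
  rw [cyl, Measure.volume_eq_prod, ← Measure.prod_restrict, Measure.restrict_univ]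

theorem integrable_cyl_snd {k : ℝ → ℝ} (hk : Integrable k) :
    Integrable (fun p : ℝ × ℝ => k p.2) cyl :=
  Integrable.comp_snd hk _

theorem integrable_cyl_of_le {E : Type*} [NormedAddCommGroup E] [SecondCountableTopology E]
    {F : ℝ × ℝ → E} (hF : Continuous F) {k : ℝ → ℝ} (hk : Integrable k)
    (hb : ∀ p : ℝ × ℝ, ‖F p‖ ≤ k p.2) : Integrable F cyl :=
  (integrable_cyl_snd hk).mono' hF.aestronglyMeasurable (ae_of_all _ hb)

theorem integrable_section_of_le {F : ℝ × ℝ → ℝ} (hF : Continuous F) {k : ℝ → ℝ}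
    (hk : Integrable k) (hb : ∀ p : ℝ × ℝ, ‖F p‖ ≤ k p.2) (θ : ℝ) :
    Integrable fun ω => F (θ, ω) :=
  hk.mono' (hF.comp (Continuous.prodMk_right θ)).aestronglyMeasurable (ae_of_all _ fun ω => hb (θ, ω))

/-- The integral of a `θ`-derivative of a periodic function vanishes. -/
theorem integral_cyl_dθ {P P' : ℝ → ℝ → ℝ} (hP : ∀ θ ω, HasDerivAt (fun s => P s ω) (P' θ ω) θ)
    (hc : Continuous fun p : ℝ × ℝ => P' p.1 p.2)
    (hp : ∀ θ ω, P (θ + 2 * Real.pi) ω = P θ ω) {k : ℝ → ℝ} (hk : Integrable k)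
    (hb : ∀ p : ℝ × ℝ, ‖P' p.1 p.2‖ ≤ k p.2) : ∫ p, P' p.1 p.2 ∂cyl = 0 := by
  rw [cyl, integral_prod_symm _ (integrable_cyl_of_le hc hk hb)]
  refine integral_eq_zero_of_ae (ae_of_all _ fun ω => ?_)
  have h := integral_deriv_neg_pi_pi (fun θ => hP θ ω) (hc.comp (Continuous.prodMk_left ω))
    (fun θ => hp θ ω)
  rwa [intervalIntegral.integral_of_le (by linarith [Real.pi_pos])] at h

/-- The integral of an `ω`-derivative of an integrable function vanishes. -/
theorem integral_cyl_dω {R R' : ℝ → ℝ → ℝ} (hR : ∀ θ ω, HasDerivAt (fun s => R θ s) (R' θ ω) ω)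
    (hc : Continuous fun p : ℝ × ℝ => R p.1 p.2) (hc' : Continuous fun p : ℝ × ℝ => R' p.1 p.2)
    {k k' : ℝ → ℝ} (hk : Integrable k) (hk' : Integrable k')
    (hb : ∀ p : ℝ × ℝ, ‖R p.1 p.2‖ ≤ k p.2) (hb' : ∀ p : ℝ × ℝ, ‖R' p.1 p.2‖ ≤ k' p.2) :
    ∫ p, R' p.1 p.2 ∂cyl = 0 := by
  rw [cyl, integral_prod _ (integrable_cyl_of_le hc' hk' hb')]
  refine integral_eq_zero_of_ae (ae_of_all _ fun θ => ?_)
  exact integral_eq_zero_of_hasDerivAt_of_integrable (fun ω => hR θ ω)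
    (integrable_section_of_le hc' hk' hb' θ) (integrable_section_of_le hc hk hb θ)

/-! ### Stationary solutions of the linear Fokker–Planck equation -/

/-- Were F x nonzero, monotonicity would keep |F| ≥ |F x| on one of the two half-lines ending at x,
which has infinite measure. -/
theorem eq_zero_of_monotone_of_integrable {F : ℝ → ℝ} (hm : Monotone F) (hi : Integrable F)
    (x : ℝ) : F x = 0 := by
  have key : ∀ s : Set ℝ, volume s = ⊤ → MeasurableSet s → ∀ c, 0 < c → (∀ y ∈ s, c ≤ |F y|) →
      False := by
    intro s hs hms c hc hle
    have h1 : IntegrableOn (fun _ : ℝ => c) s := by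
      refine Integrable.mono' hi.abs.integrableOn aestronglyMeasurable_const ?_
      refine (ae_restrict_iff' hms).mpr (ae_of_all _ fun y hy => ?_)
      rw [Real.norm_of_nonneg hc.le]
      exact hle y hy
    rw [integrableOn_const_iff] at h1
    simp [hs, hc.ne'] at h1
  by_contra hne
  rcases lt_or_gt_of_ne hne with hx | hx
  · refine key (Iic x) Real.volume_Iic measurableSet_Iic (-F x) (by linarith) fun y hy => ?_
    exact le_trans (neg_le_neg (hm hy)) (neg_le_abs _)
  · exact key (Ici x) Real.volume_Ici measurableSet_Ici (F x) hx fun y hy =>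
      le_trans (hm hy) (le_abs_self _)

theorem hasDerivAt_integral_of_continuous {G G' : ℝ → ℝ → ℝ}
    (hG : ∀ θ ω, HasDerivAt (fun s => G θ s) (G' θ ω) ω)
    (hc : Continuous fun p : ℝ × ℝ => G p.1 p.2) (hc' : Continuous fun p : ℝ × ℝ => G' p.1 p.2)
    (a b ω : ℝ) :
    HasDerivAt (fun s => ∫ θ in a..b, G θ s) (∫ θ in a..b, G' θ ω) ω := by
  -- Compactness near ω makes a constant sufficient as dominating function.
  obtain ⟨C, hC⟩ := (isCompact_uIcc.prod (isCompact_Icc (a := ω - 1) (b := ω + 1))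
    (s := uIcc a b)).exists_bound_of_continuousOn hc'.continuousOn
  refine (intervalIntegral.hasDerivAt_integral_of_dominated_loc_of_deriv_le
    (F := fun s θ => G θ s) (F' := fun s θ => G' θ s) (bound := fun _ => C)
    (Icc_mem_nhds (by linarith : ω - 1 < ω) (by linarith : ω < ω + 1)) ?_ ?_ ?_ ?_ ?_ ?_).2
  · exact Eventually.of_forall fun s => (hc.comp (Continuous.prodMk_left s)).aestronglyMeasurable
  · exact (hc.comp (Continuous.prodMk_left ω)).intervalIntegrable _ _
  · exact (hc'.comp (Continuous.prodMk_left ω)).aestronglyMeasurable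
  · exact ae_of_all _ fun θ hθ s hs => hC (θ, s) ⟨uIoc_subset_uIcc hθ, hs⟩
  · exact intervalIntegrable_const
  · exact ae_of_all _ fun θ _ s _ => hG θ s

theorem hasDerivAt_gauss_right (kω β ωb ω : ℝ) :
    HasDerivAt (gauss kω β ωb) (-(kω / β ^ 2) * (ω - ωb) * gauss kω β ωb ω) ω := by
  have h := ((((hasDerivAt_id ω).sub_const ωb).pow 2).const_mul (-(kω / (2 * β ^ 2)))).exp.const_mul
    (Real.sqrt (kω / (2 * Real.pi * β ^ 2)))
  refine h.congr_deriv ?_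
  simp only [gauss, id]
  by_cases hβ : β = 0
  · simp [hβ]
  · field_simp
    simp
    ring

theorem continuous_gauss (kω β ωb : ℝ) : Continuous (gauss kω β ωb) := by
  unfold gauss
  fun_prop

/-- The collision operator with the mean quantities replaced by parameters. -/
def linCollision (kθ kω α β θs ωb : ℝ) (u : ℝ → ℝ → ℝ) (θ ω : ℝ) : ℝ :=
  -kθ * (-Real.cos (θs - θ) * u θ ω + Real.sin (θs - θ) * deriv (fun s => u s ω) θ)
    - kω * (-u θ ω + (ωb - ω) * deriv (fun s => u θ s) ω)
    + α ^ 2 * iteratedDeriv 2 (fun s => u s ω) θ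
    + β ^ 2 * iteratedDeriv 2 (fun s => u θ s) ω

theorem collision_eq {kθ kω α β : ℝ} {u : ℝ → ℝ → ℝ} {h : ℝ → ℝ} (hu : SliceRegular u h)
    (θ ω : ℝ) :
    collision kθ kω α β u θ ω = linCollision kθ kω α β (meanAngle u) (meanAngVel u) u θ ω := by
  have h1 := (((hasDerivAt_id θ).const_sub (meanAngle u)).sin.mul (hu.hasDerivAt_θ θ ω)).deriv
  have h2 := (((hasDerivAt_id ω).const_sub (meanAngVel u)).mul (hu.hasDerivAt_ω θ ω)).deriv
  simp only [id, mul_neg, mul_one, neg_mul, one_mul] at h1 h2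
  have h1' : deriv (fun s => Real.sin (meanAngle u - s) * u s ω) θ = _ := h1
  have h2' : deriv (fun s => (meanAngVel u - s) * u θ s) ω = _ := h2
  rw [collision, linCollision, h1', h2']
  ring

theorem linCollision_eq_add {kθ kω α β θs ωb : ℝ} (u : ℝ → ℝ → ℝ) (θ ω : ℝ) :
    linCollision kθ kω α β θs ωb u θ ω =
      (α ^ 2 * iteratedDeriv 2 (fun s => u s ω) θ -
        kθ * (-Real.cos (θs - θ) * u θ ω + Real.sin (θs - θ) * deriv (fun s => u s ω) θ)) +
      (β ^ 2 * iteratedDeriv 2 (fun s => u θ s) ω -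
        kω * (-u θ ω + (ωb - ω) * deriv (fun s => u θ s) ω)) := by
  rw [linCollision]
  ring

theorem hasDerivAt_fluxθ {kθ α θs : ℝ} {u : ℝ → ℝ → ℝ} {h : ℝ → ℝ} (hu : SliceRegular u h)
    (θ ω : ℝ) :
    HasDerivAt (fun s => α ^ 2 * deriv (fun r => u r ω) s - kθ * (Real.sin (θs - s) * u s ω))
      (α ^ 2 * iteratedDeriv 2 (fun s => u s ω) θ -
        kθ * (-Real.cos (θs - θ) * u θ ω + Real.sin (θs - θ) * deriv (fun s => u s ω) θ)) θ := by
  refine (((hu.hasDerivAt_dθ θ ω).const_mul (α ^ 2)).sub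
    ((((hasDerivAt_id θ).const_sub θs).sin.mul (hu.hasDerivAt_θ θ ω)).const_mul kθ)).congr_deriv ?_
  simp only [id]
  ring

theorem hasDerivAt_fluxω {kω β ωb : ℝ} {u : ℝ → ℝ → ℝ} {h : ℝ → ℝ} (hu : SliceRegular u h)
    (θ ω : ℝ) :
    HasDerivAt (fun s => β ^ 2 * deriv (fun r => u θ r) s - kω * ((ωb - s) * u θ s))
      (β ^ 2 * iteratedDeriv 2 (fun s => u θ s) ω -
        kω * (-u θ ω + (ωb - ω) * deriv (fun s => u θ s) ω)) ω := by
  refine (((hu.hasDerivAt_dω θ ω).const_mul (β ^ 2)).sub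
    ((((hasDerivAt_id ω).const_sub ωb).mul (hu.hasDerivAt_ω θ ω)).const_mul kω)).congr_deriv ?_
  simp only [id]
  ring

/-- Functions of `ω` of at most quadratic growth are integrable against the dominating function. -/
theorem integrable_mul_of_quadratic {w h : ℝ → ℝ} (hw : Continuous w) {C : ℝ}
    (hC : ∀ ω, |w ω| ≤ C * (1 + ω ^ 2)) (hh : Integrable fun ω => (1 + ω ^ 2) * h ω) :
    Integrable fun ω => w ω * h ω := by
  have h1 : Integrable fun ω => (w ω / (1 + ω ^ 2)) * ((1 + ω ^ 2) * h ω) := by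
    have hc : Continuous fun ω : ℝ => w ω / (1 + ω ^ 2) :=
      hw.div (by fun_prop) fun ω => by positivity
    refine hh.bdd_mul hc.aestronglyMeasurable (c := C) (ae_of_all _ fun ω => ?_)
    rw [Real.norm_eq_abs, abs_div, abs_of_pos (by positivity : (0 : ℝ) < 1 + ω ^ 2),
      div_le_iff₀ (by positivity)]
    exact hC ω
  refine h1.congr (ae_of_all _ fun ω => ?_)
  have : (0 : ℝ) < 1 + ω ^ 2 := by positivity
  simp only
  field_simp

/-- Entropy dissipation: a stationary flux `(A, B)` derived from a potential `v` with positive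
mobility `E`, periodic in `θ` and with `B` integrable in `ω`, vanishes. -/
theorem stationary_flux_eq_zero {α β : ℝ} (hα : 0 < α) (hβ : 0 < β) {A A' B B' v E : ℝ → ℝ → ℝ}
    (hEpos : ∀ θ ω, 0 < E θ ω) (hEc : Continuous fun p : ℝ × ℝ => E p.1 p.2)
    (hAc : Continuous fun p : ℝ × ℝ => A p.1 p.2) (hBc : Continuous fun p : ℝ × ℝ => B p.1 p.2)
    (hA'c : Continuous fun p : ℝ × ℝ => A' p.1 p.2)
    (hvc : Continuous fun p : ℝ × ℝ => v p.1 p.2)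
    (hAd : ∀ θ ω, HasDerivAt (fun s => A s ω) (A' θ ω) θ)
    (hBd : ∀ θ ω, HasDerivAt (fun s => B θ s) (B' θ ω) ω)
    (hAB : ∀ θ ω, A' θ ω + B' θ ω = 0)
    (hvθ : ∀ θ ω, HasDerivAt (fun s => v s ω) (A θ ω / (α ^ 2 * E θ ω)) θ)
    (hvω : ∀ θ ω, HasDerivAt (fun s => v θ s) (B θ ω / (β ^ 2 * E θ ω)) ω)
    (hvper : ∀ θ ω, v (θ + 2 * Real.pi) ω = v θ ω)
    (hAper : ∀ θ ω, A (θ + 2 * Real.pi) ω = A θ ω)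
    {k : ℝ → ℝ} (hk : Integrable k) (hBle : ∀ θ ω, |B θ ω| ≤ k ω) (θ ω : ℝ) :
    A θ ω = 0 ∧ B θ ω = 0 := by
  -- D = A ∂_θ(arctan v) + B ∂_ω(arctan v). Since (A, B) is divergence free, this is the divergence
  -- of (A, B) arctan v.
  set D : ℝ → ℝ → ℝ := fun θ ω =>
    (A θ ω ^ 2 / α ^ 2 + B θ ω ^ 2 / β ^ 2) / (E θ ω * (1 + v θ ω ^ 2)) with hD
  have hDc : Continuous fun p : ℝ × ℝ => D p.1 p.2 := by
    refine Continuous.div (by fun_prop) (by fun_prop) fun p => ?_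
    have := hEpos p.1 p.2
    positivity
  have hD0 : ∀ θ ω, 0 ≤ D θ ω := fun θ ω => by
    have := hEpos θ ω
    positivity
  have hP : ∀ θ ω, HasDerivAt (fun s => A s ω * Real.arctan (v s ω))
      (A' θ ω * Real.arctan (v θ ω) +
        A θ ω * (1 / (1 + v θ ω ^ 2) * (A θ ω / (α ^ 2 * E θ ω)))) θ := fun θ ω =>
    (hAd θ ω).mul (hvθ θ ω).arctan
  have hG : ∀ θ ω, HasDerivAt (fun s => B θ s * Real.arctan (v θ s))
      (D θ ω - (A' θ ω * Real.arctan (v θ ω) +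
        A θ ω * (1 / (1 + v θ ω ^ 2) * (A θ ω / (α ^ 2 * E θ ω))))) ω := fun θ ω => by
    refine ((hBd θ ω).mul (hvω θ ω).arctan).congr_deriv ?_
    have h1 := hEpos θ ω
    change B' θ ω * _ + B θ ω * _ = _
    rw [eq_neg_of_add_eq_zero_right (hAB θ ω)]
    simp only [hD]
    have h2 : (0 : ℝ) < 1 + v θ ω ^ 2 := by positivity
    field_simp
    ring
  have hvarc : Continuous fun p : ℝ × ℝ => Real.arctan (v p.1 p.2) :=
    Real.continuous_arctan.comp hvc
  have hP'c : Continuous fun p : ℝ × ℝ => A' p.1 p.2 * Real.arctan (v p.1 p.2) +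
      A p.1 p.2 * (1 / (1 + v p.1 p.2 ^ 2) * (A p.1 p.2 / (α ^ 2 * E p.1 p.2))) := by
    refine (hA'c.mul hvarc).add (hAc.mul ((continuous_const.div (by fun_prop) fun p => ?_).mul
      (hAc.div (by fun_prop) fun p => ?_)))
    · positivity
    · have := hEpos p.1 p.2
      positivity
  -- The θ-part of the divergence integrates to zero over a period, so the flux through the circle
  -- at height ω has derivative ∫ D dθ ≥ 0.
  have hFderiv : ∀ a ω, HasDerivAt (fun s => ∫ θ in a..(a + 2 * Real.pi),
      B θ s * Real.arctan (v θ s)) (∫ θ in a..(a + 2 * Real.pi), D θ ω) ω := fun a ω => by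
    refine (hasDerivAt_integral_of_continuous hG (hBc.mul hvarc) (hDc.sub hP'c) a
      (a + 2 * Real.pi) ω).congr_deriv ?_
    have h1 : Continuous fun θ => D θ ω := hDc.comp (Continuous.prodMk_left ω)
    have h2 : Continuous fun θ => A' θ ω * Real.arctan (v θ ω) +
        A θ ω * (1 / (1 + v θ ω ^ 2) * (A θ ω / (α ^ 2 * E θ ω))) :=
      hP'c.comp (Continuous.prodMk_left ω)
    have h3 : ∫ θ in a..(a + 2 * Real.pi), (A' θ ω * Real.arctan (v θ ω) +
        A θ ω * (1 / (1 + v θ ω ^ 2) * (A θ ω / (α ^ 2 * E θ ω)))) = 0 :=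
      integral_deriv_of_periodic (P := fun s => A s ω * Real.arctan (v s ω))
        (fun θ => hP θ ω) h2 (fun θ => by simp only [hAper, hvper]) a
    rw [intervalIntegral.integral_sub (h1.intervalIntegrable _ _) (h2.intervalIntegrable _ _),
      h3, sub_zero]
  -- The flux is monotone in ω, and integrable because arctan is bounded by π/2 and B is dominated;
  -- no growth control on v is needed.
  have hFzero : ∀ a ω, ∫ θ in a..(a + 2 * Real.pi), B θ ω * Real.arctan (v θ ω) = 0 := by
    intro a
    refine eq_zero_of_monotone_of_integrable ?_ ?_
    · refine monotone_of_deriv_nonneg (fun ω => (hFderiv a ω).differentiableAt) fun ω => ?_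
      rw [(hFderiv a ω).deriv]
      exact intervalIntegral.integral_nonneg (by linarith [Real.pi_pos]) fun θ _ => hD0 θ ω
    · refine (hk.mul_const (Real.pi / 2 * (2 * Real.pi))).mono'
        (Continuous.aestronglyMeasurable ?_) (ae_of_all _ fun ω => ?_)
      · exact continuous_iff_continuousAt.mpr fun ω => (hFderiv a ω).continuousAt
      · have := intervalIntegral.norm_integral_le_of_norm_le_const (a := a)
          (b := a + 2 * Real.pi) (f := fun θ => B θ ω * Real.arctan (v θ ω))
          (C := k ω * (Real.pi / 2)) (fun θ _ => by
            rw [norm_mul]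
            exact mul_le_mul (hBle θ ω) (abs_le.mpr ⟨(Real.neg_pi_div_two_lt_arctan _).le,
              (Real.arctan_lt_pi_div_two _).le⟩) (norm_nonneg _)
              ((abs_nonneg _).trans (hBle θ ω)))
        refine this.trans_eq ?_
        rw [add_sub_cancel_left, abs_of_pos Real.two_pi_pos]
        ring
  -- The period is made to start at the point a under test, so that a lies in the interval of
  -- integration.
  have hDzero : ∀ a ω, D a ω = 0 := by
    intro a ω
    have h1 : ∫ θ in a..(a + 2 * Real.pi), D θ ω = 0 := by
      rw [← (hFderiv a ω).deriv]
      simp only [hFzero a, deriv_const]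
    by_contra hne
    have h2 := intervalIntegral.integral_lt_integral_of_continuousOn_of_le_of_exists_lt
      (a := a) (b := a + 2 * Real.pi) (f := fun _ => 0) (g := fun θ => D θ ω)
      (by linarith [Real.pi_pos]) (by fun_prop)
      (hDc.comp (Continuous.prodMk_left ω)).continuousOn (fun θ _ => hD0 θ ω)
      ⟨a, ⟨le_rfl, by linarith [Real.pi_pos]⟩, lt_of_le_of_ne (hD0 a ω) (Ne.symm hne)⟩
    simp [h1] at h2
  have h1 := hDzero θ ω
  have h2 := hEpos θ ω
  have h3 : (0 : ℝ) < E θ ω * (1 + v θ ω ^ 2) := by positivity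
  simp only [hD] at h1
  rw [div_eq_zero_iff, or_iff_left h3.ne',
    add_eq_zero_iff_of_nonneg (by positivity) (by positivity)] at h1
  constructor
  · simpa [hα.ne'] using h1.1
  · simpa [hβ.ne'] using h1.2

/-- The equilibrium E annihilates both fluxes, so for v = u / E they reduce to α²E ∂_θ v and β²E ∂_ω
v. Entropy dissipation makes them zero, hence v is the constant v(0, 0). -/
theorem stationary_eq {kθ kω α β θs ωb : ℝ} (hα : 0 < α) (hkω : 0 < kω)
    (hβ : 0 < β) {u : ℝ → ℝ → ℝ} {h : ℝ → ℝ} (hu : SliceRegular u h)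
    (heq : ∀ θ ω, linCollision kθ kω α β θs ωb u θ ω = 0) :
    ∃ c, ∀ θ ω, u θ ω = c * (vonMises (kθ / α ^ 2) θs θ * gauss kω β ωb ω) := by
  set κ := kθ / α ^ 2 with hκ
  set E : ℝ → ℝ → ℝ := fun θ ω => vonMises κ θs θ * gauss kω β ωb ω with hE
  have hEpos : ∀ θ ω, 0 < E θ ω := fun θ ω => mul_pos (vonMises_pos _ _ _) (gauss_pos hkω hβ _ _)
  have hEc : Continuous fun p : ℝ × ℝ => E p.1 p.2 :=
    ((continuous_vonMises κ θs).comp continuous_fst).mul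
      ((continuous_gauss kω β ωb).comp continuous_snd)
  set v : ℝ → ℝ → ℝ := fun θ ω => u θ ω / E θ ω with hv
  set A : ℝ → ℝ → ℝ := fun θ ω =>
    α ^ 2 * deriv (fun r => u r ω) θ - kθ * (Real.sin (θs - θ) * u θ ω) with hA
  set B : ℝ → ℝ → ℝ := fun θ ω =>
    β ^ 2 * deriv (fun r => u θ r) ω - kω * ((ωb - ω) * u θ ω) with hB
  set A' : ℝ → ℝ → ℝ := fun θ ω => α ^ 2 * iteratedDeriv 2 (fun s => u s ω) θ -
    kθ * (-Real.cos (θs - θ) * u θ ω + Real.sin (θs - θ) * deriv (fun s => u s ω) θ) with hA'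
  set B' : ℝ → ℝ → ℝ := fun θ ω => β ^ 2 * iteratedDeriv 2 (fun s => u θ s) ω -
    kω * (-u θ ω + (ωb - ω) * deriv (fun s => u θ s) ω) with hB'
  have huc := hu.continuous
  have huθ := hu.continuous_dθ
  have huω := hu.continuous_dω
  have huθθ := hu.continuous_dθθ
  have huωω := hu.continuous_dωω
  have hAB : ∀ θ ω, A' θ ω + B' θ ω = 0 := fun θ ω => by
    rw [← heq θ ω, linCollision_eq_add]
  have hAc : Continuous fun p : ℝ × ℝ => A p.1 p.2 := by
    simp only [hA]
    fun_prop
  have hBc : Continuous fun p : ℝ × ℝ => B p.1 p.2 := by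
    simp only [hB]
    fun_prop
  have hA'c : Continuous fun p : ℝ × ℝ => A' p.1 p.2 := by
    simp only [hA']
    fun_prop
  have hvc : Continuous fun p : ℝ × ℝ => v p.1 p.2 :=
    huc.div hEc fun p => (hEpos _ _).ne'
  have hvθ : ∀ θ ω, HasDerivAt (fun s => v s ω) (A θ ω / (α ^ 2 * E θ ω)) θ := fun θ ω => by
    refine ((hu.hasDerivAt_θ θ ω).div ((hasDerivAt_vonMises κ θs θ).mul_const (gauss kω β ωb ω))
      (hEpos θ ω).ne').congr_deriv ?_
    have h1 := vonMises_pos κ θs θ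
    have h2 := gauss_pos hkω hβ ωb ω
    have h3 : Real.sin (θs - θ) = -Real.sin (θ - θs) := by rw [← Real.sin_neg, neg_sub]
    simp only [hA, hE, h3]
    rw [show kθ = κ * α ^ 2 by rw [hκ]; field_simp]
    field_simp
  have hvω : ∀ θ ω, HasDerivAt (fun s => v θ s) (B θ ω / (β ^ 2 * E θ ω)) ω := fun θ ω => by
    refine ((hu.hasDerivAt_ω θ ω).div ((hasDerivAt_gauss_right kω β ωb ω).const_mul
      (vonMises κ θs θ)) (hEpos θ ω).ne').congr_deriv ?_
    have h1 := vonMises_pos κ θs θ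
    have h2 := gauss_pos hkω hβ ωb ω
    simp only [hB, hE]
    field_simp
    ring
  have hvper : ∀ θ ω, v (θ + 2 * Real.pi) ω = v θ ω := fun θ ω => by
    simp only [hv, hE, hu.periodic, periodic_vonMises κ θs θ]
  have hAper : ∀ θ ω, A (θ + 2 * Real.pi) ω = A θ ω := fun θ ω => by
    simp only [hA, hu.periodic, hu.periodic_dθ,
      show θs - (θ + 2 * Real.pi) = θs - θ - 2 * Real.pi by ring, Real.sin_sub_two_pi]
  have hBle : ∀ θ ω, |B θ ω| ≤ (β ^ 2 + kω * (|ωb| + |ω|)) * h ω := fun θ ω => by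
    have h0 := hu.bound_nonneg ω
    calc |B θ ω| ≤ |β ^ 2 * deriv (fun r => u θ r) ω| + |kω * ((ωb - ω) * u θ ω)| := abs_sub _ _
      _ = β ^ 2 * |deriv (fun r => u θ r) ω| + kω * (|ωb - ω| * |u θ ω|) := by
        rw [abs_mul, abs_mul, abs_mul, abs_of_pos hkω, abs_of_nonneg (sq_nonneg β)]
      _ ≤ β ^ 2 * h ω + kω * ((|ωb| + |ω|) * h ω) := by
        gcongr
        · exact hu.dω_le θ ω
        · exact abs_sub _ _
        · exact hu.val_le θ ω
      _ = _ := by ring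
  have hint : Integrable fun ω => (β ^ 2 + kω * (|ωb| + |ω|)) * h ω := by
    refine integrable_mul_of_quadratic (by fun_prop) (C := β ^ 2 + kω * (|ωb| + 1))
      (fun ω => ?_) hu.integrable
    have : |ω| ≤ 1 + ω ^ 2 := by nlinarith [sq_nonneg (|ω| - 1), sq_abs ω, abs_nonneg ω]
    rw [abs_of_nonneg (by positivity)]
    have h1 : kω * |ω| ≤ kω * (1 + ω ^ 2) := by gcongr
    nlinarith [mul_nonneg (add_nonneg (sq_nonneg β) (mul_nonneg hkω.le (abs_nonneg ωb)))
      (sq_nonneg ω)]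
  have hABzero : ∀ θ ω, A θ ω = 0 ∧ B θ ω = 0 :=
    stationary_flux_eq_zero hα hβ hEpos hEc hAc hBc hA'c hvc (hasDerivAt_fluxθ hu)
      (hasDerivAt_fluxω hu) hAB hvθ hvω hvper hAper hint hBle
  refine ⟨v 0 0, fun θ ω => ?_⟩
  have hc1 : v θ ω = v 0 ω := by
    refine is_const_of_deriv_eq_zero (f := fun s => v s ω)
      (fun s => (hvθ s ω).differentiableAt) (fun s => ?_) θ 0
    rw [(hvθ s ω).deriv, (hABzero s ω).1, zero_div]
  have hc2 : v 0 ω = v 0 0 := by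
    refine is_const_of_deriv_eq_zero (f := fun s => v 0 s)
      (fun s => (hvω 0 s).differentiableAt) (fun s => ?_) ω 0
    rw [(hvω 0 s).deriv, (hABzero 0 s).2, zero_div]
  rw [← hc2, ← hc1]
  exact (div_mul_cancel₀ _ (hEpos θ ω).ne').symm

/-! ### Weighted domination -/

/-- `F` is continuous and `O((1 + |ω|) ^ n h(ω))`. -/
structure Dominated (h : ℝ → ℝ) (n : ℕ) (F : ℝ × ℝ → ℝ) : Prop where
  continuous : Continuous F
  bound : ∃ C, ∀ p : ℝ × ℝ, |F p| ≤ C * ((1 + |p.2|) ^ n * h p.2)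

theorem exists_abs_le_of_periodic {ψ : ℝ → ℝ} {c : ℝ} (hψ : Function.Periodic ψ c)
    (hc : c ≠ 0) (hcont : Continuous ψ) : ∃ M, ∀ θ, |ψ θ| ≤ M := by
  obtain ⟨M, hM⟩ := isBounded_iff_forall_norm_le.mp (hψ.isBounded_of_continuous hc hcont)
  exact ⟨M, fun θ => hM _ ⟨θ, rfl⟩⟩

theorem integrable_one_add_abs_pow {h : ℝ → ℝ} (hh : Integrable fun ω => (1 + ω ^ 2) * h ω)
    {n : ℕ} (hn : n ≤ 2) : Integrable fun ω => (1 + |ω|) ^ n * h ω := by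
  refine integrable_mul_of_quadratic (by fun_prop) (C := 2) (fun ω => ?_) hh
  have h1 : (1 : ℝ) ≤ 1 + |ω| := by linarith [abs_nonneg ω]
  rw [abs_of_nonneg (by positivity)]
  calc (1 + |ω|) ^ n ≤ (1 + |ω|) ^ 2 := pow_le_pow_right₀ h1 hn
    _ ≤ 2 * (1 + ω ^ 2) := by nlinarith [sq_nonneg (1 - |ω|), sq_abs ω]

theorem abs_affine_le (a b ω : ℝ) : |a + b * ω| ≤ (|a| + |b|) * (1 + |ω|) := by
  have := abs_add_le a (b * ω)
  rw [abs_mul] at this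
  nlinarith [mul_nonneg (abs_nonneg a) (abs_nonneg ω), abs_nonneg b]

namespace Dominated

variable {h : ℝ → ℝ} {n : ℕ} {F G : ℝ × ℝ → ℝ}

theorem of_le (hF : Continuous F) (hb : ∀ p : ℝ × ℝ, |F p| ≤ h p.2) : Dominated h 0 F :=
  ⟨hF, 1, by simpa using hb⟩

theorem add (hF : Dominated h n F) (hG : Dominated h n G) :
    Dominated h n fun p => F p + G p := by
  obtain ⟨C, hC⟩ := hF.bound
  obtain ⟨C', hC'⟩ := hG.bound
  refine ⟨hF.continuous.add hG.continuous, C + C', fun p => (abs_add_le _ _).trans ?_⟩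
  linarith [hC p, hC' p]

theorem sub (hF : Dominated h n F) (hG : Dominated h n G) :
    Dominated h n fun p => F p - G p := by
  obtain ⟨C, hC⟩ := hF.bound
  obtain ⟨C', hC'⟩ := hG.bound
  refine ⟨hF.continuous.sub hG.continuous, C + C', fun p => (abs_sub _ _).trans ?_⟩
  linarith [hC p, hC' p]

theorem bdd_mul (hF : Dominated h n F) {w : ℝ × ℝ → ℝ} (hw : Continuous w)
    (hb : ∃ M, ∀ p, |w p| ≤ M) : Dominated h n fun p => w p * F p := by
  obtain ⟨C, hC⟩ := hF.bound
  obtain ⟨M, hM⟩ := hb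
  refine ⟨hw.mul hF.continuous, M * C, fun p => ?_⟩
  rw [abs_mul, mul_assoc]
  exact mul_le_mul (hM p) (hC p) (abs_nonneg _) ((abs_nonneg _).trans (hM p))

theorem const_mul (hF : Dominated h n F) (c : ℝ) : Dominated h n fun p => c * F p :=
  hF.bdd_mul continuous_const ⟨|c|, fun _ => le_rfl⟩

theorem affine_mul (hF : Dominated h n F) (a b : ℝ) :
    Dominated h (n + 1) fun p => (a + b * p.2) * F p := by
  obtain ⟨C, hC⟩ := hF.bound
  refine ⟨Continuous.mul (by fun_prop) hF.continuous, (|a| + |b|) * C, fun p => ?_⟩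
  rw [abs_mul]
  have h1 := abs_affine_le a b p.2
  calc |a + b * p.2| * |F p| ≤ (|a| + |b|) * (1 + |p.2|) * (C * ((1 + |p.2|) ^ n * h p.2)) :=
        mul_le_mul h1 (hC p) (abs_nonneg _) (by positivity)
    _ = _ := by ring

theorem succ (hF : Dominated h n F) : Dominated h (n + 1) F := by
  simpa using hF.affine_mul 1 0

theorem exists_integrable (hF : Dominated h n F) (hn : n ≤ 2)
    (hh : Integrable fun ω => (1 + ω ^ 2) * h ω) :
    ∃ k : ℝ → ℝ, Integrable k ∧ ∀ p : ℝ × ℝ, ‖F p‖ ≤ k p.2 := by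
  obtain ⟨C, hC⟩ := hF.bound
  exact ⟨_, (integrable_one_add_abs_pow hh hn).const_mul C, hC⟩

theorem integrable (hF : Dominated h n F) (hn : n ≤ 2)
    (hh : Integrable fun ω => (1 + ω ^ 2) * h ω) : Integrable F cyl := by
  obtain ⟨k, hk, hb⟩ := hF.exists_integrable hn hh
  exact integrable_cyl_of_le hF.continuous hk hb

end Dominated

/-! ### Duality for the linear collision operator -/

namespace SliceRegular

variable {u : ℝ → ℝ → ℝ} {h : ℝ → ℝ} (hu : SliceRegular u h)
include hu

theorem dominated : Dominated h 0 fun p => u p.1 p.2 :=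
  .of_le hu.continuous fun p => hu.val_le p.1 p.2

theorem dominated_dθ : Dominated h 0 fun p => deriv (fun s => u s p.2) p.1 :=
  .of_le hu.continuous_dθ fun p => hu.dθ_le p.1 p.2

theorem dominated_dω : Dominated h 0 fun p => deriv (fun s => u p.1 s) p.2 :=
  .of_le hu.continuous_dω fun p => hu.dω_le p.1 p.2

theorem dominated_dθθ : Dominated h 0 fun p => iteratedDeriv 2 (fun s => u s p.2) p.1 :=
  .of_le hu.continuous_dθθ fun p => hu.dθθ_le p.1 p.2

theorem dominated_dωω : Dominated h 0 fun p => iteratedDeriv 2 (fun s => u p.1 s) p.2 :=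
  .of_le hu.continuous_dωω fun p => hu.dωω_le p.1 p.2

theorem dominated_dfluxθ (kθ α θs : ℝ) : Dominated h 0 fun p =>
    α ^ 2 * iteratedDeriv 2 (fun s => u s p.2) p.1 -
      kθ * (-Real.cos (θs - p.1) * u p.1 p.2 +
        Real.sin (θs - p.1) * deriv (fun s => u s p.2) p.1) :=
  (hu.dominated_dθθ.const_mul _).sub (((hu.dominated.bdd_mul (w := fun p => -Real.cos (θs - p.1))
    (by fun_prop) ⟨1, fun p => by simpa using Real.abs_cos_le_one _⟩).add
    (hu.dominated_dθ.bdd_mul (w := fun p => Real.sin (θs - p.1)) (by fun_prop)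
      ⟨1, fun p => Real.abs_sin_le_one _⟩)).const_mul kθ)

theorem dominated_fluxω (kω β ωb : ℝ) : Dominated h 1 fun p =>
    β ^ 2 * deriv (fun r => u p.1 r) p.2 - kω * ((ωb - p.2) * u p.1 p.2) := by
  refine (hu.dominated_dω.const_mul _).succ.sub (Dominated.const_mul ?_ kω)
  simpa [← sub_eq_add_neg] using hu.dominated.affine_mul ωb (-1)

theorem dominated_dfluxω (kω β ωb : ℝ) : Dominated h 1 fun p =>
    β ^ 2 * iteratedDeriv 2 (fun s => u p.1 s) p.2 -
      kω * (-u p.1 p.2 + (ωb - p.2) * deriv (fun s => u p.1 s) p.2) := by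
  refine (hu.dominated_dωω.const_mul _).succ.sub (Dominated.const_mul (.add ?_ ?_) kω)
  · simpa using (hu.dominated.const_mul (-1)).succ
  · simpa [← sub_eq_add_neg] using hu.dominated_dω.affine_mul ωb (-1)

theorem dominated_linCollision (kθ kω α β θs ωb : ℝ) :
    Dominated h 1 fun p => linCollision kθ kω α β θs ωb u p.1 p.2 := by
  simp only [linCollision_eq_add]
  exact (hu.dominated_dfluxθ kθ α θs).succ.add (hu.dominated_dfluxω kω β ωb)

/-- Duality between the linearised collision operator and test functions `ψ(θ) (a + b ω)`. -/
theorem integral_linCollision_mul (kθ kω α β θs ωb a b : ℝ) {ψ ψ' ψ'' : ℝ → ℝ}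
    (hψ : ∀ θ, HasDerivAt ψ (ψ' θ) θ) (hψ' : ∀ θ, HasDerivAt ψ' (ψ'' θ) θ)
    (hψ''c : Continuous ψ'') (hp : Function.Periodic ψ (2 * Real.pi))
    (hp' : Function.Periodic ψ' (2 * Real.pi)) (hp'' : Function.Periodic ψ'' (2 * Real.pi)) :
    ∫ p, linCollision kθ kω α β θs ωb u p.1 p.2 * (ψ p.1 * (a + b * p.2)) ∂cyl =
      ∫ p, u p.1 p.2 * ((kθ * Real.sin (θs - p.1) * ψ' p.1 + α ^ 2 * ψ'' p.1) * (a + b * p.2)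
        + kω * (ωb - p.2) * b * ψ p.1) ∂cyl := by
  have hψc : Continuous ψ := continuous_iff_continuousAt.mpr fun θ => (hψ θ).continuousAt
  have hψ'c : Continuous ψ' := continuous_iff_continuousAt.mpr fun θ => (hψ' θ).continuousAt
  have bd : ∀ {χ : ℝ → ℝ}, Continuous χ → Function.Periodic χ (2 * Real.pi) →
      ∃ M, ∀ p : ℝ × ℝ, |χ p.1| ≤ M := fun hc hχ => by
    obtain ⟨M, hM⟩ := exists_abs_le_of_periodic hχ Real.two_pi_pos.ne' hc
    exact ⟨M, fun p => hM p.1⟩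
  have bψ := bd hψc hp
  have bψ' := bd hψ'c hp'
  have bψ'' := bd hψ''c hp''
  have cψ : Continuous fun p : ℝ × ℝ => ψ p.1 := hψc.comp continuous_fst
  have cψ' : Continuous fun p : ℝ × ℝ => ψ' p.1 := hψ'c.comp continuous_fst
  have cψ'' : Continuous fun p : ℝ × ℝ => ψ'' p.1 := hψ''c.comp continuous_fst
  have bs : ∃ M, ∀ p : ℝ × ℝ, |Real.sin (θs - p.1)| ≤ M := ⟨1, fun p => Real.abs_sin_le_one _⟩
  have cs : Continuous fun p : ℝ × ℝ => Real.sin (θs - p.1) := by fun_prop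
  -- the adjoint applied to the test function
  have dN : Dominated h 1 fun p => (a + b * p.2) * (kθ * (ψ' p.1 * (Real.sin (θs - p.1) *
      u p.1 p.2)) + α ^ 2 * (ψ'' p.1 * u p.1 p.2)) :=
    ((((hu.dominated.bdd_mul cs bs).bdd_mul cψ' bψ').const_mul kθ).add
      ((hu.dominated.bdd_mul cψ'' bψ'').const_mul (α ^ 2))).affine_mul a b
  have dN' : Dominated h 1 fun p => kω * b * (ψ p.1 * ((ωb + (-1) * p.2) * u p.1 p.2)) :=
    ((hu.dominated.affine_mul ωb (-1)).bdd_mul cψ bψ).const_mul (kω * b)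
  have dP : Dominated h 1 fun p => (a + b * p.2) * (ψ p.1 *
      (α ^ 2 * iteratedDeriv 2 (fun s => u s p.2) p.1 -
        kθ * (-Real.cos (θs - p.1) * u p.1 p.2 +
          Real.sin (θs - p.1) * deriv (fun s => u s p.2) p.1))) -
      (a + b * p.2) * (kθ * (ψ' p.1 * (Real.sin (θs - p.1) *
      u p.1 p.2)) + α ^ 2 * (ψ'' p.1 * u p.1 p.2)) :=
    (((hu.dominated_dfluxθ kθ α θs).bdd_mul cψ bψ).affine_mul a b).sub dN
  -- The weight (1 + |ω|)² has one factor from the test function and one from the drift; the second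
  -- moment of h is used here.
  have dR : Dominated h 2 fun p => (a + b * p.2) * (ψ p.1 *
      (β ^ 2 * deriv (fun r => u p.1 r) p.2 - kω * ((ωb - p.2) * u p.1 p.2))) -
      β ^ 2 * b * (ψ p.1 * u p.1 p.2) :=
    (((hu.dominated_fluxω kω β ωb).bdd_mul cψ bψ).affine_mul a b).sub
      ((hu.dominated.bdd_mul cψ bψ).const_mul (β ^ 2 * b)).succ.succ
  have dR' : Dominated h 2 fun p => (a + b * p.2) * (ψ p.1 *
      (β ^ 2 * iteratedDeriv 2 (fun s => u p.1 s) p.2 -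
        kω * (-u p.1 p.2 + (ωb - p.2) * deriv (fun s => u p.1 s) p.2))) -
      kω * b * (ψ p.1 * ((ωb + (-1) * p.2) * u p.1 p.2)) :=
    (((hu.dominated_dfluxω kω β ωb).bdd_mul cψ bψ).affine_mul a b).sub dN'.succ
  obtain ⟨kP, hkP, hbP⟩ := dP.exists_integrable (by norm_num) hu.integrable
  obtain ⟨kR, hkR, hbR⟩ := dR.exists_integrable le_rfl hu.integrable
  obtain ⟨kR', hkR', hbR'⟩ := dR'.exists_integrable le_rfl hu.integrable
  -- Green's identity in θ: subtracting α² u ψ' from ψ times the flux cancels the ∂_θ u terms in the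
  -- derivative, leaving the tested flux derivative minus the adjoint part.
  have iP := integral_cyl_dθ (P := fun θ ω => (a + b * ω) * (ψ θ *
      (α ^ 2 * deriv (fun r => u r ω) θ - kθ * (Real.sin (θs - θ) * u θ ω)) -
      α ^ 2 * (u θ ω * ψ' θ)))
    (P' := fun θ ω => (a + b * ω) * (ψ θ *
      (α ^ 2 * iteratedDeriv 2 (fun s => u s ω) θ -
        kθ * (-Real.cos (θs - θ) * u θ ω + Real.sin (θs - θ) * deriv (fun s => u s ω) θ))) -
      (a + b * ω) * (kθ * (ψ' θ * (Real.sin (θs - θ) * u θ ω)) + α ^ 2 * (ψ'' θ * u θ ω)))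
    (fun θ ω => by
      refine ((((hψ θ).mul (hasDerivAt_fluxθ hu θ ω)).sub (((hu.hasDerivAt_θ θ ω).mul
        (hψ' θ)).const_mul (α ^ 2))).const_mul (a + b * ω)).congr_deriv ?_
      ring) dP.continuous
    (fun θ ω => by
      simp only [hu.periodic, hu.periodic_dθ, hp θ, hp' θ,
        show θs - (θ + 2 * Real.pi) = θs - θ - 2 * Real.pi by ring, Real.sin_sub_two_pi]) hkP hbP
  -- The same in ω, with correction β² b ψ u. The test function is affine in ω, so β² leaves no term
  -- in the adjoint.
  have iR := integral_cyl_dω (R := fun θ ω => (a + b * ω) * (ψ θ *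
      (β ^ 2 * deriv (fun r => u θ r) ω - kω * ((ωb - ω) * u θ ω))) -
      β ^ 2 * b * (ψ θ * u θ ω))
    (R' := fun θ ω => (a + b * ω) * (ψ θ * (β ^ 2 * iteratedDeriv 2 (fun s => u θ s) ω -
        kω * (-u θ ω + (ωb - ω) * deriv (fun s => u θ s) ω))) -
      kω * b * (ψ θ * ((ωb + (-1) * ω) * u θ ω)))
    (fun θ ω => by
      refine (((((hasDerivAt_id ω).const_mul b).const_add a).mul
        ((hasDerivAt_fluxω hu θ ω).const_mul (ψ θ))).sub
        (((hu.hasDerivAt_ω θ ω).const_mul (ψ θ)).const_mul (β ^ 2 * b))).congr_deriv ?_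
      simp only [id]
      ring) dR.continuous dR'.continuous hkR hkR' hbR hbR'
  have jP := dP.integrable (by norm_num) hu.integrable
  have jR' := dR'.integrable le_rfl hu.integrable
  have jN := dN.integrable (by norm_num) hu.integrable
  have jN' := dN'.integrable (by norm_num) hu.integrable
  have hsum := integral_add (jP.add jR') (jN.add jN')
  have hPR := integral_add jP jR'
  simp only [Pi.add_apply] at hsum hPR
  rw [hPR, iP, iR, add_zero, zero_add] at hsum
  calc _ = _ := integral_congr_ae (ae_of_all _ fun p => by
        simp only [linCollision_eq_add]
        ring)
    _ = _ := hsum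
    _ = _ := integral_congr_ae (ae_of_all _ fun p => by
        simp only
        ring)

end SliceRegular

/-! ### Regularity in `(t, x)` -/

/-- Total derivative of a phase function with respect to `(t, x)`. -/
def dtx (f : PhaseFun) (p : ℝ × Plane) (z : ℝ × ℝ) : (ℝ × Plane) →L[ℝ] ℝ :=
  fderiv ℝ (fun q : ℝ × Plane => f q.1 q.2 z.1 z.2) p

section Regularity

variable {f : PhaseFun} {I : Set ℝ} {n : WithTop ℕ∞}

theorem contDiff_slice
    (hf : ContDiffOn ℝ n (fun p : ℝ × Plane × ℝ × ℝ => f p.1 p.2.1 p.2.2.1 p.2.2.2) (I ×ˢ univ))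
    {t : ℝ} (ht : t ∈ I) (x : Plane) : ContDiff ℝ n fun p : ℝ × ℝ => f t x p.1 p.2 := by
  rw [← contDiffOn_univ]
  exact hf.comp (g := fun p : ℝ × Plane × ℝ × ℝ => f p.1 p.2.1 p.2.2.1 p.2.2.2)
    (f := fun p : ℝ × ℝ => (t, x, p.1, p.2)) (by fun_prop) fun p _ => ⟨ht, mem_univ _⟩

theorem contDiffOn_section
    (hf : ContDiffOn ℝ n (fun p : ℝ × Plane × ℝ × ℝ => f p.1 p.2.1 p.2.2.1 p.2.2.2) (I ×ˢ univ))
    (z : ℝ × ℝ) : ContDiffOn ℝ n (fun q : ℝ × Plane => f q.1 q.2 z.1 z.2) (I ×ˢ univ) :=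
  hf.comp (g := fun p : ℝ × Plane × ℝ × ℝ => f p.1 p.2.1 p.2.2.1 p.2.2.2)
    (f := fun q : ℝ × Plane => (q.1, q.2, z.1, z.2)) (by fun_prop) fun q hq => ⟨hq.1, mem_univ _⟩

theorem isOpen_timeSpace (hI : IsOpen I) : IsOpen (I ×ˢ (univ : Set Plane)) :=
  hI.prod isOpen_univ

variable (hI : IsOpen I) (hf : ContDiffOn ℝ 1
  (fun p : ℝ × Plane × ℝ × ℝ => f p.1 p.2.1 p.2.2.1 p.2.2.2) (I ×ˢ univ))
include hI hf

theorem hasFDerivAt_dtx {p : ℝ × Plane} (hp : p.1 ∈ I) (z : ℝ × ℝ) :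
    HasFDerivAt (fun q : ℝ × Plane => f q.1 q.2 z.1 z.2) (dtx f p z) p :=
  (((contDiffOn_section hf z).differentiableOn (by simp)).differentiableAt
    ((isOpen_timeSpace hI).mem_nhds ⟨hp, mem_univ _⟩)).hasFDerivAt

theorem hasDerivAt_dtx_time {t : ℝ} (ht : t ∈ I) (x : Plane) (z : ℝ × ℝ) :
    HasDerivAt (fun s => f s x z.1 z.2) (dtx f (t, x) z (1, 0)) t :=
  HasFDerivAt.comp_hasDerivAt t (f := fun s => (s, x)) (hasFDerivAt_dtx hI hf (p := (t, x)) ht z)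
    ((hasDerivAt_id t).prodMk (hasDerivAt_const t x))

theorem hasFDerivAt_dtx_space {t : ℝ} (ht : t ∈ I) (x : Plane) (z : ℝ × ℝ) :
    HasFDerivAt (fun y => f t y z.1 z.2)
      ((dtx f (t, x) z).comp (ContinuousLinearMap.inr ℝ ℝ Plane)) x :=
  HasFDerivAt.comp x (f := fun y => (t, y)) (hasFDerivAt_dtx hI hf (p := (t, x)) ht z)
    (hasFDerivAt_prodMk_right t x)

theorem dtx_apply {t : ℝ} (ht : t ∈ I) (x : Plane) (z : ℝ × ℝ) (s : ℝ) (v : Plane) :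
    dtx f (t, x) z (s, v) = s * deriv (fun s => f s x z.1 z.2) t +
      inner ℝ v (gradient (fun y => f t y z.1 z.2) x) := by
  have h1 : (s, v) = s • ((1, 0) : ℝ × Plane) + (0, v) := by simp
  have h2 : inner ℝ v (gradient (fun y => f t y z.1 z.2) x) = dtx f (t, x) z (0, v) := by
    rw [inner_gradient_right, (hasFDerivAt_dtx_space hI hf ht x z).fderiv]
    simp
  rw [h1, map_add, map_smul, (hasDerivAt_dtx_time hI hf ht x z).deriv, h2, smul_eq_mul]

theorem norm_dtx_le {t : ℝ} (ht : t ∈ I) (x : Plane) (z : ℝ × ℝ) {c : ℝ}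
    (h1 : |deriv (fun s => f s x z.1 z.2) t| ≤ c)
    (h2 : ‖gradient (fun y => f t y z.1 z.2) x‖ ≤ c) : ‖dtx f (t, x) z‖ ≤ 2 * c := by
  have hc : 0 ≤ c := (abs_nonneg _).trans h1
  refine ContinuousLinearMap.opNorm_le_bound _ (by positivity) fun w => ?_
  obtain ⟨s, v⟩ := w
  rw [dtx_apply hI hf ht]
  have hs : ‖s‖ ≤ ‖(s, v)‖ := norm_fst_le (s, v)
  have hv : ‖v‖ ≤ ‖(s, v)‖ := norm_snd_le (s, v)
  calc ‖s * deriv (fun s => f s x z.1 z.2) t + inner ℝ v (gradient (fun y => f t y z.1 z.2) x)‖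
      ≤ ‖s‖ * |deriv (fun s => f s x z.1 z.2) t| +
        ‖v‖ * ‖gradient (fun y => f t y z.1 z.2) x‖ := by
        refine (norm_add_le _ _).trans (add_le_add (norm_mul_le _ _) (norm_inner_le_norm _ _))
    _ ≤ ‖(s, v)‖ * c + ‖(s, v)‖ * c := by gcongr
    _ = _ := by ring

/-- The derivative in (t, x) is the full derivative composed with the fixed inclusion `L`, hence
jointly continuous in all variables. -/
theorem continuousOn_dtx :
    ContinuousOn (fun q : (ℝ × Plane) × ℝ × ℝ => dtx f q.1 q.2) ((I ×ˢ univ) ×ˢ univ) := by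
  have hO : IsOpen (I ×ˢ (univ : Set (Plane × ℝ × ℝ))) := hI.prod isOpen_univ
  have hc := hf.continuousOn_fderiv_of_isOpen hO (by simp)
  let L : (ℝ × Plane) →L[ℝ] ℝ × Plane × ℝ × ℝ :=
    (ContinuousLinearMap.fst ℝ ℝ Plane).prod ((ContinuousLinearMap.snd ℝ ℝ Plane).prod 0)
  have h1 : ContinuousOn (fun q : (ℝ × Plane) × ℝ × ℝ =>
      (fderiv ℝ (fun p : ℝ × Plane × ℝ × ℝ => f p.1 p.2.1 p.2.2.1 p.2.2.2)
        (q.1.1, q.1.2, q.2)).comp L) ((I ×ˢ univ) ×ˢ univ) := by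
    refine ContinuousOn.clm_comp (hc.comp (by fun_prop) ?_) continuousOn_const
    intro q hq
    exact ⟨hq.1.1, mem_univ _⟩
  refine h1.congr fun q hq => ?_
  have hd : HasFDerivAt (fun p : ℝ × Plane × ℝ × ℝ => f p.1 p.2.1 p.2.2.1 p.2.2.2) _
      (q.1.1, q.1.2, q.2) := ((hf.differentiableOn (by simp)).differentiableAt
        (hO.mem_nhds ⟨hq.1.1, mem_univ _⟩)).hasFDerivAt
  refine HasFDerivAt.fderiv (HasFDerivAt.comp q.1
    (f := fun p : ℝ × Plane => (p.1, p.2, q.2.1, q.2.2)) hd ?_)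
  exact hasFDerivAt_fst.prodMk (hasFDerivAt_snd.prodMk (hasFDerivAt_const _ _))

theorem continuous_dtx {t : ℝ} (ht : t ∈ I) (x : Plane) :
    Continuous fun z : ℝ × ℝ => dtx f (t, x) z := by
  rw [← continuousOn_univ]
  exact (continuousOn_dtx hI hf).comp (f := fun z : ℝ × ℝ => ((t, x), z)) (by fun_prop)
    fun z _ => ⟨⟨ht, mem_univ _⟩, mem_univ _⟩

end Regularity

theorem continuous_tau : Continuous tau := by
  unfold tau
  fun_prop

theorem norm_tau (θ : ℝ) : ‖tau θ‖ = 1 := by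
  rw [EuclideanSpace.norm_eq]
  simp [tau, Fin.sum_univ_two]

/-- The free transport part of the kinetic equation. -/
def transport (f : PhaseFun) (t : ℝ) (x : Plane) (z : ℝ × ℝ) : ℝ :=
  dtx f (t, x) z (1, tau z.1) + z.2 * deriv (fun s => f t x s z.2) z.1

/-! ### Bounds at a fixed time and position -/

section Slice

variable {f : PhaseFun} {I : Set ℝ} {h : ℝ → ℝ} {t : ℝ} {x : Plane}

theorem sliceRegular_of_bound
    (hf : ContDiffOn ℝ 2 (fun p : ℝ × Plane × ℝ × ℝ => f p.1 p.2.1 p.2.2.1 p.2.2.2) (I ×ˢ univ))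
    (ht : t ∈ I) (hp : ∀ θ ω, f t x (θ + 2 * Real.pi) ω = f t x θ ω)
    (hh : Integrable fun ω => (1 + ω ^ 2) * h ω) (hb : ∀ θ ω, DerivBound f h t x θ ω) :
    SliceRegular (f t x) h where
  contDiff := contDiff_slice hf ht x
  periodic := hp
  val_le θ ω := (hb θ ω).val
  dθ_le θ ω := (hb θ ω).dθ
  dω_le θ ω := (hb θ ω).dω
  dθθ_le θ ω := (hb θ ω).dθθ
  dωω_le θ ω := (hb θ ω).dωω
  integrable := hh

variable (hI : IsOpen I) (hf : ContDiffOn ℝ 2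
    (fun p : ℝ × Plane × ℝ × ℝ => f p.1 p.2.1 p.2.2.1 p.2.2.2) (I ×ˢ univ)) (ht : t ∈ I)
include hI hf ht

theorem norm_dtx_le_of_bound (hb : ∀ θ ω, DerivBound f h t x θ ω) (z : ℝ × ℝ) :
    ‖dtx f (t, x) z‖ ≤ 2 * h z.2 :=
  norm_dtx_le hI (hf.of_le (by norm_num)) ht x z (hb z.1 z.2).dt (hb z.1 z.2).dx

theorem residual_eq (hu : SliceRegular (f t x) h) (kθ kω α β ε : ℝ) (θ ω : ℝ) :
    residual kθ kω α β ε f t x θ ω = transport f t x (θ, ω) - (1 / ε) *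
      linCollision kθ kω α β (meanAngle (f t x)) (meanAngVel (f t x)) (f t x) θ ω := by
  rw [residual, collision_eq hu, transport, dtx_apply hI (hf.of_le (by norm_num)) ht,
    deriv_const_mul _ (hu.hasDerivAt_θ θ ω).differentiableAt, one_mul]

theorem continuous_transport (hu : SliceRegular (f t x) h) : Continuous (transport f t x) :=
  ((continuous_dtx hI (hf.of_le (by norm_num)) ht x).clm_apply
    (continuous_const.prodMk (continuous_tau.comp continuous_fst))).add
    (continuous_snd.mul hu.continuous_dθ)

variable (hb : ∀ θ ω, DerivBound f h t x θ ω)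
include hb

theorem abs_dtx_apply_le (z : ℝ × ℝ) {w : ℝ × Plane} {M : ℝ} (hw : ‖w‖ ≤ M) :
    |dtx f (t, x) z w| ≤ 2 * M * h z.2 := by
  have h1 := norm_dtx_le_of_bound hI hf ht hb z
  calc |dtx f (t, x) z w| ≤ ‖dtx f (t, x) z‖ * ‖w‖ := (dtx f (t, x) z).le_opNorm w
    _ ≤ 2 * h z.2 * M := mul_le_mul h1 hw (norm_nonneg _) ((norm_nonneg _).trans h1)
    _ = _ := by ring

theorem abs_transport_le (z : ℝ × ℝ) : |transport f t x z| ≤ 2 * ((1 + |z.2|) * h z.2) := by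
  -- The product carries the sup norm, so (1, τ(θ)) has norm 1.
  have h1 := abs_dtx_apply_le hI hf ht hb z (w := (1, tau z.1)) (M := 1)
    (by simp [Prod.norm_def, norm_tau])
  have h2 := (hb z.1 z.2).dθ
  have h3 := mul_le_mul_of_nonneg_left h2 (abs_nonneg z.2)
  rw [← abs_mul] at h3
  have h4 := mul_nonneg (abs_nonneg z.2) ((abs_nonneg _).trans h2)
  refine (abs_add_le _ _).trans ?_
  linarith

end Slice

/-! ### Moments -/

theorem mass_eq_integral_cyl (u : ℝ → ℝ → ℝ) : mass u = ∫ p, u p.1 p.2 ∂cyl := by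
  rw [mass, restrict_eq_cyl]

theorem meanAngVel_eq_integral_cyl (u : ℝ → ℝ → ℝ) :
    meanAngVel u = (∫ p, p.2 * u p.1 p.2 ∂cyl) / mass u := by
  rw [meanAngVel, restrict_eq_cyl]

theorem SliceRegular.current_apply {u : ℝ → ℝ → ℝ} {h : ℝ → ℝ} (hu : SliceRegular u h)
    (i : Fin 2) : current u i = ∫ p, u p.1 p.2 * tau p.1 i ∂cyl := by
  have hi : Integrable (fun p : ℝ × ℝ => u p.1 p.2 • tau p.1) cyl := by
    refine integrable_cyl_of_le (k := h) (hu.continuous.smul (continuous_tau.comp continuous_fst))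
      ?_ fun p => ?_
    · simpa using integrable_one_add_abs_pow hu.integrable (n := 0) (by norm_num)
    · rw [norm_smul, norm_tau, mul_one]
      exact hu.val_le _ _
  rw [current, restrict_eq_cyl]
  have := (EuclideanSpace.proj i : Plane →L[ℝ] ℝ).integral_comp_comm hi
  simpa using this.symm

/-- By Fubini the Gaussian factor contributes only the mean of A + B ω. All moments of equilibria
needed below have weights of this product form. -/
theorem integral_equilibrium {kω β : ℝ} (hkω : 0 < kω) (hβ : 0 < β) (κ θs ωb c A B : ℝ)
    (a : ℝ → ℝ) :
    ∫ p, c * (vonMises κ θs p.1 * gauss kω β ωb p.2) * (a p.1 * (A + B * p.2)) ∂cyl =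
      c * (A + B * ωb) * ∫ θ in (-Real.pi)..Real.pi, vonMises κ θs θ * a θ := by
  have h1 : ∫ ω, (A + B * ω) * gauss kω β ωb ω = A + B * ωb := by
    have h := integral_add ((integrable_gauss hkω hβ ωb).const_mul A)
      ((integrable_mul_gauss hkω hβ ωb).const_mul B)
    rw [integral_const_mul, integral_const_mul, integral_gauss hkω hβ,
      integral_mul_gauss hkω hβ, mul_one] at h
    rw [← h]
    exact integral_congr_ae (ae_of_all _ fun ω => by simp only; ring)
  have h2 := integral_prod_mul (μ := volume.restrict (Ioc (-Real.pi) Real.pi)) (ν := volume)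
    (fun θ => vonMises κ θs θ * a θ) (fun ω => (A + B * ω) * gauss kω β ωb ω)
  rw [h1, ← intervalIntegral.integral_of_le (by linarith [Real.pi_pos])] at h2
  rw [mul_assoc, mul_comm (A + B * ωb), ← h2, ← integral_const_mul]
  exact integral_congr_ae (ae_of_all _ fun p => by simp only; ring)

/-- A nonnegative periodic continuous density without mass vanishes. -/
theorem SliceRegular.eq_zero_of_mass_eq_zero {u : ℝ → ℝ → ℝ} {h : ℝ → ℝ} (hu : SliceRegular u h)
    (h0 : ∀ θ ω, 0 ≤ u θ ω) (hm : mass u = 0) (θ ω : ℝ) : u θ ω = 0 := by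
  rw [mass_eq_integral_cyl, integral_eq_zero_iff_of_nonneg (fun p => h0 _ _)
    (hu.dominated.integrable (by norm_num) hu.integrable), ← restrict_eq_cyl] at hm
  -- Passing from almost everywhere to everywhere needs an open set; the closure then restores the
  -- endpoints, and periodicity the other angles.
  have hm' : (fun p : ℝ × ℝ => u p.1 p.2) =ᵐ[(volume : Measure (ℝ × ℝ)).restrict
      (Ioo (-Real.pi) Real.pi ×ˢ univ)] fun _ => 0 :=
    ae_mono (Measure.restrict_mono (Set.prod_mono Ioo_subset_Ioc_self le_rfl) le_rfl) hm
  have h1 := (Measure.eqOn_open_of_ae_eq hm' (isOpen_Ioo.prod isOpen_univ)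
    hu.continuous.continuousOn continuousOn_const).closure hu.continuous continuous_const
  rw [closure_prod_eq, closure_Ioo (by linarith [Real.pi_pos]), closure_univ] at h1
  have hp : Function.Periodic (fun s => u s ω) (2 * Real.pi) := fun s => hu.periodic s ω
  obtain ⟨s, hs, hsu⟩ := hp.exists_mem_Ioc Real.two_pi_pos θ (-Real.pi)
  rw [show -Real.pi + 2 * Real.pi = Real.pi by ring] at hs
  change u θ ω = u s ω at hsu
  rw [hsu]
  exact h1 (x := (s, ω)) ⟨Ioc_subset_Icc_self hs, mem_univ _⟩

theorem tau_eq_of_current {u : ℝ → ℝ → ℝ} (h : current u ≠ 0) {c θ : ℝ} (hc : 0 < c)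
    (hJ : current u = c • tau θ) : tau (meanAngle u) = tau θ := by
  rw [tau_meanAngle u h, hJ, norm_smul, norm_tau, mul_one, Real.norm_of_nonneg hc.le, smul_smul,
    inv_mul_cancel₀ hc.ne', one_smul]

/-- The current has no component orthogonal to the mean direction. -/
theorem integral_mul_sin_meanAngle {u : ℝ → ℝ → ℝ} {h : ℝ → ℝ} (hu : SliceRegular u h)
    (hJ : current u ≠ 0) :
    ∫ p, u p.1 p.2 * Real.sin (p.1 - meanAngle u) ∂cyl = 0 := by
  have hi : ∀ i, Integrable (fun p : ℝ × ℝ => u p.1 p.2 * tau p.1 i) cyl := fun i => by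
    have hc : Continuous fun p : ℝ × ℝ => tau p.1 i :=
      (EuclideanSpace.proj i : Plane →L[ℝ] ℝ).continuous.comp
        (continuous_tau.comp continuous_fst)
    refine ((hu.dominated.bdd_mul hc ⟨1, fun p => ?_⟩).integrable (by norm_num)
      hu.integrable).congr (ae_of_all _ fun p => mul_comm _ _)
    exact (PiLp.norm_apply_le (tau p.1) i).trans_eq (norm_tau _)
  have h1 := integral_sub ((hi 1).mul_const (Real.cos (meanAngle u)))
    ((hi 0).mul_const (Real.sin (meanAngle u)))
  rw [integral_mul_const, integral_mul_const, ← hu.current_apply, ← hu.current_apply] at h1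
  have h2 : current u = ‖current u‖ • tau (meanAngle u) := by
    rw [tau_meanAngle u hJ, smul_smul, mul_inv_cancel₀ (norm_ne_zero_iff.mpr hJ), one_smul]
  have h3 : current u 0 = ‖current u‖ * Real.cos (meanAngle u) := congrArg (fun v : Plane => v 0) h2
  have h4 : current u 1 = ‖current u‖ * Real.sin (meanAngle u) := congrArg (fun v : Plane => v 1) h2
  rw [h3, h4] at h1
  calc _ = _ := integral_congr_ae (ae_of_all _ fun p => by
        change _ = u p.1 p.2 * Real.sin p.1 * Real.cos (meanAngle u) -
          u p.1 p.2 * Real.cos p.1 * Real.sin (meanAngle u)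
        rw [Real.sin_sub]
        ring)
    _ = _ := h1
    _ = 0 := by ring

/-! ### The hydrodynamic limit at a fixed point -/

section Limit

variable {kθ kω α β : ℝ} {I : Set ℝ} {f : ℝ → PhaseFun} {f₀ : PhaseFun} {t : ℝ} {x : Plane}

theorem ConvergesStrongly.nonneg (hf : IsScaledSolution kθ kω α β I f)
    (hconv : ConvergesStrongly I f f₀) (ht : t ∈ I) (x : Plane) (θ ω : ℝ) : 0 ≤ f₀ t x θ ω :=
  ge_of_tendsto (hconv.val t ht x θ ω) (eventually_nhdsWithin_of_forall fun ε hε =>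
    (hf.density ε hε).nonneg t ht x θ ω)

theorem ConvergesStrongly.periodic (hf : IsScaledSolution kθ kω α β I f)
    (hconv : ConvergesStrongly I f f₀) (ht : t ∈ I) (x : Plane) (θ ω : ℝ) :
    f₀ t x (θ + 2 * Real.pi) ω = f₀ t x θ ω := by
  refine tendsto_nhds_unique (hconv.val t ht x (θ + 2 * Real.pi) ω)
    ((hconv.val t ht x θ ω).congr' (eventually_nhdsWithin_of_forall fun ε hε => ?_))
  exact ((hf.density ε hε).periodic t ht x θ ω).symm

/-- Bounds survive pointwise limits, so the function h of the family dominates f₀ on the same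
neighbourhood. -/
theorem ConvergesStrongly.bound (hconv : ConvergesStrongly I f f₀) {t₀ : ℝ} (ht₀ : t₀ ∈ I)
    (x₀ : Plane) : ∃ V ∈ 𝓝 (t₀, x₀), ∃ h : ℝ → ℝ, (Integrable fun ω => (1 + ω ^ 2) * h ω) ∧
      (∀ᶠ ε in 𝓝[>] (0 : ℝ), ∀ t x, (t, x) ∈ V → t ∈ I → ∀ θ ω, DerivBound (f ε) h t x θ ω) ∧
      ∀ t x, (t, x) ∈ V → t ∈ I → ∀ θ ω, DerivBound f₀ h t x θ ω := by
  obtain ⟨V, hV, h, hh, hb⟩ := hconv.dominated t₀ ht₀ x₀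
  refine ⟨V, hV, h, hh, hb, fun t x hx ht θ ω => ?_⟩
  have hb' : ∀ᶠ ε in 𝓝[>] (0 : ℝ), DerivBound (f ε) h t x θ ω :=
    hb.mono fun ε hε => hε t x hx ht θ ω
  exact ⟨le_of_tendsto (hconv.val t ht x θ ω).abs (hb'.mono fun _ h => h.val),
    le_of_tendsto (hconv.dt t ht x θ ω).abs (hb'.mono fun _ h => h.dt),
    le_of_tendsto (hconv.dx t ht x θ ω).norm (hb'.mono fun _ h => h.dx),
    le_of_tendsto (hconv.dθ t ht x θ ω).abs (hb'.mono fun _ h => h.dθ),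
    le_of_tendsto (hconv.dω t ht x θ ω).abs (hb'.mono fun _ h => h.dω),
    le_of_tendsto (hconv.dθθ t ht x θ ω).abs (hb'.mono fun _ h => h.dθθ),
    le_of_tendsto (hconv.dωω t ht x θ ω).abs (hb'.mono fun _ h => h.dωω)⟩

theorem IsKineticDensity.contDiffOn_two {f : PhaseFun} (hf : IsKineticDensity I f) :
    ContDiffOn ℝ 2 (fun p : ℝ × Plane × ℝ × ℝ => f p.1 p.2.1 p.2.2.1 p.2.2.2) (I ×ˢ univ) :=
  hf.smooth.of_le (WithTop.coe_le_coe.mpr (le_top : (2 : ℕ∞) ≤ ⊤))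

/-- A common dominating function at a point for the limit and for the family. -/
theorem exists_sliceRegular (hf : IsScaledSolution kθ kω α β I f)
    (hconv : ConvergesStrongly I f f₀) (ht : t ∈ I) (x : Plane) :
    ∃ h : ℝ → ℝ, SliceRegular (f₀ t x) h ∧ (∀ θ ω, DerivBound f₀ h t x θ ω) ∧
      ∀ᶠ ε in 𝓝[>] (0 : ℝ), 0 < ε ∧ SliceRegular (f ε t x) h ∧
        ∀ θ ω, DerivBound (f ε) h t x θ ω := by
  obtain ⟨V, hV, h, hh, hb, hb₀⟩ := hconv.bound ht x
  have hx := mem_of_mem_nhds hV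
  refine ⟨h, sliceRegular_of_bound hconv.contDiff ht (hconv.periodic hf ht x) hh
    (hb₀ t x hx ht), hb₀ t x hx ht, ?_⟩
  filter_upwards [hb, self_mem_nhdsWithin] with ε hε hpos
  exact ⟨hpos, sliceRegular_of_bound (hf.density ε hpos).contDiffOn_two ht
    ((hf.density ε hpos).periodic t ht x) hh (hε t x hx ht), hε t x hx ht⟩

theorem tendsto_transport (hI : IsOpen I) (hf : IsScaledSolution kθ kω α β I f)
    (hconv : ConvergesStrongly I f f₀) (ht : t ∈ I) (z : ℝ × ℝ) :
    Tendsto (fun ε => transport (f ε) t x z) (𝓝[>] 0) (𝓝 (transport f₀ t x z)) := by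
  change Tendsto _ _ (𝓝 (dtx f₀ (t, x) z (1, tau z.1) + z.2 * deriv (fun s => f₀ t x s z.2) z.1))
  rw [dtx_apply hI (hconv.contDiff.of_le (by norm_num)) ht]
  refine Tendsto.congr' (eventually_nhdsWithin_of_forall fun ε hε => ?_)
    ((((hconv.dt t ht x z.1 z.2).const_mul 1).add
      (tendsto_const_nhds.inner (hconv.dx t ht x z.1 z.2))).add
      ((hconv.dθ t ht x z.1 z.2).const_mul z.2))
  change _ = dtx (f ε) (t, x) z (1, tau z.1) + z.2 * deriv (fun s => f ε t x s z.2) z.1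
  rw [dtx_apply hI ((hf.density ε hε).contDiffOn_two.of_le (by norm_num)) ht]

theorem tendsto_moment (hf : IsScaledSolution kθ kω α β I f)
    (hconv : ConvergesStrongly I f f₀) (ht : t ∈ I) (x : Plane) (a b : ℝ) :
    Tendsto (fun ε => ∫ p, (a + b * p.2) * f ε t x p.1 p.2 ∂cyl) (𝓝[>] 0)
      (𝓝 (∫ p, (a + b * p.2) * f₀ t x p.1 p.2 ∂cyl)) := by
  obtain ⟨h, hu₀, -, hev⟩ := exists_sliceRegular hf hconv ht x
  refine tendsto_integral_filter_of_dominated_convergence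
    (fun p => (|a| + |b|) * ((1 + |p.2|) ^ 1 * h p.2)) ?_ ?_ ?_ ?_
  · filter_upwards [hev] with ε hε
    exact (hε.2.1.dominated.affine_mul a b).continuous.aestronglyMeasurable
  · filter_upwards [hev] with ε hε
    refine ae_of_all _ fun p => ?_
    rw [norm_mul]
    have h1 := abs_affine_le a b p.2
    calc ‖a + b * p.2‖ * ‖f ε t x p.1 p.2‖ ≤ (|a| + |b|) * (1 + |p.2|) * h p.2 :=
          mul_le_mul h1 (hε.2.1.val_le _ _) (abs_nonneg _) (by positivity)
      _ = _ := by ring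
  · exact integrable_cyl_snd
      ((integrable_one_add_abs_pow hu₀.integrable (by norm_num)).const_mul _)
  · exact ae_of_all _ fun p => (hconv.val t ht x p.1 p.2).const_mul _

theorem tendsto_meanAngVel (hf : IsScaledSolution kθ kω α β I f)
    (hconv : ConvergesStrongly I f f₀) (ht : t ∈ I) (hm : mass (f₀ t x) ≠ 0) :
    Tendsto (fun ε => meanAngVel (f ε t x)) (𝓝[>] 0) (𝓝 (meanAngVel (f₀ t x))) := by
  simp only [meanAngVel_eq_integral_cyl]
  have h1 := tendsto_moment hf hconv ht x 0 1
  have h2 := tendsto_moment hf hconv ht x 1 0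
  simp only [zero_add, one_mul, zero_mul, add_zero, ← mass_eq_integral_cyl] at h1 h2
  exact h1.div h2 hm

/-- A sequence `ε → 0` along which the mean angles converge. -/
theorem exists_seq_tendsto_meanAngle (f : ℝ → PhaseFun) (t : ℝ) (x : Plane) :
    ∃ (e : ℕ → ℝ) (θs : ℝ), Tendsto e atTop (𝓝[>] 0) ∧
      Tendsto (fun n => meanAngle (f (e n) t x)) atTop (𝓝 θs) := by
  have h0 : Tendsto (fun n : ℕ => 1 / ((n : ℝ) + 1)) atTop (𝓝[>] 0) :=
    tendsto_nhdsWithin_iff.mpr ⟨tendsto_one_div_add_atTop_nhds_zero_nat,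
      Eventually.of_forall fun n => by simp only [mem_Ioi]; positivity⟩
  -- Compactness replaces continuity of the angle, which fails at the branch cut of the argument and
  -- where the limit current is zero.
  obtain ⟨θs, -, φ, hφ, hlim⟩ := (isCompact_Icc (a := -Real.pi) (b := Real.pi)).tendsto_subseq
    (x := fun n : ℕ => meanAngle (f (1 / ((n : ℝ) + 1)) t x))
    fun n => Ioc_subset_Icc_self (meanAngle_mem _)
  exact ⟨_, θs, h0.comp hφ.tendsto_atTop, hlim⟩

/-- The kinetic equation reads L = ε (transport − remainder), whose right side tends to zero.
Nonzero limit mass is what makes ω̄ converge; the angle converges only along the chosen sequence. -/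
theorem linCollision_limit_eq_zero (hI : IsOpen I) (hf : IsScaledSolution kθ kω α β I f)
    (hconv : ConvergesStrongly I f f₀) (ht : t ∈ I) (hm : mass (f₀ t x) ≠ 0)
    {e : ℕ → ℝ} {θs : ℝ} (he : Tendsto e atTop (𝓝[>] 0))
    (hθ : Tendsto (fun n => meanAngle (f (e n) t x)) atTop (𝓝 θs)) (θ ω : ℝ) :
    linCollision kθ kω α β θs (meanAngVel (f₀ t x)) (f₀ t x) θ ω = 0 := by
  obtain ⟨h, hu₀, -, hev⟩ := exists_sliceRegular hf hconv ht x
  obtain ⟨h', -, hr⟩ := hf.remainder t ht x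
  have hω := (tendsto_meanAngVel hf hconv ht hm).comp he
  have h1 : Tendsto (fun n => linCollision kθ kω α β (meanAngle (f (e n) t x))
      (meanAngVel (f (e n) t x)) (f (e n) t x) θ ω) atTop
      (𝓝 (linCollision kθ kω α β θs (meanAngVel (f₀ t x)) (f₀ t x) θ ω)) := by
    have hs := (hθ.sub_const θ)
    have hsin := (Real.continuous_sin.tendsto _).comp hs
    have hcos := (Real.continuous_cos.tendsto _).comp hs
    have hv := (hconv.val t ht x θ ω).comp he
    have hvθ := (hconv.dθ t ht x θ ω).comp he
    have hvω := (hconv.dω t ht x θ ω).comp he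
    exact (((((hcos.neg.mul hv).add (hsin.mul hvθ)).const_mul (-kθ)).sub
      ((hv.neg.add ((hω.sub_const ω).mul hvω)).const_mul kω)).add
      (((hconv.dθθ t ht x θ ω).comp he).const_mul (α ^ 2))).add
      (((hconv.dωω t ht x θ ω).comp he).const_mul (β ^ 2))
  have he0 : Tendsto e atTop (𝓝 0) := he.mono_right nhdsWithin_le_nhds
  -- Transport converges and the remainder tends to zero, so the prefactor ε kills both.
  have h2 : Tendsto (fun n => e n * (transport (f (e n)) t x (θ, ω) -
      residual kθ kω α β (e n) (f (e n)) t x θ ω)) atTop (𝓝 0) := by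
    have hres : Tendsto (fun n => residual kθ kω α β (e n) (f (e n)) t x θ ω) atTop (𝓝 0) := by
      refine squeeze_zero_norm' ((he.eventually hr).mono fun n hn => hn θ ω) ?_
      simpa using he0.mul_const (h' ω)
    simpa using he0.mul (((tendsto_transport hI hf hconv ht (θ, ω)).comp he).sub hres)
  refine tendsto_nhds_unique h1 (h2.congr' ?_)
  filter_upwards [he.eventually hev] with n hn
  rw [residual_eq hI (hf.density _ hn.1).contDiffOn_two ht hn.2.1]
  have := hn.1.ne'
  field_simp
  ring

/-- The limit is a local equilibrium, with mean angle the limit of mean angles. -/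
theorem limit_eq_equilibrium (hkω : 0 < kω) (hα : 0 < α) (hβ : 0 < β)
    (hI : IsOpen I) (hf : IsScaledSolution kθ kω α β I f) (hconv : ConvergesStrongly I f f₀)
    (ht : t ∈ I) {e : ℕ → ℝ} {θs : ℝ} (he : Tendsto e atTop (𝓝[>] 0))
    (hθ : Tendsto (fun n => meanAngle (f (e n) t x)) atTop (𝓝 θs)) (θ ω : ℝ) :
    f₀ t x θ ω = mass (f₀ t x) *
      (vonMises (kθ / α ^ 2) θs θ * gauss kω β (meanAngVel (f₀ t x)) ω) := by
  obtain ⟨h, hu₀, -, -⟩ := exists_sliceRegular hf hconv ht x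
  -- In vacuum the mean velocities need not converge, but both sides are zero.
  by_cases hm : mass (f₀ t x) = 0
  · rw [hm, zero_mul]
    exact hu₀.eq_zero_of_mass_eq_zero (hconv.nonneg hf ht x) hm θ ω
  obtain ⟨c, hc⟩ := stationary_eq hα hkω hβ hu₀
    (linCollision_limit_eq_zero hI hf hconv ht hm he hθ)
  have hmc : mass (f₀ t x) = c := by
    have h1 := integral_equilibrium hkω hβ (kθ / α ^ 2) θs (meanAngVel (f₀ t x)) c 1 0
      (fun _ => 1)
    simp only [zero_mul, add_zero, mul_one, integral_vonMises] at h1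
    rw [mass_eq_integral_cyl]
    simp only [hc]
    exact h1
  rw [hmc]
  exact hc θ ω

end Limit

/-! ### Testing against collisional invariants -/

section Limit

variable {kθ kω α β : ℝ} {I : Set ℝ} {f : ℝ → PhaseFun} {f₀ : PhaseFun} {t : ℝ} {x : Plane}

/-- Testing the kinetic equation with functions in the kernel of the adjoint collision operator
gives, in the limit, a relation for the free transport of the limit. -/
theorem integral_transport_mul_eq_zero (hI : IsOpen I) (hf : IsScaledSolution kθ kω α β I f)
    (hconv : ConvergesStrongly I f f₀) (ht : t ∈ I) {e : ℕ → ℝ} (he : Tendsto e atTop (𝓝[>] 0))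
    {ψ : ℕ → ℝ → ℝ} {ψ₀ : ℝ → ℝ} (hψc : ∀ n, Continuous (ψ n)) {M : ℝ}
    (hM : ∀ n θ, |ψ n θ| ≤ M) (hψ : ∀ θ, Tendsto (fun n => ψ n θ) atTop (𝓝 (ψ₀ θ))) (a b : ℝ)
    (hzero : ∀ᶠ n in atTop, ∫ p, linCollision kθ kω α β (meanAngle (f (e n) t x))
      (meanAngVel (f (e n) t x)) (f (e n) t x) p.1 p.2 * (ψ n p.1 * (a + b * p.2)) ∂cyl = 0) :
    ∫ p, transport f₀ t x p * (ψ₀ p.1 * (a + b * p.2)) ∂cyl = 0 := by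
  obtain ⟨h, hu₀, -, hev⟩ := exists_sliceRegular hf hconv ht x
  obtain ⟨h', hh', hr⟩ := hf.remainder t ht x
  have hM0 : 0 ≤ M := (abs_nonneg _).trans (hM 0 0)
  have hw : ∀ n (p : ℝ × ℝ), |ψ n p.1 * (a + b * p.2)| ≤ M * ((|a| + |b|) * (1 + |p.2|)) :=
    fun n p => by
      rw [abs_mul]
      exact mul_le_mul (hM _ _) (abs_affine_le _ _ _) (abs_nonneg _) hM0
  have hwc : ∀ n, Continuous fun p : ℝ × ℝ => ψ n p.1 * (a + b * p.2) := fun n =>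
    ((hψc n).comp continuous_fst).mul (by fun_prop)
  have h1 : Tendsto (fun n => ∫ p, transport (f (e n)) t x p * (ψ n p.1 * (a + b * p.2)) ∂cyl)
      atTop (𝓝 (∫ p, transport f₀ t x p * (ψ₀ p.1 * (a + b * p.2)) ∂cyl)) := by
    refine tendsto_integral_filter_of_dominated_convergence
      (fun p => 2 * M * (|a| + |b|) * ((1 + |p.2|) ^ 2 * h p.2)) ?_ ?_ ?_ ?_
    · filter_upwards [he.eventually hev] with n hn
      exact ((continuous_transport hI (hf.density _ hn.1).contDiffOn_two ht hn.2.1).mul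
        (hwc n)).aestronglyMeasurable
    · filter_upwards [he.eventually hev] with n hn
      refine ae_of_all _ fun p => ?_
      have h0 := hu₀.bound_nonneg p.2
      rw [norm_mul]
      calc ‖transport (f (e n)) t x p‖ * ‖ψ n p.1 * (a + b * p.2)‖
          ≤ 2 * ((1 + |p.2|) * h p.2) * (M * ((|a| + |b|) * (1 + |p.2|))) :=
            mul_le_mul (abs_transport_le hI (hf.density _ hn.1).contDiffOn_two ht hn.2.2 p)
              (hw n p) (abs_nonneg _) (by positivity)
        _ = _ := by ring
    · exact integrable_cyl_snd ((integrable_one_add_abs_pow hu₀.integrable le_rfl).const_mul _)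
    · exact ae_of_all _ fun p => ((tendsto_transport hI hf hconv ht p).comp he).mul
        ((hψ p.1).mul_const _)
  have he0 : Tendsto e atTop (𝓝 0) := he.mono_right nhdsWithin_le_nhds
  -- For large n the collision integral is exactly zero, so 1/ε multiplies nothing and only the O(ε)
  -- remainder is left.
  have h2 : Tendsto (fun n => ∫ p, transport (f (e n)) t x p * (ψ n p.1 * (a + b * p.2)) ∂cyl)
      atTop (𝓝 0) := by
    have hk := integrable_cyl_snd hh'
    refine squeeze_zero_norm' (a := fun n => e n * (M * (|a| + |b|) *
      ∫ p : ℝ × ℝ, (1 + |p.2|) * h' p.2 ∂cyl)) ?_ (by simpa using he0.mul_const _)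
    filter_upwards [he.eventually hev, he.eventually hr, hzero] with n hn hrn hz
    have hT := continuous_transport hI (hf.density _ hn.1).contDiffOn_two ht hn.2.1
    have i1 : Integrable (fun p => transport (f (e n)) t x p * (ψ n p.1 * (a + b * p.2))) cyl := by
      refine integrable_cyl_of_le (hT.mul (hwc n)) (k := fun ω => 2 * M * (|a| + |b|) *
        ((1 + |ω|) ^ 2 * h ω)) ((integrable_one_add_abs_pow hu₀.integrable le_rfl).const_mul _)
        fun p => ?_
      have h0 := hu₀.bound_nonneg p.2
      rw [norm_mul]
      calc ‖transport (f (e n)) t x p‖ * ‖ψ n p.1 * (a + b * p.2)‖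
          ≤ 2 * ((1 + |p.2|) * h p.2) * (M * ((|a| + |b|) * (1 + |p.2|))) :=
            mul_le_mul (abs_transport_le hI (hf.density _ hn.1).contDiffOn_two ht hn.2.2 p)
              (hw n p) (abs_nonneg _) (by positivity)
        _ = _ := by ring
    have i2 : Integrable (fun p : ℝ × ℝ => linCollision kθ kω α β (meanAngle (f (e n) t x))
        (meanAngVel (f (e n) t x)) (f (e n) t x) p.1 p.2 * (ψ n p.1 * (a + b * p.2))) cyl := by
      have hd := ((hn.2.1.dominated_linCollision kθ kω α β (meanAngle (f (e n) t x))
        (meanAngVel (f (e n) t x))).bdd_mul (w := fun p => ψ n p.1)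
        ((hψc n).comp continuous_fst) ⟨M, fun p => hM n p.1⟩).affine_mul a b
      refine (hd.integrable le_rfl hu₀.integrable).congr (ae_of_all _ fun p => ?_)
      simp only
      ring
    have h3 : ∫ p, transport (f (e n)) t x p * (ψ n p.1 * (a + b * p.2)) ∂cyl =
        ∫ p, residual kθ kω α β (e n) (f (e n)) t x p.1 p.2 * (ψ n p.1 * (a + b * p.2)) ∂cyl := by
      have h4 := integral_sub i1 (i2.const_mul (1 / e n))
      rw [integral_const_mul, hz, mul_zero, sub_zero] at h4
      rw [← h4]
      refine integral_congr_ae (ae_of_all _ fun p => ?_)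
      simp only
      rw [residual_eq hI (hf.density _ hn.1).contDiffOn_two ht hn.2.1]
      ring
    rw [h3, ← integral_const_mul, ← integral_const_mul]
    refine norm_integral_le_of_norm_le ((hk.const_mul _).const_mul _) (ae_of_all _ fun p => ?_)
    rw [norm_mul]
    calc ‖residual kθ kω α β (e n) (f (e n)) t x p.1 p.2‖ * ‖ψ n p.1 * (a + b * p.2)‖
        ≤ e n * h' p.2 * (M * ((|a| + |b|) * (1 + |p.2|))) :=
          mul_le_mul (hrn p.1 p.2) (hw n p) (abs_nonneg _) ((abs_nonneg _).trans (hrn p.1 p.2))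
      _ = _ := by ring
  exact tendsto_nhds_unique h1 h2

theorem mass_ne_zero_of_current_ne_zero {u : ℝ → ℝ → ℝ} {h : ℝ → ℝ} (hu : SliceRegular u h)
    (h0 : ∀ θ ω, 0 ≤ u θ ω) (hJ : current u ≠ 0) : mass u ≠ 0 := by
  intro hm
  apply hJ
  simp [current, hu.eq_zero_of_mass_eq_zero h0 hm]

/-- Conservation of mass and of angular momentum by collisions. -/
theorem SliceRegular.integral_linCollision_mul_affine {u : ℝ → ℝ → ℝ} {h : ℝ → ℝ}
    (hu : SliceRegular u h) (hm : mass u ≠ 0) (θs a b : ℝ) :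
    ∫ p, linCollision kθ kω α β θs (meanAngVel u) u p.1 p.2 * (1 * (a + b * p.2)) ∂cyl = 0 := by
  have h1 := hu.integral_linCollision_mul kθ kω α β θs (meanAngVel u) a b (ψ := fun _ => 1)
    (ψ' := fun _ => 0) (ψ'' := fun _ => 0) (fun _ => hasDerivAt_const _ _)
    (fun _ => hasDerivAt_const _ _) continuous_const (fun _ => rfl) (fun _ => rfl) (fun _ => rfl)
  -- That ∫ (ω̄ − ω) u vanishes is the definition of ω̄, provided the mass is nonzero.
  have h2 := integral_sub (((hu.dominated.const_mul (meanAngVel u)).integrable (by norm_num)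
    hu.integrable)) ((hu.dominated.affine_mul 0 1).integrable (by norm_num) hu.integrable)
  simp only [zero_add, one_mul] at h2
  rw [integral_const_mul, ← mass_eq_integral_cyl, meanAngVel_eq_integral_cyl, div_mul_cancel₀ _ hm,
    sub_self] at h2
  rw [h1]
  calc _ = ∫ p, kω * b * ((∫ p, p.2 * u p.1 p.2 ∂cyl) / mass u * u p.1 p.2 -
        p.2 * u p.1 p.2) ∂cyl := integral_congr_ae (ae_of_all _ fun p => by
          simp only [← meanAngVel_eq_integral_cyl]
          ring)
    _ = 0 := by rw [integral_const_mul, h2, mul_zero]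

theorem periodic_comp_sub {g : ℝ → ℝ} {c : ℝ} (hg : Function.Periodic g c) (a : ℝ) :
    Function.Periodic (fun θ => g (θ - a)) c := fun θ => by
  simp only [show θ + c - a = θ - a + c by ring, hg (θ - a)]

/-- The generalized collisional invariant is orthogonal to collisions. -/
theorem SliceRegular.integral_linCollision_mul_gci (hkθ : 0 < kθ) (hα : 0 < α)
    {u : ℝ → ℝ → ℝ} {h : ℝ → ℝ} (hu : SliceRegular u h) (hJ : current u ≠ 0) (ωb : ℝ) :
    ∫ p, linCollision kθ kω α β (meanAngle u) ωb u p.1 p.2 *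
      (gci (kθ / α ^ 2) (p.1 - meanAngle u) * (1 + 0 * p.2)) ∂cyl = 0 := by
  have hκ : 0 < kθ / α ^ 2 := by positivity
  have hp2 : Function.Periodic (gciDeriv2 (kθ / α ^ 2)) (2 * Real.pi) := fun s => by
    simp only [gciDeriv2, Real.sin_add_two_pi, periodic_gciDeriv _ s]
  have h1 := hu.integral_linCollision_mul kθ kω α β (meanAngle u) ωb 1 0
    (fun θ => (hasDerivAt_gci (kθ / α ^ 2) (θ - meanAngle u)).comp_sub_const θ (meanAngle u))
    (fun θ => (hasDerivAt_gciDeriv hκ (θ - meanAngle u)).comp_sub_const θ (meanAngle u))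
    ((continuous_gciDeriv2 _).comp (continuous_id.sub continuous_const))
    (periodic_comp_sub (periodic_gci _) _) (periodic_comp_sub (periodic_gciDeriv _) _)
    (periodic_comp_sub hp2 _)
  rw [h1]
  -- The equation for g'' cancels the drift term and leaves −α² sin(θ − θ̄), which tests the
  -- component of the current orthogonal to its own direction.
  calc _ = ∫ p, -α ^ 2 * (u p.1 p.2 * Real.sin (p.1 - meanAngle u)) ∂cyl :=
        integral_congr_ae (ae_of_all _ fun p => by
          have h3 : Real.sin (meanAngle u - p.1) = -Real.sin (p.1 - meanAngle u) := by
            rw [← Real.sin_neg, neg_sub]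
          simp only [gciDeriv2, h3]
          field_simp
          ring)
    _ = 0 := by rw [integral_const_mul, integral_mul_sin_meanAngle hu hJ, mul_zero]

/-- The functions 1 and ω are invariants whatever the mean angle, so the limit angle of the sequence
plays no role. -/
theorem integral_transport_mul_affine (hI : IsOpen I) (hf : IsScaledSolution kθ kω α β I f)
    (hconv : ConvergesStrongly I f f₀) (ht : t ∈ I) (x : Plane) (a b : ℝ) :
    ∫ p, transport f₀ t x p * (a + b * p.2) ∂cyl = 0 := by
  obtain ⟨h, -, -, hev⟩ := exists_sliceRegular hf hconv ht x
  obtain ⟨e, θs, he, -⟩ := exists_seq_tendsto_meanAngle f t x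
  have h1 := integral_transport_mul_eq_zero hI hf hconv ht (x := x) he (ψ := fun _ _ => 1)
    (ψ₀ := fun _ => 1) (fun _ => continuous_const) (M := 1) (by simp)
    (fun _ => tendsto_const_nhds) a b ?_
  · simpa using h1
  · filter_upwards [he.eventually hev] with n hn
    have hd := hf.density _ hn.1
    exact hn.2.1.integral_linCollision_mul_affine (mass_ne_zero_of_current_ne_zero hn.2.1
      (hd.nonneg t ht x) (hd.current_ne_zero t ht x)) _ a b

/-- The invariant rotates with the mean angle of f^ε; continuity and boundedness of g carry it to
the invariant centred at θs. -/
theorem integral_transport_mul_gci (hkθ : 0 < kθ) (hα : 0 < α) (hI : IsOpen I)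
    (hf : IsScaledSolution kθ kω α β I f)
    (hconv : ConvergesStrongly I f f₀) (ht : t ∈ I) {e : ℕ → ℝ} {θs : ℝ}
    (he : Tendsto e atTop (𝓝[>] 0))
    (hθ : Tendsto (fun n => meanAngle (f (e n) t x)) atTop (𝓝 θs)) :
    ∫ p, transport f₀ t x p * gci (kθ / α ^ 2) (p.1 - θs) ∂cyl = 0 := by
  obtain ⟨h, -, -, hev⟩ := exists_sliceRegular hf hconv ht x
  have hg := continuous_gci (kθ / α ^ 2)
  obtain ⟨M, hM⟩ := exists_abs_le_of_periodic (periodic_gci (kθ / α ^ 2)) Real.two_pi_pos.ne' hg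
  have h1 := integral_transport_mul_eq_zero hI hf hconv ht (x := x) he
    (ψ := fun n θ => gci (kθ / α ^ 2) (θ - meanAngle (f (e n) t x)))
    (ψ₀ := fun θ => gci (kθ / α ^ 2) (θ - θs)) (fun _ => by fun_prop) (fun n θ => hM _)
    (fun θ => (hg.tendsto _).comp (hθ.const_sub θ)) 1 0 ?_
  · simpa using h1
  · filter_upwards [he.eventually hev] with n hn
    exact hn.2.1.integral_linCollision_mul_gci hkθ hα
      ((hf.density _ hn.1).current_ne_zero t ht x) _

theorem inner_plane (v w : Plane) : inner ℝ v w = v 0 * w 0 + v 1 * w 1 := by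
  simp [PiLp.inner_apply, Fin.sum_univ_two, mul_comm]

theorem inner_tau_tau (a θ : ℝ) : inner ℝ (tau a) (tau θ) = Real.cos (θ - a) := by
  rw [inner_plane, Real.cos_sub]
  change Real.cos a * Real.cos θ + Real.sin a * Real.sin θ = _
  ring

/-- The angle enters only through its unit vector. This allows angles to be exchanged modulo 2π, and
the density to be differentiated in (t, x) although the angle itself may jump. -/
theorem vonMises_eq_of_tau (κ a θ : ℝ) :
    vonMises κ a θ = (2 * halfNorm κ)⁻¹ * Real.exp (κ * inner ℝ (tau a) (tau θ)) := by
  rw [vonMises_eq, inner_tau_tau]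

theorem integral_vonMises_mul_tau (κ a : ℝ) (i : Fin 2) :
    ∫ θ in (-Real.pi)..Real.pi, vonMises κ a θ * tau θ i = c1 κ * tau a i := by
  fin_cases i
  · exact integral_vonMises_mul_cos_sub κ a
  · exact integral_vonMises_mul_sin_sub κ a

theorem mass_nonneg_limit (hf : IsScaledSolution kθ kω α β I f)
    (hconv : ConvergesStrongly I f f₀) (ht : t ∈ I) (x : Plane) : 0 ≤ mass (f₀ t x) := by
  rw [mass_eq_integral_cyl]
  exact integral_nonneg fun p => hconv.nonneg hf ht x _ _

/-- Where there is mass, the direction of the limit is the limit of the mean directions. -/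
theorem tau_meanAngle_limit (hkθ : 0 < kθ) (hkω : 0 < kω) (hα : 0 < α) (hβ : 0 < β)
    (hI : IsOpen I) (hf : IsScaledSolution kθ kω α β I f) (hconv : ConvergesStrongly I f f₀)
    (ht : t ∈ I) {e : ℕ → ℝ} {θs : ℝ} (he : Tendsto e atTop (𝓝[>] 0))
    (hθ : Tendsto (fun n => meanAngle (f (e n) t x)) atTop (𝓝 θs)) (hm : mass (f₀ t x) ≠ 0) :
    tau (meanAngle (f₀ t x)) = tau θs := by
  obtain ⟨h, hu₀, -, -⟩ := exists_sliceRegular hf hconv ht x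
  have hκ : 0 < kθ / α ^ 2 := by positivity
  have hc : 0 < mass (f₀ t x) * c1 (kθ / α ^ 2) :=
    mul_pos (lt_of_le_of_ne (mass_nonneg_limit hf hconv ht x) hm.symm) (c1_pos hκ)
  have heq := limit_eq_equilibrium hkω hα hβ hI hf hconv ht he hθ
  -- The first moment of the equilibrium; since its coefficient is positive, it determines the
  -- direction.
  have hJ : current (f₀ t x) = (mass (f₀ t x) * c1 (kθ / α ^ 2)) • tau θs := by
    ext i
    have h1 := integral_equilibrium hkω hβ (kθ / α ^ 2) θs (meanAngVel (f₀ t x))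
      (mass (f₀ t x)) 1 0 (fun θ => tau θ i)
    simp only [← heq, zero_mul, add_zero, mul_one, integral_vonMises_mul_tau] at h1
    rw [hu₀.current_apply, h1, PiLp.smul_apply, smul_eq_mul, mul_assoc]
  refine tau_eq_of_current (fun h0 => ?_) hc hJ
  have h2 := congrArg norm (hJ.symm.trans h0)
  rw [norm_smul, norm_tau, mul_one, norm_zero, norm_eq_zero] at h2
  exact hc.ne' h2

/-- The angle θs may differ from `meanAngle` by a multiple of 2π, and in vacuum arbitrarily; neither
affects the product. -/
theorem limit_eq (hkθ : 0 < kθ) (hkω : 0 < kω) (hα : 0 < α) (hβ : 0 < β)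
    (hI : IsOpen I) (hf : IsScaledSolution kθ kω α β I f) (hconv : ConvergesStrongly I f f₀)
    (ht : t ∈ I) (x : Plane) (θ ω : ℝ) :
    f₀ t x θ ω = mass (f₀ t x) * (vonMises (kθ / α ^ 2) (meanAngle (f₀ t x)) θ *
      gauss kω β (meanAngVel (f₀ t x)) ω) := by
  obtain ⟨e, θs, he, hθ⟩ := exists_seq_tendsto_meanAngle f t x
  have heq := limit_eq_equilibrium hkω hα hβ hI hf hconv ht he hθ θ ω
  by_cases hm : mass (f₀ t x) = 0
  · rw [heq, hm, zero_mul, zero_mul]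
  · rw [vonMises_eq_of_tau, tau_meanAngle_limit hkθ hkω hα hβ hI hf hconv ht he hθ hm,
      ← vonMises_eq_of_tau]
    exact heq

end Limit

/-! ### Moments of the limit as functions of `(t, x)` -/

/-- The moment `∫ w f dθ dω` as a function of `(t, x)`. -/
def moment (f : PhaseFun) (w : ℝ × ℝ → ℝ) (p : ℝ × Plane) : ℝ :=
  ∫ z, w z * f p.1 p.2 z.1 z.2 ∂cyl

section Moments

variable {kθ kω α β : ℝ} {I : Set ℝ} {f : ℝ → PhaseFun} {f₀ : PhaseFun} {t : ℝ} {x : Plane}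
  {w : ℝ × ℝ → ℝ} {K : ℝ} (hI : IsOpen I) (hf : IsScaledSolution kθ kω α β I f)
  (hconv : ConvergesStrongly I f f₀)
include hI hf hconv

/-- Differentiation under the integral: the local domination of the derivatives is uniform near (t,
x), and a weight of linear growth is absorbed by the moments of h. The same bound gives continuity
of the derivative. -/
theorem hasFDerivAt_moment (hw : Continuous w) (hK : ∀ z : ℝ × ℝ, |w z| ≤ K * (1 + |z.2|))
    (ht : t ∈ I) (x : Plane) :
    Integrable (fun z => w z • dtx f₀ (t, x) z) cyl ∧
    HasFDerivAt (moment f₀ w) (∫ z, w z • dtx f₀ (t, x) z ∂cyl) (t, x) ∧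
    ContinuousAt (fun p => ∫ z, w z • dtx f₀ p z ∂cyl) (t, x) := by
  obtain ⟨V, hV, h, hh, -, hb⟩ := hconv.bound ht x
  have hC2 := hconv.contDiff
  have hC1 := hC2.of_le (m := 1) (by norm_num)
  have hU : V ∩ (I ×ˢ univ) ∈ 𝓝 (t, x) :=
    inter_mem hV ((isOpen_timeSpace hI).mem_nhds ⟨ht, mem_univ _⟩)
  have hslice : ∀ p ∈ V ∩ (I ×ˢ univ), SliceRegular (f₀ p.1 p.2) h := fun p hp =>
    sliceRegular_of_bound hC2 hp.2.1 (hconv.periodic hf hp.2.1 p.2) hh (hb p.1 p.2 hp.1 hp.2.1)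
  have hcont : ∀ p ∈ V ∩ (I ×ˢ univ), Continuous fun z => w z • dtx f₀ p z := fun p hp =>
    hw.smul (continuous_dtx hI hC1 hp.2.1 p.2)
  have hle : ∀ p ∈ V ∩ (I ×ˢ univ), ∀ z : ℝ × ℝ,
      ‖w z • dtx f₀ p z‖ ≤ 2 * K * ((1 + |z.2|) ^ 1 * h z.2) := fun p hp z => by
    rw [norm_smul]
    calc ‖w z‖ * ‖dtx f₀ p z‖ ≤ K * (1 + |z.2|) * (2 * h z.2) :=
          mul_le_mul (hK z) (norm_dtx_le_of_bound hI hC2 hp.2.1 (hb p.1 p.2 hp.1 hp.2.1) z)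
            (norm_nonneg _) ((abs_nonneg _).trans (hK z))
      _ = _ := by ring
  have hk : Integrable fun ω => 2 * K * ((1 + |ω|) ^ 1 * h ω) :=
    (integrable_one_add_abs_pow hh (by norm_num)).const_mul _
  have hp0 := mem_of_mem_nhds hU
  refine ⟨integrable_cyl_of_le (hcont _ hp0) hk (hle _ hp0), ?_, ?_⟩
  · refine hasFDerivAt_integral_of_dominated_of_fderiv_le
      (F := fun (p : ℝ × Plane) (z : ℝ × ℝ) => w z * f₀ p.1 p.2 z.1 z.2)
      (F' := fun p z => w z • dtx f₀ p z)
      (bound := fun z => 2 * K * ((1 + |z.2|) ^ 1 * h z.2)) hU ?_ ?_ ?_ ?_ ?_ ?_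
    · filter_upwards [hU] with p hp
      exact (hw.mul (hslice p hp).continuous).aestronglyMeasurable
    · refine integrable_cyl_of_le (hw.mul (hslice _ hp0).continuous)
        (k := fun ω => K * ((1 + |ω|) ^ 1 * h ω))
        ((integrable_one_add_abs_pow hh (by norm_num)).const_mul _) fun z => ?_
      rw [norm_mul, pow_one, ← mul_assoc]
      exact mul_le_mul (hK z) ((hslice _ hp0).val_le _ _) (abs_nonneg _)
        ((abs_nonneg _).trans (hK z))
    · exact (hcont _ hp0).aestronglyMeasurable
    · exact ae_of_all _ fun z p hp => hle p hp z
    · exact integrable_cyl_snd hk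
    · exact ae_of_all _ fun z p hp => (hasFDerivAt_dtx hI hC1 hp.2.1 z).const_mul (w z)
  · refine continuousAt_of_dominated (bound := fun z => 2 * K * ((1 + |z.2|) ^ 1 * h z.2))
      ?_ ?_ (integrable_cyl_snd hk) ?_
    · filter_upwards [hU] with p hp
      exact (hcont p hp).aestronglyMeasurable
    · filter_upwards [hU] with p hp
      exact ae_of_all _ (hle p hp)
    · refine ae_of_all _ fun z => ContinuousAt.const_smul ?_ (w z)
      exact ((continuousOn_dtx hI hC1).comp (f := fun p : ℝ × Plane => (p, z)) (by fun_prop)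
        (fun p hp => ⟨hp, mem_univ _⟩)).continuousAt
        ((isOpen_timeSpace hI).mem_nhds ⟨ht, mem_univ _⟩)

theorem contDiffOn_moment (hw : Continuous w) (hK : ∀ z : ℝ × ℝ, |w z| ≤ K * (1 + |z.2|)) :
    ContDiffOn ℝ 1 (moment f₀ w) (I ×ˢ univ) := by
  have h := contDiffOn_succ_iff_fderiv_of_isOpen (𝕜 := ℝ) (n := 0) (f := moment f₀ w)
    (isOpen_timeSpace hI)
  rw [zero_add] at h
  refine h.mpr ⟨fun p hp => ?_, by simp, ?_⟩
  · exact (hasFDerivAt_moment hI hf hconv hw hK hp.1 p.2).2.1.differentiableAt.differentiableWithinAt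
  · rw [contDiffOn_zero]
    have hc : ContinuousOn (fun p => ∫ z, w z • dtx f₀ p z ∂cyl) (I ×ˢ univ) := fun p hp =>
      (hasFDerivAt_moment hI hf hconv hw hK hp.1 p.2).2.2.continuousWithinAt
    exact hc.congr fun p hp => (hasFDerivAt_moment hI hf hconv hw hK hp.1 p.2).2.1.fderiv

theorem fderiv_moment_apply (hw : Continuous w) (hK : ∀ z : ℝ × ℝ, |w z| ≤ K * (1 + |z.2|))
    (ht : t ∈ I) (x : Plane) (v : ℝ × Plane) :
    Integrable (fun z => w z * dtx f₀ (t, x) z v) cyl ∧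
      fderiv ℝ (moment f₀ w) (t, x) v = ∫ z, w z * dtx f₀ (t, x) z v ∂cyl := by
  obtain ⟨h1, h2, -⟩ := hasFDerivAt_moment hI hf hconv hw hK ht x
  constructor
  · exact h1.apply_continuousLinearMap v
  · rw [h2.fderiv, ContinuousLinearMap.integral_apply h1]
    rfl

/-- Balance laws of the affine moments. -/
theorem moment_balance (ht : t ∈ I) (x : Plane) (a b : ℝ) :
    fderiv ℝ (moment f₀ fun z => a + b * z.2) (t, x) (1, 0) +
      ∑ i : Fin 2, fderiv ℝ (moment f₀ fun z => tau z.1 i * (a + b * z.2)) (t, x)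
        (0, EuclideanSpace.single i 1) = 0 := by
  obtain ⟨h, hu₀, hb, -⟩ := exists_sliceRegular hf hconv ht x
  have hτ : ∀ i, Continuous fun z : ℝ × ℝ => tau z.1 i := fun i =>
    (EuclideanSpace.proj i : Plane →L[ℝ] ℝ).continuous.comp (continuous_tau.comp continuous_fst)
  have hτ1 : ∀ θ i, |tau θ i| ≤ 1 := fun θ i =>
    (PiLp.norm_apply_le (tau θ) i).trans_eq (norm_tau _)
  obtain ⟨i0, e0⟩ := fderiv_moment_apply hI hf hconv (w := fun z => a + b * z.2) (by fun_prop)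
    (fun z => abs_affine_le a b z.2) ht x (1, 0)
  have hi := fun i : Fin 2 => fderiv_moment_apply hI hf hconv
    (w := fun z => tau z.1 i * (a + b * z.2)) (K := |a| + |b|) ((hτ i).mul (by fun_prop))
    (fun z => by
      rw [abs_mul]
      calc |tau z.1 i| * |a + b * z.2| ≤ 1 * ((|a| + |b|) * (1 + |z.2|)) :=
            mul_le_mul (hτ1 _ _) (abs_affine_le a b z.2) (abs_nonneg _) zero_le_one
        _ = _ := one_mul _) ht x (0, EuclideanSpace.single i 1)
  have hd := (hu₀.dominated_dθ.affine_mul 0 1).affine_mul a b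
  have i3 := hd.integrable le_rfl hu₀.integrable
  obtain ⟨k, hk, hbk⟩ := hd.exists_integrable le_rfl hu₀.integrable
  -- The term ω ∂_θ f₀ has no effect on weights independent of θ, by periodicity.
  have e3 := integral_cyl_dθ (P := fun θ ω => (a + b * ω) * ((0 + 1 * ω) * f₀ t x θ ω))
    (P' := fun θ ω => (a + b * ω) * ((0 + 1 * ω) * deriv (fun s => f₀ t x s ω) θ))
    (fun θ ω => ((hu₀.hasDerivAt_θ θ ω).const_mul _).const_mul _) hd.continuous
    (fun θ ω => by simp only [hu₀.periodic]) hk hbk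
  have hsum := integral_add (i0.add ((hi 0).1.add (hi 1).1)) i3
  have hsum1 := integral_add i0 ((hi 0).1.add (hi 1).1)
  have hsum2 := integral_add (hi 0).1 (hi 1).1
  simp only [Pi.add_apply] at hsum hsum1 hsum2
  rw [e3, hsum1, hsum2, add_zero, ← e0, ← (hi 0).2, ← (hi 1).2] at hsum
  rw [Fin.sum_univ_two]
  refine (hsum.symm.trans (integral_congr_ae (ae_of_all _ fun z => ?_))).trans
    (integral_transport_mul_affine hI hf hconv ht x a b)
  -- Splitting the transport direction into coordinates turns the tested transport into a time
  -- derivative plus a divergence of moments.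
  have hv : ((1, tau z.1) : ℝ × Plane) = (1, 0) +
      (tau z.1 0 • ((0, EuclideanSpace.single 0 1) : ℝ × Plane) +
        tau z.1 1 • ((0, EuclideanSpace.single 1 1) : ℝ × Plane)) := by
    ext j
    · simp
    · fin_cases j <;> simp
  simp only [transport, hv, map_add, map_smul, smul_eq_mul]
  ring

end Moments

/-! ### The balance laws -/

theorem integrable_equilibrium {kω β : ℝ} (hkω : 0 < kω) (hβ : 0 < β) (κ θs ωb A B : ℝ)
    {a : ℝ → ℝ} (ha : Continuous a) :
    Integrable (fun p : ℝ × ℝ => vonMises κ θs p.1 * gauss kω β ωb p.2 *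
      (a p.1 * (A + B * p.2))) cyl := by
  have h1 : Integrable (fun θ => vonMises κ θs θ * a θ)
      (volume.restrict (Ioc (-Real.pi) Real.pi)) :=
    (((continuous_vonMises κ θs).mul ha).continuousOn.integrableOn_Icc).mono_set
      Ioc_subset_Icc_self
  have h2 := ((integrable_gauss hkω hβ ωb).const_mul A).add
    ((integrable_mul_gauss hkω hβ ωb).const_mul B)
  refine (h1.mul_prod h2).congr (ae_of_all _ fun p => ?_)
  simp only [Pi.add_apply]
  ring

theorem eq_inner_add_inner (a : ℝ) (v : Plane) :
    v = inner ℝ (tau a) v • tau a + inner ℝ (perp (tau a)) v • perp (tau a) := by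
  rw [inner_plane, inner_plane]
  have h := Real.sin_sq_add_cos_sq a
  ext i
  fin_cases i
  · change v 0 = (Real.cos a * v 0 + Real.sin a * v 1) * Real.cos a +
      (-Real.sin a * v 0 + Real.cos a * v 1) * -Real.sin a
    linear_combination (-v 0) * h
  · change v 1 = (Real.cos a * v 0 + Real.sin a * v 1) * Real.sin a +
      (-Real.sin a * v 0 + Real.cos a * v 1) * Real.cos a
    linear_combination (-v 1) * h

theorem inner_perp_tau (a θ : ℝ) : inner ℝ (perp (tau a)) (tau θ) = Real.sin (θ - a) := by
  rw [inner_plane, Real.sin_sub]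
  change -Real.sin a * Real.cos θ + Real.cos a * Real.sin θ = _
  ring

theorem tau_eq_rotate (a θ : ℝ) :
    tau θ = Real.cos (θ - a) • tau a + Real.sin (θ - a) • perp (tau a) := by
  rw [← inner_tau_tau, ← inner_perp_tau]
  exact eq_inner_add_inner a (tau θ)

/-- The von Mises density is even and g is odd, so only the odd terms sin and cos · sin contribute.
-/
theorem integral_gci_expansion (κ r0 r1 s1 s2 s3 : ℝ) :
    ∫ θ in (-Real.pi)..Real.pi, vonMises κ 0 θ * (gci κ θ * (r0 + r1 * Real.cos θ +
      s1 * Real.sin θ + s2 * (Real.cos θ * Real.sin θ) + s3 * Real.sin θ ^ 2)) =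
      s1 * K1 κ + s2 * K2 κ := by
  have hv := continuous_vonMises κ 0
  have hg := continuous_gci κ
  have h1 : ∫ θ in (-Real.pi)..Real.pi, vonMises κ 0 θ * (gci κ θ * (r0 + r1 * Real.cos θ +
      s3 * Real.sin θ ^ 2)) = 0 := integral_neg_pi_pi_of_odd (fun θ => by
    simp only [vonMises_neg, gci_neg, Real.cos_neg, Real.sin_neg]
    ring)
  have h2 : ∫ θ in (-Real.pi)..Real.pi, s1 * (Real.sin θ * vonMises κ 0 θ * gci κ θ) =
      s1 * K1 κ := intervalIntegral.integral_const_mul _ _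
  have h3 : ∫ θ in (-Real.pi)..Real.pi,
      s2 * (Real.cos θ * Real.sin θ * vonMises κ 0 θ * gci κ θ) = s2 * K2 κ :=
    intervalIntegral.integral_const_mul _ _
  rw [← h2, ← h3, ← intervalIntegral.integral_add
      (Continuous.intervalIntegrable (by fun_prop) _ _)
      (Continuous.intervalIntegrable (by fun_prop) _ _)]
  refine Eq.trans ?_ ((intervalIntegral.integral_add
    (Continuous.intervalIntegrable (by fun_prop) _ _)
    (Continuous.intervalIntegrable (by fun_prop) _ _)).trans
      ((congrArg (· + _) h1).trans (zero_add _)))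
  refine intervalIntegral.integral_congr fun θ _ => ?_
  ring

/-- Extraction of the equation for the direction from the invariant. -/
theorem direction_eq_of_integral {κ : ℝ} (hκ : 0 < κ) (θs ρ ωb : ℝ)
    (R : (ℝ × Plane) →L[ℝ] ℝ) (W : (ℝ × Plane) →L[ℝ] Plane)
    (hW : ∀ v, inner ℝ (tau θs) (W v) = 0)
    (hint : ∫ θ in (-Real.pi)..Real.pi, vonMises κ θs θ * (gci κ (θ - θs) *
      (R (1, tau θ) + ρ * κ * inner ℝ (tau θ) (W (1, tau θ))
        - ωb * (ρ * κ) * Real.sin (θ - θs))) = 0) :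
    ρ * (inner ℝ (perp (tau θs)) (W (1, 0)) + c2 κ * inner ℝ (perp (tau θs)) (W (0, tau θs)) - ωb)
      + 1 / κ * R (0, perp (tau θs)) = 0 := by
  set Ω := tau θs
  -- W takes values orthogonal to Ω, so this single coordinate along Ω^⊥ determines it.
  set l : ℝ × Plane → ℝ := fun v => inner ℝ (perp Ω) (W v) with hl
  have hdec : ∀ θ, ((1, tau θ) : ℝ × Plane) =
      (1, 0) + (Real.cos (θ - θs) • (0, Ω) + Real.sin (θ - θs) • (0, perp Ω)) := fun θ => by
    conv_lhs => rw [tau_eq_rotate θs θ]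
    simp [Ω]
  have hWin : ∀ θ v, inner ℝ (tau θ) (W v) = Real.sin (θ - θs) * l v := fun θ v => by
    rw [tau_eq_rotate θs θ, inner_add_left, real_inner_smul_left, real_inner_smul_left]
    change _ * inner ℝ (tau θs) (W v) + _ = _
    rw [hW, mul_zero, zero_add]
  have hladd : ∀ v v', l (v + v') = l v + l v' := fun v v' => by
    simp only [hl, map_add, inner_add_right]
  have hlsmul : ∀ (c : ℝ) v, l (c • v) = c * l v := fun c v => by
    simp only [hl, map_smul, real_inner_smul_right]
  -- In the frame (Ω, Ω^⊥), with angles measured from θs, the bracket becomes a trigonometric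
  -- polynomial; periodicity permits the shift by θs.
  have hF : Function.Periodic (fun Γ => vonMises κ 0 Γ * (gci κ Γ * (R (1, 0) +
      R (0, Ω) * Real.cos Γ +
      (R (0, perp Ω) + ρ * κ * l (1, 0) - ωb * (ρ * κ)) * Real.sin Γ +
      (ρ * κ * l (0, Ω)) * (Real.cos Γ * Real.sin Γ) +
      (ρ * κ * l (0, perp Ω)) * Real.sin Γ ^ 2))) (2 * Real.pi) := fun Γ => by
    simp only [periodic_vonMises κ 0 Γ, periodic_gci κ Γ, Real.sin_add_two_pi,
      Real.cos_add_two_pi]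
  have h1 := integral_comp_sub_of_periodic hF θs
  rw [integral_gci_expansion] at h1
  -- The derivative of Ω in the direction Ω^⊥ appears only with sin², hence drops out. Division by κ
  -- K1 then gives the claim.
  have h2 : (R (0, perp Ω) + ρ * κ * l (1, 0) - ωb * (ρ * κ)) * K1 κ +
      ρ * κ * l (0, Ω) * K2 κ = 0 := by
    refine h1.symm.trans (Eq.trans (intervalIntegral.integral_congr fun θ _ => ?_) hint)
    beta_reduce
    rw [hWin θ (1, tau θ), hdec θ]
    simp only [map_add, map_smul, hladd, hlsmul, smul_eq_mul, ← vonMises_sub]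
    ring
  have hK := (K1_pos hκ).ne'
  change ρ * (l (1, 0) + c2 κ * l (0, Ω) - ωb) + _ = 0
  rw [c2]
  field_simp
  linear_combination h2

/-! ### Conservation laws and regularity of the macroscopic fields -/

section Macro

variable {kθ kω α β : ℝ} {I : Set ℝ} {f : ℝ → PhaseFun} {f₀ : PhaseFun} {t : ℝ} {x : Plane}
  (hkθ : 0 < kθ) (hkω : 0 < kω) (hα : 0 < α) (hβ : 0 < β)
  (hI : IsOpen I) (hf : IsScaledSolution kθ kω α β I f) (hconv : ConvergesStrongly I f f₀)
include hkθ hkω hα hβ hI hf hconv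

theorem moment_affine_eq (ht : t ∈ I) (x : Plane) (a b : ℝ) :
    moment f₀ (fun z => a + b * z.2) (t, x) =
      mass (f₀ t x) * (a + b * meanAngVel (f₀ t x)) := by
  have h1 := integral_equilibrium hkω hβ (kθ / α ^ 2) (meanAngle (f₀ t x)) (meanAngVel (f₀ t x))
    (mass (f₀ t x)) a b (fun _ => 1)
  simp only [mul_one, integral_vonMises,
    ← limit_eq hkθ hkω hα hβ hI hf hconv ht x, one_mul] at h1
  rw [← h1]
  exact integral_congr_ae (ae_of_all _ fun z => mul_comm _ _)

theorem moment_tau_eq (ht : t ∈ I) (x : Plane) (a b : ℝ) (i : Fin 2) :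
    moment f₀ (fun z => tau z.1 i * (a + b * z.2)) (t, x) =
      c1 (kθ / α ^ 2) * (mass (f₀ t x) * (a + b * meanAngVel (f₀ t x)) *
        tau (meanAngle (f₀ t x)) i) := by
  have h1 := integral_equilibrium hkω hβ (kθ / α ^ 2) (meanAngle (f₀ t x)) (meanAngVel (f₀ t x))
    (mass (f₀ t x)) a b (fun θ => tau θ i)
  simp only [integral_vonMises_mul_tau, ← limit_eq hkθ hkω hα hβ hI hf hconv ht x] at h1
  rw [← mul_assoc, mul_right_comm, mul_assoc, mul_comm, mul_right_comm] at h1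
  refine Eq.trans (integral_congr_ae (ae_of_all _ fun z => mul_comm _ _)) (h1.trans ?_)
  ring

omit hkθ hkω hα hβ in
theorem contDiffOn_moment_affine (a b : ℝ) :
    ContDiffOn ℝ 1 (moment f₀ fun z => a + b * z.2) (I ×ˢ univ) :=
  contDiffOn_moment hI hf hconv (by fun_prop) fun z => abs_affine_le a b z.2

omit hkθ hkω hα hβ in
theorem contDiffOn_moment_tau (a b : ℝ) (i : Fin 2) :
    ContDiffOn ℝ 1 (moment f₀ fun z => tau z.1 i * (a + b * z.2)) (I ×ˢ univ) := by
  have hτ : Continuous fun z : ℝ × ℝ => tau z.1 i :=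
    (EuclideanSpace.proj i : Plane →L[ℝ] ℝ).continuous.comp (continuous_tau.comp continuous_fst)
  refine contDiffOn_moment hI hf hconv (K := |a| + |b|) (hτ.mul (by fun_prop)) fun z => ?_
  rw [abs_mul]
  calc |tau z.1 i| * |a + b * z.2| ≤ 1 * ((|a| + |b|) * (1 + |z.2|)) :=
        mul_le_mul ((PiLp.norm_apply_le (tau z.1) i).trans_eq (norm_tau _))
          (abs_affine_le a b z.2) (abs_nonneg _) zero_le_one
    _ = _ := one_mul _

theorem contDiffOn_density (a b : ℝ) :
    ContDiffOn ℝ 1 (fun p : ℝ × Plane => mass (f₀ p.1 p.2) * (a + b * meanAngVel (f₀ p.1 p.2)))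
      (I ×ˢ univ) :=
  (contDiffOn_moment_affine hI hf hconv a b).congr fun p hp =>
    (moment_affine_eq hkθ hkω hα hβ hI hf hconv hp.1 p.2 a b).symm

/-- The flux is a moment of f₀ divided by c1 > 0, hence C¹ even across the vacuum, where the
direction may jump. -/
theorem contDiffOn_flux (a b : ℝ) :
    ContDiffOn ℝ 1 (fun p : ℝ × Plane => (mass (f₀ p.1 p.2) * (a + b * meanAngVel (f₀ p.1 p.2))) •
      tau (meanAngle (f₀ p.1 p.2))) (I ×ˢ univ) := by
  have hc := (c1_pos (κ := kθ / α ^ 2) (by positivity)).ne'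
  refine contDiffOn_euclidean.mpr fun i => ?_
  refine ((contDiffOn_moment_tau hI hf hconv a b i).const_smul (c1 (kθ / α ^ 2))⁻¹).congr
    fun p hp => ?_
  have h1 := moment_tau_eq hkθ hkω hα hβ hI hf hconv hp.1 p.2 a b i
  simp only [PiLp.smul_apply, smul_eq_mul] at h1 ⊢
  rw [h1, inv_mul_cancel_left₀ hc]

/-- The pair (a, b) = (1, 0) gives conservation of mass and (0, 1) that of angular momentum; both
come from the balance of moments once these are evaluated on the equilibrium. -/
theorem macro_balance (ht : t ∈ I) (x : Plane) (a b : ℝ) :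
    deriv (fun s => mass (f₀ s x) * (a + b * meanAngVel (f₀ s x))) t + c1 (kθ / α ^ 2) *
      div (fun y => (mass (f₀ t y) * (a + b * meanAngVel (f₀ t y))) • tau (meanAngle (f₀ t y))) x
      = 0 := by
  have hc := (c1_pos (κ := kθ / α ^ 2) (by positivity)).ne'
  have hmem : I ×ˢ (univ : Set Plane) ∈ 𝓝 (t, x) :=
    (isOpen_timeSpace hI).mem_nhds ⟨ht, mem_univ _⟩
  have h1 : deriv (fun s => mass (f₀ s x) * (a + b * meanAngVel (f₀ s x))) t =
      fderiv ℝ (moment f₀ fun z => a + b * z.2) (t, x) (1, 0) := by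
    have hd := (((contDiffOn_moment_affine hI hf hconv a b).differentiableOn
      (by simp)).differentiableAt hmem).hasFDerivAt
    have hd' := HasFDerivAt.comp_hasDerivAt t (f := fun s => (s, x)) hd
      ((hasDerivAt_id t).prodMk (hasDerivAt_const t x))
    refine (hd'.congr_of_eventuallyEq ?_).deriv
    filter_upwards [hI.mem_nhds ht] with s hs
    exact (moment_affine_eq hkθ hkω hα hβ hI hf hconv hs x a b).symm
  have hF : DifferentiableAt ℝ (fun y => (mass (f₀ t y) * (a + b * meanAngVel (f₀ t y))) •
      tau (meanAngle (f₀ t y))) x :=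
    DifferentiableAt.comp x (f := fun y : Plane => (t, y)) (((contDiffOn_flux hkθ hkω hα hβ hI hf
      hconv a b).differentiableOn (by simp)).differentiableAt hmem) (by fun_prop)
  have h2 : ∀ i, c1 (kθ / α ^ 2) * (fderiv ℝ (fun y => (mass (f₀ t y) *
      (a + b * meanAngVel (f₀ t y))) • tau (meanAngle (f₀ t y))) x (EuclideanSpace.single i 1)) i =
      fderiv ℝ (moment f₀ fun z => tau z.1 i * (a + b * z.2)) (t, x)
        (0, EuclideanSpace.single i 1) := by
    intro i
    have hd := (((contDiffOn_moment_tau hI hf hconv a b i).differentiableOn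
      (by simp)).differentiableAt hmem).hasFDerivAt
    have hd' := HasFDerivAt.comp x (f := fun y : Plane => (t, y)) hd (hasFDerivAt_prodMk_right t x)
    have he := ((EuclideanSpace.proj i : Plane →L[ℝ] ℝ).hasFDerivAt.comp x
      hF.hasFDerivAt).const_mul (c1 (kθ / α ^ 2))
    have hu := (hd'.congr_of_eventuallyEq (Eventually.of_forall fun y => ?_)).unique he
    · exact (congrArg (fun L : Plane →L[ℝ] ℝ => L (EuclideanSpace.single i 1)) hu).symm
    · exact (moment_tau_eq hkθ hkω hα hβ hI hf hconv ht y a b i).symm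
  rw [h1, div, Finset.mul_sum]
  simp only [h2]
  exact moment_balance hI hf hconv ht x a b

theorem contDiffOn_mass :
    ContDiffOn ℝ 1 (fun p : ℝ × Plane => mass (f₀ p.1 p.2)) (I ×ˢ univ) := by
  simpa using contDiffOn_density hkθ hkω hα hβ hI hf hconv 1 0

theorem isOpen_massPositive : IsOpen {p : ℝ × Plane | p.1 ∈ I ∧ 0 < mass (f₀ p.1 p.2)} := by
  have h := (contDiffOn_mass hkθ hkω hα hβ hI hf hconv).continuousOn.isOpen_inter_preimage
    (isOpen_timeSpace hI) (isOpen_Ioi (a := 0))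
  have he : {p : ℝ × Plane | p.1 ∈ I ∧ 0 < mass (f₀ p.1 p.2)} =
      (I ×ˢ univ) ∩ (fun p : ℝ × Plane => mass (f₀ p.1 p.2)) ⁻¹' Ioi 0 := by
    ext p
    simp
  rw [he]
  exact h

/-- The direction is recovered as (ρΩ)/ρ, which avoids differentiating the angle. -/
theorem contDiffOn_direction : ContDiffOn ℝ 1
    (fun p : ℝ × Plane => tau (meanAngle (f₀ p.1 p.2)))
    {p : ℝ × Plane | p.1 ∈ I ∧ 0 < mass (f₀ p.1 p.2)} := by
  have hsub : {p : ℝ × Plane | p.1 ∈ I ∧ 0 < mass (f₀ p.1 p.2)} ⊆ I ×ˢ univ :=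
    fun p hp => ⟨hp.1, mem_univ _⟩
  have h1 := ((contDiffOn_mass hkθ hkω hα hβ hI hf hconv).mono hsub).inv fun p hp => hp.2.ne'
  refine (h1.smul ((contDiffOn_flux hkθ hkω hα hβ hI hf hconv 1 0).mono hsub)).congr
    fun p hp => ?_
  simp [smul_smul, inv_mul_cancel₀ hp.2.ne']

theorem contDiffOn_meanAngVel : ContDiffOn ℝ 1
    (fun p : ℝ × Plane => meanAngVel (f₀ p.1 p.2))
    {p : ℝ × Plane | p.1 ∈ I ∧ 0 < mass (f₀ p.1 p.2)} := by
  have hsub : {p : ℝ × Plane | p.1 ∈ I ∧ 0 < mass (f₀ p.1 p.2)} ⊆ I ×ˢ univ :=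
    fun p hp => ⟨hp.1, mem_univ _⟩
  have h1 := ((contDiffOn_mass hkθ hkω hα hβ hI hf hconv).mono hsub).inv fun p hp => hp.2.ne'
  refine (h1.mul ((contDiffOn_density hkθ hkω hα hβ hI hf hconv 0 1).mono hsub)).congr
    fun p hp => ?_
  simp [inv_mul_cancel_left₀ hp.2.ne']

end Macro

/-! ### The orientation equation -/

section Orientation

variable {kθ kω α β : ℝ} {I : Set ℝ} {f : ℝ → PhaseFun} {f₀ : PhaseFun} {t : ℝ} {x : Plane}

/-- Differentiate ‖u‖² = 1. -/
theorem inner_unit_fderiv {u : ℝ × Plane → Plane} {W : (ℝ × Plane) →L[ℝ] Plane} {p : ℝ × Plane}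
    (hu : ∀ q, ‖u q‖ = 1) (hW : HasFDerivAt u W p) (v : ℝ × Plane) : inner ℝ (u p) (W v) = 0 := by
  have h1 := hW.inner ℝ hW
  have h2 : (fun q => inner ℝ (u q) (u q)) = fun _ => (1 : ℝ) := funext fun q => by
    rw [real_inner_self_eq_norm_sq, hu, one_pow]
  rw [h2] at h1
  have h3 := congrArg (fun L : (ℝ × Plane) →L[ℝ] ℝ => L v) (h1.unique (hasFDerivAt_const 1 p))
  simp only [ContinuousLinearMap.comp_apply, ContinuousLinearMap.prod_apply, fderivInnerCLM_apply,
    zero_apply, real_inner_comm (u p) (W v)] at h3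
  linarith

variable (hkθ : 0 < kθ) (hkω : 0 < kω) (hα : 0 < α) (hβ : 0 < β)
  (hI : IsOpen I) (hf : IsScaledSolution kθ kω α β I f) (hconv : ConvergesStrongly I f f₀)
include hkθ hkω hα hβ hI hf hconv

/-- The `(t, x)`-derivative of a local equilibrium. -/
theorem dtx_limit_apply (ht : t ∈ I) {R : (ℝ × Plane) →L[ℝ] ℝ} {W : (ℝ × Plane) →L[ℝ] Plane}
    {m : (ℝ × Plane) →L[ℝ] ℝ}
    (hR : HasFDerivAt (fun p : ℝ × Plane => mass (f₀ p.1 p.2)) R (t, x))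
    (hW : HasFDerivAt (fun p : ℝ × Plane => tau (meanAngle (f₀ p.1 p.2))) W (t, x))
    (hm : HasFDerivAt (fun p : ℝ × Plane => meanAngVel (f₀ p.1 p.2)) m (t, x))
    (z : ℝ × ℝ) (v : ℝ × Plane) :
    dtx f₀ (t, x) z v = vonMises (kθ / α ^ 2) (meanAngle (f₀ t x)) z.1 *
      gauss kω β (meanAngVel (f₀ t x)) z.2 * (R v +
        mass (f₀ t x) * (kθ / α ^ 2) * inner ℝ (tau z.1) (W v) +
        mass (f₀ t x) * (kω / β ^ 2 * (z.2 - meanAngVel (f₀ t x))) * m v) := by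
  -- The von Mises factor is differentiated through the unit vector, the angle being possibly
  -- discontinuous.
  have hE := (((innerSL ℝ (tau z.1)).hasFDerivAt.comp (t, x) hW).const_mul
    (kθ / α ^ 2)).exp.const_mul (2 * halfNorm (kθ / α ^ 2))⁻¹
  have hG := (hasDerivAt_gauss kω β (meanAngVel (f₀ t x)) z.2).comp_hasFDerivAt (t, x) hm
  have hprod := hR.mul (hE.mul hG)
  have hmem : I ×ˢ (univ : Set Plane) ∈ 𝓝 (t, x) :=
    (isOpen_timeSpace hI).mem_nhds ⟨ht, mem_univ _⟩
  have hvm : ∀ p : ℝ × Plane, (2 * halfNorm (kθ / α ^ 2))⁻¹ * Real.exp (kθ / α ^ 2 *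
      inner ℝ (tau z.1) (tau (meanAngle (f₀ p.1 p.2)))) =
      vonMises (kθ / α ^ 2) (meanAngle (f₀ p.1 p.2)) z.1 := fun p => by
    rw [vonMises_eq_of_tau, real_inner_comm]
  have hd := (hprod.congr_of_eventuallyEq (f₁ := fun p : ℝ × Plane => f₀ p.1 p.2 z.1 z.2) (by
    filter_upwards [hmem] with p hp
    rw [limit_eq hkθ hkω hα hβ hI hf hconv hp.1 p.2, ← hvm]
    rfl)).unique (hasFDerivAt_dtx hI (hconv.contDiff.of_le (by norm_num)) (p := (t, x)) ht z)
  rw [← hd]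
  have hv := hvm (t, x)
  simp only at hv
  simp [hv, -mul_inv_rev, -one_div]
  rw [← hv]
  ring

/-- The equilibrium is inserted into the relation for g and ω is integrated out. The derivative of
ω̄ disappears, and the rotation term ω ∂_θ contributes through its mean ω̄. -/
theorem integral_direction (ht : t ∈ I) {θs : ℝ} {R : (ℝ × Plane) →L[ℝ] ℝ}
    {W : (ℝ × Plane) →L[ℝ] Plane} {m : (ℝ × Plane) →L[ℝ] ℝ}
    (hθs : tau (meanAngle (f₀ t x)) = tau θs)
    (heq : ∀ θ ω, f₀ t x θ ω = mass (f₀ t x) *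
      (vonMises (kθ / α ^ 2) θs θ * gauss kω β (meanAngVel (f₀ t x)) ω))
    (hgci : ∫ p, transport f₀ t x p * gci (kθ / α ^ 2) (p.1 - θs) ∂cyl = 0)
    (hR : HasFDerivAt (fun p : ℝ × Plane => mass (f₀ p.1 p.2)) R (t, x))
    (hW : HasFDerivAt (fun p : ℝ × Plane => tau (meanAngle (f₀ p.1 p.2))) W (t, x))
    (hm : HasFDerivAt (fun p : ℝ × Plane => meanAngVel (f₀ p.1 p.2)) m (t, x)) :
    ∫ θ in (-Real.pi)..Real.pi, vonMises (kθ / α ^ 2) θs θ * (gci (kθ / α ^ 2) (θ - θs) *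
      (R (1, tau θ) + mass (f₀ t x) * (kθ / α ^ 2) * inner ℝ (tau θ) (W (1, tau θ))
        - meanAngVel (f₀ t x) * (mass (f₀ t x) * (kθ / α ^ 2)) * Real.sin (θ - θs))) = 0 := by
  set κ := kθ / α ^ 2
  set ρ := mass (f₀ t x)
  set ωb := meanAngVel (f₀ t x)
  have hg := continuous_gci κ
  have hτ := continuous_tau
  have hvc := continuous_vonMises κ θs
  have cR : Continuous fun θ => R (1, tau θ) := by fun_prop
  have cW : Continuous fun θ => W (1, tau θ) := by fun_prop
  have cm : Continuous fun θ => m (1, tau θ) := by fun_prop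
  -- The three angular profiles: `a₁` from the derivatives of ρ and Ω, `a₂` from ω ∂_θ f₀ with
  -- weight ω, `a₃` from the derivative of ω̄ with weight ω − ω̄.
  set a₁ : ℝ → ℝ := fun θ => gci κ (θ - θs) *
    (R (1, tau θ) + ρ * κ * inner ℝ (tau θ) (W (1, tau θ))) with ha₁
  set a₂ : ℝ → ℝ := fun θ => gci κ (θ - θs) * (-(ρ * κ) * Real.sin (θ - θs)) with ha₂
  set a₃ : ℝ → ℝ := fun θ => gci κ (θ - θs) * (ρ * (kω / β ^ 2) * m (1, tau θ)) with ha₃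
  have c₁ : Continuous a₁ := by fun_prop
  have c₂ : Continuous a₂ := by fun_prop
  have c₃ : Continuous a₃ := by fun_prop
  have i₁ := integrable_equilibrium hkω hβ κ θs ωb 1 0 c₁
  have i₂ := integrable_equilibrium hkω hβ κ θs ωb 0 1 c₂
  have i₃ := integrable_equilibrium hkω hβ κ θs ωb (-ωb) 1 c₃
  have e₁ := integral_equilibrium hkω hβ κ θs ωb 1 1 0 a₁
  have e₂ := integral_equilibrium hkω hβ κ θs ωb 1 0 1 a₂
  -- The weight ω − ω̄ has zero mean, so this integral is zero whatever the derivative of ω̄.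
  have e₃ := integral_equilibrium hkω hβ κ θs ωb 1 (-ωb) 1 a₃
  simp only [one_mul] at e₁ e₂ e₃
  have hs₁ := integral_add i₁ (i₂.add i₃)
  have hs₂ := integral_add i₂ i₃
  simp only [Pi.add_apply, one_mul] at hs₁ hs₂ i₁ i₂ i₃
  rw [hs₂, e₁, e₂, e₃] at hs₁
  have hT : ∀ p : ℝ × ℝ, transport f₀ t x p * gci κ (p.1 - θs) =
      vonMises κ θs p.1 * gauss kω β ωb p.2 * (a₁ p.1 * (1 + 0 * p.2)) +
        (vonMises κ θs p.1 * gauss kω β ωb p.2 * (a₂ p.1 * (0 + p.2)) +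
          vonMises κ θs p.1 * gauss kω β ωb p.2 * (a₃ p.1 * (-ωb + p.2))) := fun p => by
    have hdθ : deriv (fun s => f₀ t x s p.2) p.1 =
        ρ * (-κ * Real.sin (p.1 - θs) * vonMises κ θs p.1 * gauss kω β ωb p.2) := by
      simp only [heq]
      exact (((hasDerivAt_vonMises κ θs p.1).mul_const _).const_mul ρ).deriv
    have hv : vonMises κ (meanAngle (f₀ t x)) p.1 = vonMises κ θs p.1 := by
      rw [vonMises_eq_of_tau, hθs, ← vonMises_eq_of_tau]
    rw [transport, hdθ, dtx_limit_apply hkθ hkω hα hβ hI hf hconv ht hR hW hm, hv]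
    simp only [ha₁, ha₂, ha₃]
    ring
  have hz := (integral_congr_ae (ae_of_all cyl hT)).symm.trans hgci
  rw [hs₁] at hz
  have hn : ∫ θ in (-Real.pi)..Real.pi, (vonMises κ θs θ * a₁ θ +
      ωb * (vonMises κ θs θ * a₂ θ)) = 0 := by
    rw [intervalIntegral.integral_add (Continuous.intervalIntegrable (by fun_prop) _ _)
      (Continuous.intervalIntegrable (by fun_prop) _ _), intervalIntegral.integral_const_mul]
    linear_combination hz
  refine Eq.trans (intervalIntegral.integral_congr fun θ _ => ?_) hn
  simp only [ha₁, ha₂]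
  ring

/-- Every vector in the equation is a multiple of Ω^⊥: the derivatives of Ω because |Ω| = 1, the
pressure term by projection. The equation is thus the scalar identity of `direction_eq_of_integral`
times Ω^⊥. -/
theorem orientation_eq (ht : t ∈ I) (x : Plane) :
    mass (f₀ t x) • (deriv (fun s => tau (meanAngle (f₀ s x))) t +
        c2 (kθ / α ^ 2) • fderiv ℝ (fun y => tau (meanAngle (f₀ t y))) x (tau (meanAngle (f₀ t x)))
        - meanAngVel (f₀ t x) • perp (tau (meanAngle (f₀ t x))))
      + (1 / (kθ / α ^ 2)) • projPerp (tau (meanAngle (f₀ t x)))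
        (gradient (fun y => mass (f₀ t y)) x) = 0 := by
  have hκ : 0 < kθ / α ^ 2 := by positivity
  rcases (mass_nonneg_limit hf hconv ht x).eq_or_lt with h0 | hpos
  -- At a vacuum point the nonnegative density is minimal in x, so its gradient vanishes and both
  -- terms are zero.
  · have hmin : IsLocalMin (fun y => mass (f₀ t y)) x := Eventually.of_forall fun y => by
      change mass (f₀ t x) ≤ mass (f₀ t y)
      rw [← h0]
      exact mass_nonneg_limit hf hconv ht y
    rw [← h0, gradient, hmin.fderiv_eq_zero]
    simp [projPerp]
  have hU : {p : ℝ × Plane | p.1 ∈ I ∧ 0 < mass (f₀ p.1 p.2)} ∈ 𝓝 (t, x) :=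
    (isOpen_massPositive hkθ hkω hα hβ hI hf hconv).mem_nhds
      (show (t, x) ∈ _ from ⟨ht, hpos⟩)
  have hR := (((contDiffOn_mass hkθ hkω hα hβ hI hf hconv).differentiableOn
    (by simp)).differentiableAt ((isOpen_timeSpace hI).mem_nhds
      (show (t, x) ∈ I ×ˢ univ from ⟨ht, mem_univ x⟩))).hasFDerivAt
  have hW := (((contDiffOn_direction hkθ hkω hα hβ hI hf hconv).differentiableOn
    (by simp)).differentiableAt hU).hasFDerivAt
  have hm := (((contDiffOn_meanAngVel hkθ hkω hα hβ hI hf hconv).differentiableOn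
    (by simp)).differentiableAt hU).hasFDerivAt
  set R := fderiv ℝ (fun p : ℝ × Plane => mass (f₀ p.1 p.2)) (t, x)
  set W := fderiv ℝ (fun p : ℝ × Plane => tau (meanAngle (f₀ p.1 p.2))) (t, x)
  obtain ⟨e, θs, he, hθ⟩ := exists_seq_tendsto_meanAngle f t x
  have hθs := tau_meanAngle_limit hkθ hkω hα hβ hI hf hconv ht he hθ hpos.ne'
  have hWorth : ∀ v, inner ℝ (tau θs) (W v) = 0 := fun v => by
    rw [← hθs]
    exact inner_unit_fderiv (fun q => norm_tau _) hW v
  have key := direction_eq_of_integral hκ θs (mass (f₀ t x)) (meanAngVel (f₀ t x)) R W hWorth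
    (integral_direction hkθ hkω hα hβ hI hf hconv ht hθs
      (limit_eq_equilibrium hkω hα hβ hI hf hconv ht he hθ)
      (integral_transport_mul_gci hkθ hα hI hf hconv ht he hθ) hR hW hm)
  have hWt : deriv (fun s => tau (meanAngle (f₀ s x))) t = W (1, 0) :=
    (HasFDerivAt.comp_hasDerivAt t (f := fun s => (s, x)) hW
      ((hasDerivAt_id t).prodMk (hasDerivAt_const t x))).deriv
  have hWx : fderiv ℝ (fun y => tau (meanAngle (f₀ t y))) x (tau (meanAngle (f₀ t x))) =
      W (0, tau θs) := by
    have h1 : HasFDerivAt (fun y => tau (meanAngle (f₀ t y)))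
        (W.comp (ContinuousLinearMap.inr ℝ ℝ Plane)) x :=
      HasFDerivAt.comp x (f := fun y => (t, y)) hW (hasFDerivAt_prodMk_right t x)
    rw [h1.fderiv, hθs]
    simp
  have hRx : ∀ v, inner ℝ v (gradient (fun y => mass (f₀ t y)) x) = R (0, v) := fun v => by
    have h1 : HasFDerivAt (fun y => mass (f₀ t y))
        (R.comp (ContinuousLinearMap.inr ℝ ℝ Plane)) x :=
      HasFDerivAt.comp x (f := fun y => (t, y)) hR (hasFDerivAt_prodMk_right t x)
    rw [inner_gradient_right, h1.fderiv]
    simp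
  have hWl : ∀ v, W v = inner ℝ (perp (tau θs)) (W v) • perp (tau θs) := fun v => by
    conv_lhs => rw [eq_inner_add_inner θs (W v), hWorth, zero_smul, zero_add]
  have hproj : projPerp (tau θs) (gradient (fun y => mass (f₀ t y)) x) =
      R (0, perp (tau θs)) • perp (tau θs) := by
    rw [← hRx, projPerp, sub_eq_iff_eq_add']
    exact eq_inner_add_inner θs _
  rw [hWt, hWx, hθs, hproj, hWl (1, 0), hWl (0, tau θs)]
  have hkey := congrArg (fun r : ℝ => r • perp (tau θs)) key
  simp only [zero_smul] at hkey
  refine Eq.trans ?_ hkey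
  module

end Orientation

end VK

end

theorem mainTheorem1 (kθ kω α β : ℝ) (hkθ : 0 < kθ) (hkω : 0 < kω) (hα : 0 < α) (hβ : 0 < β)
    (I : Set ℝ) (hI : IsOpen I) (f : ℝ → VK.PhaseFun) (f₀ : VK.PhaseFun)
    (hf : VK.IsScaledSolution kθ kω α β I f) (hconv : VK.ConvergesStrongly I f f₀) :
    (∀ t ∈ I, ∀ x θ ω,
      f₀ t x θ ω = VK.mass (f₀ t x) * VK.vonMises (kθ / α ^ 2) (VK.meanAngle (f₀ t x)) θ
          * VK.gauss kω β (VK.meanAngVel (f₀ t x)) ω) ∧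
    VK.K1 (kθ / α ^ 2) ≠ 0 ∧
    VK.IsMacroSolution (kθ / α ^ 2) I (fun t x => VK.mass (f₀ t x))
      (fun t x => VK.tau (VK.meanAngle (f₀ t x))) (fun t x => VK.meanAngVel (f₀ t x)) := by
  have hκ : 0 < kθ / α ^ 2 := by positivity
  refine ⟨fun t ht x θ ω => ?_, (VK.K1_pos hκ).ne', ?_, ?_, ?_, ?_, ?_, ?_, ?_, ?_, ?_⟩
  · rw [mul_assoc]
    exact VK.limit_eq hkθ hkω hα hβ hI hf hconv ht x θ ω
  · exact VK.contDiffOn_mass hkθ hkω hα hβ hI hf hconv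
  · simpa using VK.contDiffOn_flux hkθ hkω hα hβ hI hf hconv 1 0
  · simpa using VK.contDiffOn_density hkθ hkω hα hβ hI hf hconv 0 1
  · simpa using VK.contDiffOn_flux hkθ hkω hα hβ hI hf hconv 0 1
  · exact VK.contDiffOn_direction hkθ hkω hα hβ hI hf hconv
  · exact VK.contDiffOn_meanAngVel hkθ hkω hα hβ hI hf hconv
  · intro t ht x
    simpa using VK.macro_balance hkθ hkω hα hβ hI hf hconv ht x 1 0
  · intro t ht x
    simpa using VK.macro_balance hkθ hkω hα hβ hI hf hconv ht x 0 1
  · exact fun t ht x => VK.orientation_eq hkθ hkω hα hβ hI hf hconv ht x
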